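/- **Setting.** Let $0<\tau<\beta$, and let $A,B\in\mathbb R$, $A\neq0$. On $\mathbb R^3\times[0,\infty)$ consider the Jordan–Moore–Gibson–Thompson system (with sound speed $c=1$) $$u_t=v,\qquad v_t=w,\qquad \tau w_t=\Delta u+\beta\Delta v-w+\tfrac BA\,vw+2\nabla u\cdot\nabla v,\qquad (u,v,w)|_{t=0}=(u_0,u_1,u_2),$$ where all functions may be complex-valued. Write $\mathbf U=(u,v,w)$, $\mathbf U_0=(u_0,u_1,u_2)$, $$\mathbf V=(v+\tau w,\ \nabla(u+\tau v),\ \nabla v),\qquad \mathbf V_0=(u_1+\tau u_2,\ \nabla(u_0+\tau u_1),\ \nabla u_1).$$ **Norms.** Fix smooth $\varphi,\chi:\mathbb R^3\to[0,1]$ with $\operatorname{supp}\varphi\subset\{\frac34\le|\xi|\le\frac83\}$, $\operatorname{supp}\chi\subset\{|\xi|\le\frac43\}$, $\chi(\xi)+\sum_{q\ge0}\varphi(2^{-q}\xi)=1$ for all $\xi$ and $\sum_{q\in\mathbb Z}\varphi(2^{-q}\xi)=1$ for $\xi\ne0$. With $D=-i\nabla$ put $\dot\Delta_q=\varphi(2^{-q}D)$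 and $\Delta_{-1}=\chi(D)$, and $$\|f\|_{\dot B^s_{2,1}}=\sum_{q\in\mathbb Z}2^{qs}\|\dot\Delta_qf\|_{L^2},\quad \|f\|_{\dot B^s_{2,\infty}}=\sup_{q\in\mathbb Z}2^{qs}\|\dot\Delta_qf\|_{L^2},\quad \|f\|_{B^s_{2,1}}=2^{-s}\|\Delta_{-1}f\|_{L^2}+\sum_{q\ge0}2^{qs}\|\dot\Delta_qf\|_{L^2}.$$ The operator $\Lambda^\ell$ multiplies the Fourier transform $\int e^{-2\pi ix\cdot\xi}f(x)\,dx$ by $|\xi|^\ell$. For $X=L^2$ or $X=\dot B^s_{2,1}$ let $\|\mathbf U\|_{(X)}$ be the square root of $$\|v+\tau w\|_X^2+\|\nabla(v+\tau w)\|_X^2+\|\Delta v\|_X^2+\|\nabla v\|_X^2+\|\Delta(u+\tau v)\|_X^2+\|\nabla(u+\tau v)\|_X^2+\|w\|_X^2,$$ and, for $s>0$, $\|\mathbf U\|_{\mathcal B^s_{2,1}}=\|\mathbf U\|_{(L^2)}+\|\mathbf U\|_{(\dot B^s_{2,1})}$. Let $\|\mathbf U\|_{\widetilde L^\infty(\mathcal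 B^s_{2,1})}$ be the sum, over the same seven quantities $f$, of $\sup_{t\ge0}\|f(t)\|_{L^2}+\sum_{q\in\mathbb Z}2^{qs}\sup_{t\ge0}\|\dot\Delta_qf(t)\|_{L^2}$. A *global solution* is a triple $\mathbf U$ of functions in $C^1([0,\infty);L^2)$ that satisfies the system for all $t\ge0$ and such that $\mathbf U\in C([0,\infty);\mathcal B^{3/2}_{2,1})\cap C^1([0,\infty);\mathcal B^{1/2}_{2,1})$, $\|\mathbf U\|_{\widetilde L^\infty(\mathcal B^{3/2}_{2,1})}<\infty$ and $\|\partial_t\mathbf U\|_{\widetilde L^\infty(\mathcal B^{1/2}_{2,1})}<\infty$. **Theorem.** There are $\delta>0$ and $C>0$, depending only on $\tau,\beta,A,B,\varphi,\chi$, such that the following holds. Let $u_0,u_1\in B^{7/2}_{2,1}(\mathbb R^3)$ and $u_2\in B^{5/2}_{2,1}(\mathbb R^3)$ satisfy $$E_0:=\|\mathbf U_0\|_{\mathcal B^{3/2}_{2,1}}+\|\mathbf V_0\|_{\dot B^{-3/2}_{2,\infty}}\le\delta,$$ and let $\mathbf U=(u,v,w)$ be a global solution with these initial data. Then for all $t\ge0$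 $$\|\Lambda^\ell\mathbf V(t)\|_{B^{3/2-\ell}_{2,1}}\le C\,E_0\,(1+t)^{-3/4-\ell/2}\quad(0\le\ell<3/2),\qquad \|\Lambda^{3/2}\mathbf V(t)\|_{\dot B^{0}_{2,1}}\le C\,E_0\,(1+t)^{-3/2},$$ $$\|w(t)\|_{\dot B^{3/2}_{2,1}}\le C\,E_0\,(1+t)^{-3/2},\qquad \|w(t)\|_{\dot B^{0}_{2,1}}\le C\,E_0\,(1+t)^{-3/4}.$$ In particular $\Lambda^\ell\mathbf V(t)\in L^2$ for $0\le\ell\le 3/2$. -/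

import Mathlib

open MeasureTheory Set Filter Topology
open scoped ENNReal SchwartzMap FourierTransform LineDeriv Laplacian

noncomputable section

namespace JMGT

/-- Three-dimensional Euclidean space. -/
abbrev E3 : Type := EuclideanSpace ℝ (Fin 3)

/-- The space of (complex-valued) square-integrable functions on `ℝ³`. -/
abbrev L2 : Type := Lp (α := E3) ℂ 2 (volume : Measure E3)

/-- The space of tempered distributions on `ℝ³`. -/
abbrev TD : Type := 𝓢'(E3, ℂ)

/-- A square-integrable function seen as a tempered distribution. -/
def td (f : L2) : TD := Lp.toTemperedDistribution f

/-- The gradient of a tempered distribution. -/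
def grad (T : TD) (i : Fin 3) : TD := ∂_{(EuclideanSpace.single i (1 : ℝ) : E3)} T

/-- A scalar distribution seen as a family with one member. -/
def sc (T : TD) : Unit → TD := fun _ => T

/-- The `L²` norm of a tempered distribution: the norm of the `L²` function that represents it,
and `∞` if there is none. -/
def l2Norm (T : TD) : ℝ≥0∞ := ⨅ (g : L2) (_ : td g = T), ‖g‖ₑ

/-- The `L²` norm of a finite family (a vector-valued distribution). -/
def l2NormV {ι : Type} [Fintype ι] (f : ι → TD) : ℝ≥0∞ :=
  (∑ i, l2Norm (f i) ^ 2) ^ (1 / 2 : ℝ)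

/-- A pair of smooth cut-off functions generating the Littlewood-Paley decompositions. -/
structure LittlewoodPaley where
  φ : E3 → ℝ
  χ : E3 → ℝ
  φ_smooth : ContDiff ℝ ((⊤ : ℕ∞) : WithTop ℕ∞) φ
  χ_smooth : ContDiff ℝ ((⊤ : ℕ∞) : WithTop ℕ∞) χ
  φ_mem : ∀ ξ, φ ξ ∈ Icc (0 : ℝ) 1
  χ_mem : ∀ ξ, χ ξ ∈ Icc (0 : ℝ) 1
  φ_supp : ∀ ξ, φ ξ ≠ 0 → 3 / 4 ≤ ‖ξ‖ ∧ ‖ξ‖ ≤ 8 / 3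
  χ_supp : ∀ ξ, χ ξ ≠ 0 → ‖ξ‖ ≤ 4 / 3
  sum_inhom : ∀ ξ, HasSum (fun q : ℕ => φ ((2 : ℝ) ^ (-(q : ℤ)) • ξ)) (1 - χ ξ)
  sum_hom : ∀ ξ, ξ ≠ 0 → HasSum (fun q : ℤ => φ ((2 : ℝ) ^ (-q) • ξ)) 1

/-- The operator `m(D)`, with `D = -i∇`. The Fourier transform of Mathlib is normalised by
`exp (-2πi x·ξ)`, so the symbol of `D` is `2πξ`. -/
def symbolOp (m : E3 → ℝ) (T : TD) : TD :=
  TemperedDistribution.fourierMultiplierCLM ℂ (fun ξ : E3 => ((m ((2 * Real.pi) • ξ) : ℝ) : ℂ)) T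

/-- The dyadic block `φ(2^{-q} D)`. -/
def block (P : LittlewoodPaley) (q : ℤ) (T : TD) : TD :=
  symbolOp (fun ξ => P.φ ((2 : ℝ) ^ (-q) • ξ)) T

/-- The low-frequency block `χ(D)`. -/
def lowBlock (P : LittlewoodPaley) (T : TD) : TD := symbolOp P.χ T

/-- The weight `2^{qs}`. -/
def weight (q : ℤ) (s : ℝ) : ℝ≥0∞ := ENNReal.ofReal ((2 : ℝ) ^ ((q : ℝ) * s))

section Besov

variable {ι : Type} [Fintype ι]

/-- The `L²` norm of the dyadic block of a vector-valued distribution. -/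
def blockNorm (P : LittlewoodPaley) (q : ℤ) (f : ι → TD) : ℝ≥0∞ :=
  l2NormV fun i => block P q (f i)

/-- The norm of the homogeneous Besov space with exponents `s`, `2`, `1`. -/
def homBesov (P : LittlewoodPaley) (s : ℝ) (f : ι → TD) : ℝ≥0∞ :=
  ∑' q : ℤ, weight q s * blockNorm P q f

/-- The norm of the homogeneous Besov space with exponents `s`, `2`, `∞`. -/
def homBesovInf (P : LittlewoodPaley) (s : ℝ) (f : ι → TD) : ℝ≥0∞ :=
  ⨆ q : ℤ, weight q s * blockNorm P q f

/-- The norm of the inhomogeneous Besov space with exponents `s`, `2`, `1`. -/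
def inhomBesov (P : LittlewoodPaley) (s : ℝ) (f : ι → TD) : ℝ≥0∞ :=
  weight (-1) s * l2NormV (fun i => lowBlock P (f i)) +
    ∑' q : ℕ, weight (q : ℤ) s * blockNorm P (q : ℤ) f

/-- The Chemin-Lerner norm on `[0, ∞)` with time exponent `∞` over the inhomogeneous Besov space
with exponents `s`, `2`, `1`. -/
def cheminLerner (P : LittlewoodPaley) (s : ℝ) (f : ℝ → ι → TD) : ℝ≥0∞ :=
  (⨆ t ∈ Ici (0 : ℝ), l2NormV (f t)) +
    ∑' q : ℤ, weight q s * ⨆ t ∈ Ici (0 : ℝ), blockNorm P q (f t)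

end Besov

/-- The energy norm of a triple `(u, v, w)` at the level of `L²`. -/
def energyL2 (τ : ℝ) (u v w : L2) : ℝ≥0∞ :=
  (l2Norm (td (v + (τ : ℂ) • w)) ^ 2
    + l2NormV (grad (td (v + (τ : ℂ) • w))) ^ 2
    + l2Norm (Δ (td v)) ^ 2
    + l2NormV (grad (td v)) ^ 2
    + l2Norm (Δ (td (u + (τ : ℂ) • v))) ^ 2
    + l2NormV (grad (td (u + (τ : ℂ) • v))) ^ 2
    + l2Norm (td w) ^ 2) ^ (1 / 2 : ℝ)

/-- The energy norm of a triple `(u, v, w)` at the level of the homogeneous Besov space with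
exponents `s`, `2`, `1`. -/
def energyHom (P : LittlewoodPaley) (τ s : ℝ) (u v w : L2) : ℝ≥0∞ :=
  (homBesov P s (sc (td (v + (τ : ℂ) • w))) ^ 2
    + homBesov P s (grad (td (v + (τ : ℂ) • w))) ^ 2
    + homBesov P s (sc (Δ (td v))) ^ 2
    + homBesov P s (grad (td v)) ^ 2
    + homBesov P s (sc (Δ (td (u + (τ : ℂ) • v)))) ^ 2
    + homBesov P s (grad (td (u + (τ : ℂ) • v))) ^ 2
    + homBesov P s (sc (td w)) ^ 2) ^ (1 / 2 : ℝ)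

/-- The inhomogeneous energy norm of a triple `(u, v, w)`, for `s > 0`. -/
def energyNorm (P : LittlewoodPaley) (τ s : ℝ) (u v w : L2) : ℝ≥0∞ :=
  energyL2 τ u v w + energyHom P τ s u v w

/-- The Chemin-Lerner energy norm on `[0, ∞)`, with time exponent `∞`. -/
def energyCL (P : LittlewoodPaley) (τ s : ℝ) (u v w : ℝ → L2) : ℝ≥0∞ :=
  cheminLerner P s (fun t => sc (td (v t + (τ : ℂ) • w t)))
    + cheminLerner P s (fun t => grad (td (v t + (τ : ℂ) • w t)))
    + cheminLerner P s (fun t => sc (Δ (td (v t))))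
    + cheminLerner P s (fun t => grad (td (v t)))
    + cheminLerner P s (fun t => sc (Δ (td (u t + (τ : ℂ) • v t))))
    + cheminLerner P s (fun t => grad (td (u t + (τ : ℂ) • v t)))
    + cheminLerner P s (fun t => sc (td (w t)))

/-- Continuity on `[0, ∞)` with values in the inhomogeneous energy space. -/
def ContEnergy (P : LittlewoodPaley) (τ s : ℝ) (u v w : ℝ → L2) : Prop :=
  ∀ t, 0 ≤ t → energyNorm P τ s (u t) (v t) (w t) < ∞ ∧
    Tendsto (fun r => energyNorm P τ s (u r - u t) (v r - v t) (w r - w t)) (𝓝[Ici 0] t) (𝓝 0)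

/-- The triple `(u', v', w')` is the time derivative on `[0, ∞)` of `(u, v, w)` in the
inhomogeneous energy space. -/
def DerivEnergy (P : LittlewoodPaley) (τ s : ℝ) (u v w u' v' w' : ℝ → L2) : Prop :=
  ∀ t, 0 ≤ t → Tendsto (fun r => energyNorm P τ s
      ((r - t)⁻¹ • (u r - u t) - u' t)
      ((r - t)⁻¹ • (v r - v t) - v' t)
      ((r - t)⁻¹ • (w r - w t) - w' t)) (𝓝[Ici 0 \ {t}] t) (𝓝 0)

/-- The space of `(u, v, w)` that are continuous on `[0, ∞)` with values in the energy space and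
have a finite Chemin-Lerner energy norm. -/
def MemCTilde (P : LittlewoodPaley) (τ s : ℝ) (u v w : ℝ → L2) : Prop :=
  ContEnergy P τ s u v w ∧ energyCL P τ s u v w < ∞

/-- The space of `(u, v, w)` that are continuously differentiable on `[0, ∞)` with values in the
energy space, with derivative `(u', v', w')` of finite Chemin-Lerner energy norm. -/
def MemC1Tilde (P : LittlewoodPaley) (τ s : ℝ) (u v w u' v' w' : ℝ → L2) : Prop :=
  ContEnergy P τ s u v w ∧ DerivEnergy P τ s u v w u' v' w' ∧ MemCTilde P τ s u' v' w'

/-- `N` is the nonlinear term `κ v w + 2 ∇u · ∇v` (with square-integrable gradients). -/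
def IsNonlinearity (κ : ℝ) (u v w N : L2) : Prop :=
  ∃ p r : Fin 3 → L2, (∀ i, td (p i) = grad (td u) i) ∧ (∀ i, td (r i) = grad (td v) i) ∧
    ∀ᵐ x : E3, N x = (κ : ℂ) * v x * w x + 2 * ∑ i, p i x * r i x

/-- `(u, v, w)` is a global solution, with initial data `(u₀, u₁, u₂)`, of
`u_t = v`, `v_t = w`, `τ w_t = Δu + β Δv - w + κ v w + 2 ∇u · ∇v`,
in the class `C̃(𝓑^{3/2}) ∩ C̃¹(𝓑^{1/2})`. Time derivatives of `u`, `v`, `w` are taken in `L²`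
(one-sided at `t = 0`); the third equation holds in the sense of distributions on `ℝ³` at
every `t ≥ 0`. -/
def IsGlobalSolution (P : LittlewoodPaley) (τ β κ : ℝ) (u₀ u₁ u₂ : L2) (u v w : ℝ → L2) : Prop :=
  u 0 = u₀ ∧ v 0 = u₁ ∧ w 0 = u₂ ∧
  MemCTilde P τ (3 / 2) u v w ∧
  ∃ w' : ℝ → L2,
    MemC1Tilde P τ (1 / 2) u v w v w w' ∧
    ∀ t, 0 ≤ t →
      HasDerivWithinAt u (v t) (Ici 0) t ∧
      HasDerivWithinAt v (w t) (Ici 0) t ∧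
      HasDerivWithinAt w (w' t) (Ici 0) t ∧
      ∃ N : L2, IsNonlinearity κ (u t) (v t) (w t) N ∧
        (τ : ℂ) • td (w' t) = Δ (td (u t)) + (β : ℂ) • Δ (td (v t)) - td (w t) + td N

/-- The vector `V = (v + τ w, ∇(u + τ v), ∇v)`, with seven components. -/
def vecV (τ : ℝ) (u v w : L2) : Unit ⊕ Fin 3 ⊕ Fin 3 → TD :=
  Sum.elim (sc (td (v + (τ : ℂ) • w)))
    (Sum.elim (grad (td (u + (τ : ℂ) • v))) (grad (td v)))

/-- The size `E₀` of the initial data `(u₀, u₁, u₂)`. -/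
def initialSize (P : LittlewoodPaley) (τ : ℝ) (u₀ u₁ u₂ : L2) : ℝ≥0∞ :=
  energyNorm P τ (3 / 2) u₀ u₁ u₂ + homBesovInf P (-3 / 2) (vecV τ u₀ u₁ u₂)

/-- `S = Λ^ℓ T`, for `T` and `S` in `L²`: the Fourier transform of `S` is `|ξ|^ℓ` times that
of `T`, where the Fourier transform has the normalisation `exp (-2πi x·ξ)`. -/
def IsLambda (ℓ : ℝ) (T S : TD) : Prop :=
  ∃ f g : L2, td f = T ∧ td g = S ∧
    ∀ᵐ ξ : E3, (𝓕 g : L2) ξ = ((‖ξ‖ ^ ℓ : ℝ) : ℂ) * (𝓕 f : L2) ξ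

end JMGT

end

/-!
The proof works entirely on the Fourier side and only uses the `L²` theory: no paraproducts are needed,
because the nonlinear term does not contain the highest derivatives.

Let `a`, `p`, `d` be the Fourier transforms of `v + τ w`, `u + τ v`, `v`, and `k = 2π|ξ|`. With
`γ = β - τ > 0` the system is, for each `ξ`,
`a' = -k² p - γ k² d + N̂`, `p' = a`, `τ d' = a - d`, where `N` is the nonlinear term
(`IsLinearSolution`, `IsGlobalSolution.exists_fourier`), and `|a|² + k² |p|² + k² |d|²` is the squared
length of the transform of `V` (`quad`, `vlen`).

*Linear decay.* The energy `(|a|² + k² |p|² + γ τ k² |d|²) / 2` dissipates `γ k² |d|²` only. Adding small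
multiples of the correctors `ρ Re (p ā)` and `-ρ Re (d ā)`, with `ρ = k² / (1 + k²)`, gives an equivalent
functional that decays at a rate proportional to `ρ` (`exists_lyapunov`). Integrated against a weight
supported where `ρ ≥ l`, this gives decay of the weighted `L²` norm at a rate proportional to `l`, up to
the effect of the source (`exists_linear_decay`).

*Source.* Let `𝓔` be the `H²` norm of `(v + τ w, ∇(u + τ v), ∇v, w)` (`sobSize`). In dimension three `H²`
embeds into the functions with integrable Fourier transform, so that `N̂` is dominated by a convolution of
two integrable functions; hence `N̂` is bounded by `C 𝓔²` pointwise
(`enorm_fourier_nonlinearity_le_sq`), and `N` by `C 𝓔²` in `H²` (`eLpNorm_nonlinearity_le`). The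
pointwise bound makes the block of `N` at a low frequency `h` of size `h^{3/2} 𝓔²`, by the volume of a ball
(`exists_block_bound`): this is the same size as that of the blocks of initial data in
`Ḃ^{-3/2}_{2,∞}`.

*Decay of the blocks.* If `𝓔 ≤ M (1 + σ)^{-3/4}` on `[0, t]`, the source is of size
`M² (1 + σ)^{-3/2}`. On the block at frequency `h ≤ 1` the rate is comparable to `h²`, and splitting
`[0, t]` at `t / 2` bounds the block of `V(t)` by `C (E + M²) h^{3/2} profile h (1 + t)`
(`exists_block_decay`); the blocks of `w` follow from `τ w' + w = (v + τ w)'` (`exists_block_decay_w`). At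
high frequencies the rate is bounded below, so that two derivatives of `V` decay as fast as the source
(`exists_high_decay`). The three bounds are collected in `FreqDecay` (`exists_freqDecay`).

*Conclusion.* Summation over the blocks (`sum_profile_le`) gives `𝓔(t) ≤ C (E + M²) (1 + t)^{-3/4}`
(`FreqDecay.sobSize_le`). As `𝓔` is continuous in time, a bootstrap argument (`bootstrap_le`) yields
`𝓔(t) ≤ C E (1 + t)^{-3/4}` for small `E`, hence `FreqDecay` with a constant proportional to `E`
(`exists_freqDecay_of_small`). The Besov norms are then read off: the low-frequency blocks with the weight
`h^ℓ` sum up to `(1 + t)^{-3/4 - ℓ/2}`, including the endpoint `ℓ = 3/2`, and at high frequencies two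
derivatives in `L²` control `Ḃ^{3/2}_{2,1}` with the faster rate `(1 + t)^{-3/2}`
(`FreqDecay.inhomBesov_le`, `FreqDecay.homBesov_le`, `FreqDecay.homBesov_w_le`).
-/

namespace JMGT

/-! ### Tempered distributions with a function as Fourier transform -/

/-- The Fourier transform of `T` is the locally integrable function `F`. Integrability against
every Schwartz function is part of the definition, so that `F` may be multiplied by any symbol of
temperate growth. -/
def HasFourier (T : TD) (F : E3 → ℂ) : Prop :=
  LocallyIntegrable F volume ∧
    ∀ ψ : 𝓢(E3, ℂ), Integrable (fun ξ => ψ ξ * F ξ) ∧ (𝓕 T) ψ = ∫ ξ, ψ ξ * F ξ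

lemma HasFourier.aesm {T : TD} {F : E3 → ℂ} (h : HasFourier T F) :
    AEStronglyMeasurable F volume := h.1.aestronglyMeasurable

lemma hasFourier_td (f : L2) : HasFourier (td f) ((𝓕 f : L2) : E3 → ℂ) := by
  refine ⟨(Lp.memLp _).locallyIntegrable (by norm_num), fun ψ => ⟨?_, ?_⟩⟩
  · exact MemLp.integrable_mul (p := 2) (q := 2) (ψ.memLp 2 volume) (Lp.memLp _)
  · unfold td
    rw [Lp.fourier_toTemperedDistribution_eq, Lp.toTemperedDistribution_apply]
    rfl

lemma HasFourier.unique {T : TD} {F G : E3 → ℂ} (hF : HasFourier T F) (hG : HasFourier T G) :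
    F =ᵐ[volume] G := by
  refine ae_eq_of_integral_contDiff_smul_eq hF.1 hG.1 fun g hg hc => ?_
  have hg₁ : HasCompactSupport (Complex.ofRealCLM ∘ g) := hc.comp_left rfl
  have hg₂ : ContDiff ℝ ((⊤ : ℕ∞) : WithTop ℕ∞) (Complex.ofRealCLM ∘ g) := by fun_prop
  have h1 := (hF.2 (hg₁.toSchwartzMap hg₂)).2
  have h2 := (hG.2 (hg₁.toSchwartzMap hg₂)).2
  rw [h1] at h2
  simpa using h2

lemma HasFourier.congr {T : TD} {F G : E3 → ℂ} (hF : HasFourier T F) (h : F =ᵐ[volume] G) :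
    HasFourier T G := by
  refine ⟨fun x => ?_, fun ψ => ⟨?_, ?_⟩⟩
  · obtain ⟨s, hs, hi⟩ := hF.1 x
    exact ⟨s, hs, hi.congr (ae_restrict_of_ae h)⟩
  · exact (hF.2 ψ).1.congr (by filter_upwards [h] with x hx; rw [hx])
  · rw [(hF.2 ψ).2]
    exact integral_congr_ae (by filter_upwards [h] with x hx; rw [hx])

lemma HasFourier.fourierMultiplier {T : TD} {F : E3 → ℂ} (hF : HasFourier T F) {g : E3 → ℂ}
    (hg : g.HasTemperateGrowth) :
    HasFourier (TemperedDistribution.fourierMultiplierCLM ℂ g T) (fun ξ => g ξ * F ξ) := by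
  refine ⟨?_, fun ψ => ?_⟩
  · rw [← locallyIntegrableOn_univ]
    exact (locallyIntegrableOn_univ.2 hF.1).continuousOn_mul hg.1.continuous.continuousOn
      isClosed_univ.isLocallyClosed
  · have h := hF.2 (SchwartzMap.smulLeftCLM ℂ g ψ)
    have e : ∀ ξ, (SchwartzMap.smulLeftCLM ℂ g ψ) ξ * F ξ = ψ ξ * (g ξ * F ξ) := by
      intro ξ
      rw [SchwartzMap.smulLeftCLM_apply_apply hg, smul_eq_mul]; ring
    simp only [e] at h
    refine ⟨h.1, ?_⟩
    rw [TemperedDistribution.fourierMultiplierCLM_apply,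
      FourierTransform.fourier_fourierInv_eq, TemperedDistribution.smulLeftCLM_apply_apply]
    exact h.2

lemma HasFourier.add {T S : TD} {F G : E3 → ℂ} (hF : HasFourier T F) (hG : HasFourier S G) :
    HasFourier (T + S) (fun ξ => F ξ + G ξ) := by
  refine ⟨hF.1.add hG.1, fun ψ => ?_⟩
  have hi := (hF.2 ψ).1.add (hG.2 ψ).1
  refine ⟨hi.congr (.of_forall fun ξ => by simp [mul_add]), ?_⟩
  rw [FourierTransform.fourier_add]
  change (𝓕 T) ψ + (𝓕 S) ψ = _
  rw [(hF.2 ψ).2, (hG.2 ψ).2, ← integral_add (hF.2 ψ).1 (hG.2 ψ).1]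
  simp [mul_add]

lemma HasFourier.smul {T : TD} {F : E3 → ℂ} (hF : HasFourier T F) (c : ℂ) :
    HasFourier (c • T) (fun ξ => c * F ξ) := by
  refine ⟨hF.1.smul c, fun ψ => ?_⟩
  have e : ∀ ξ, ψ ξ * (c * F ξ) = c * (ψ ξ * F ξ) := fun ξ => by ring
  simp only [e]
  refine ⟨(hF.2 ψ).1.const_mul c, ?_⟩
  rw [FourierTransform.fourier_smul, integral_const_mul, ← (hF.2 ψ).2]
  rfl

lemma HasFourier.sub {T S : TD} {F G : E3 → ℂ} (hF : HasFourier T F) (hG : HasFourier S G) :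
    HasFourier (T - S) (fun ξ => F ξ - G ξ) := by
  have h := hF.add (hG.smul (-1))
  have e : T + (-1 : ℂ) • S = T - S := by module
  rw [e] at h
  exact h.congr (.of_forall fun ξ => by simp only; ring)

/-- The length of the frequency variable of `D = -i∇`, whose symbol is `2πξ`. -/
noncomputable def freq (ξ : E3) : ℝ := 2 * Real.pi * ‖ξ‖

lemma HasFourier.grad {T : TD} {F : E3 → ℂ} (hF : HasFourier T F) (i : Fin 3) :
    HasFourier (grad T i) (fun ξ => 2 * Real.pi * Complex.I * (ξ i : ℝ) * F ξ) := by
  unfold JMGT.grad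
  rw [TemperedDistribution.lineDeriv_eq_fourierMultiplierCLM]
  refine ((hF.fourierMultiplier (g := fun x : E3 =>
    ((inner ℝ x (EuclideanSpace.single i (1 : ℝ)) : ℝ) : ℂ)) (by fun_prop)).smul
      (2 * Real.pi * Complex.I)).congr (.of_forall fun ξ => ?_)
  simp [EuclideanSpace.inner_single_right]
  ring

lemma HasFourier.laplacian {T : TD} {F : E3 → ℂ} (hF : HasFourier T F) :
    HasFourier (Δ T) (fun ξ => -((freq ξ ^ 2 : ℝ) : ℂ) * F ξ) := by
  rw [TemperedDistribution.laplacian_eq_fourierMultiplierCLM]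
  have := ((hF.fourierMultiplier (g := fun x : E3 => Complex.ofReal (‖x‖ ^ 2))
    (by fun_prop)).smul (((-(2 * Real.pi) ^ 2 : ℝ)) : ℂ)).congr (G := fun ξ =>
      -((freq ξ ^ 2 : ℝ) : ℂ) * F ξ) (.of_forall fun ξ => by
        simp only [freq]; push_cast; ring)
  convert! this using 1

lemma HasFourier.symbolOp {T : TD} {F : E3 → ℂ} (hF : HasFourier T F) {m : E3 → ℝ}
    (hm : ContDiff ℝ ((⊤ : ℕ∞) : WithTop ℕ∞) m) (hc : HasCompactSupport m) :
    HasFourier (symbolOp m T) (fun ξ => ((m ((2 * Real.pi) • ξ) : ℝ) : ℂ) * F ξ) := by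
  refine hF.fourierMultiplier ?_
  refine HasCompactSupport.hasTemperateGrowth ?_ ?_
  · exact (hc.comp_smul (by positivity : (2 * Real.pi) ≠ 0)).comp_left Complex.ofReal_zero
  · exact Complex.ofRealCLM.contDiff.comp (hm.comp (contDiff_const_smul _))

lemma hasCompactSupport_of_norm_le {m : E3 → ℝ} {R : ℝ} (h : ∀ ξ, m ξ ≠ 0 → ‖ξ‖ ≤ R) :
    HasCompactSupport m :=
  HasCompactSupport.of_support_subset_isCompact (isCompact_closedBall (0 : E3) R) fun ξ hξ => by
    simpa using h ξ hξ

/-- The symbol of the dyadic block of index `q`, in Mathlib's frequency variable. -/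
noncomputable def blockSym (P : LittlewoodPaley) (q : ℤ) (ξ : E3) : ℝ :=
  P.φ ((2 : ℝ) ^ (-q) • ((2 * Real.pi) • ξ))

/-- The symbol of the low-frequency block, in Mathlib's frequency variable. -/
noncomputable def lowSym (P : LittlewoodPaley) (ξ : E3) : ℝ := P.χ ((2 * Real.pi) • ξ)

lemma HasFourier.block {T : TD} {F : E3 → ℂ} (hF : HasFourier T F) (P : LittlewoodPaley) (q : ℤ) :
    HasFourier (block P q T) (fun ξ => (blockSym P q ξ : ℂ) * F ξ) := by
  refine hF.symbolOp (P.φ_smooth.comp (contDiff_const_smul _)) ?_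
  have : HasCompactSupport P.φ := hasCompactSupport_of_norm_le fun ξ h => (P.φ_supp ξ h).2
  exact this.comp_smul (by positivity)

lemma HasFourier.lowBlock {T : TD} {F : E3 → ℂ} (hF : HasFourier T F) (P : LittlewoodPaley) :
    HasFourier (lowBlock P T) (fun ξ => (lowSym P ξ : ℂ) * F ξ) :=
  hF.symbolOp P.χ_smooth (hasCompactSupport_of_norm_le P.χ_supp)

lemma HasFourier.ext {T S : TD} {F : E3 → ℂ} (hT : HasFourier T F) (hS : HasFourier S F) :
    T = S := by
  have : 𝓕 T = 𝓕 S := by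
    ext ψ
    rw [(hT.2 ψ).2, (hS.2 ψ).2]
  have := congrArg (𝓕⁻ : TD → TD) this
  simpa using this

/-- The function of `L²` with a given Fourier transform. -/
lemma exists_hasFourier {F : E3 → ℂ} (hF : MemLp F 2 volume) :
    ∃ g : L2, ((𝓕 g : L2) : E3 → ℂ) =ᵐ[volume] F ∧ HasFourier (td g) F := by
  have e : (𝓕 (𝓕⁻ (hF.toLp F) : L2) : L2) = hF.toLp F := FourierTransform.fourier_fourierInv_eq _
  refine ⟨𝓕⁻ (hF.toLp F), ?_, ?_⟩
  · rw [e]; exact hF.coeFn_toLp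
  · refine (hasFourier_td _).congr ?_
    rw [e]; exact hF.coeFn_toLp

lemma HasFourier.exists_td {T : TD} {F : E3 → ℂ} (hT : HasFourier T F)
    (hF : MemLp F 2 volume) :
    ∃ g : L2, ((𝓕 g : L2) : E3 → ℂ) =ᵐ[volume] F ∧ td g = T := by
  obtain ⟨g, h1, h2⟩ := exists_hasFourier hF
  exact ⟨g, h1, h2.ext hT⟩

lemma enorm_fourier (g : L2) : ‖(𝓕 g : L2)‖ₑ = ‖g‖ₑ := by
  rw [← ofReal_norm, ← ofReal_norm, Lp.norm_fourier_eq]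

/-- Plancherel's identity for the extended `L²` norm. -/
lemma HasFourier.l2Norm_eq {T : TD} {F : E3 → ℂ} (hT : HasFourier T F) :
    l2Norm T = eLpNorm F 2 volume := by
  unfold l2Norm
  apply le_antisymm
  · by_cases hF : eLpNorm F 2 volume < ∞
    · obtain ⟨g, hg, rfl⟩ := hT.exists_td ⟨hT.aesm, hF⟩
      refine (iInf₂_le (f := fun (h : L2) (_ : td h = td g) => ‖h‖ₑ) g rfl).trans ?_
      rw [← enorm_fourier, Lp.enorm_def, eLpNorm_congr_ae hg]
    · simp only [not_lt, top_le_iff] at hF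
      simp [hF]
  · refine le_iInf₂ fun g hg => ?_
    subst hg
    rw [← enorm_fourier, Lp.enorm_def, eLpNorm_congr_ae (hT.unique (hasFourier_td g))]

lemma eLpNorm_two_sq {E : Type*} [NormedAddCommGroup E] (F : E3 → E) :
    eLpNorm F 2 volume ^ 2 = ∫⁻ ξ, ‖F ξ‖ₑ ^ 2 := by
  rw [eLpNorm_eq_lintegral_rpow_enorm_toReal (by norm_num) (by norm_num)]
  simp only [ENNReal.toReal_ofNat, one_div, ENNReal.rpow_ofNat]
  rw [← ENNReal.rpow_natCast, ← ENNReal.rpow_mul]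
  norm_num

/-- Plancherel's identity for a vector-valued distribution: `G` is the length of the vector of
Fourier transforms. -/
lemma l2NormV_eq {ι : Type} [Fintype ι] {f : ι → TD} {F : ι → E3 → ℂ} {G : E3 → ℝ}
    (hf : ∀ i, HasFourier (f i) (F i)) (hG : ∀ᵐ ξ, G ξ ^ 2 = ∑ i, ‖F i ξ‖ ^ 2) :
    l2NormV f = eLpNorm G 2 volume := by
  have h : ∑ i, l2Norm (f i) ^ 2 = eLpNorm G 2 volume ^ 2 := by
    rw [eLpNorm_two_sq]
    simp only [fun i => (hf i).l2Norm_eq, eLpNorm_two_sq]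
    rw [← lintegral_finsetSum' _ fun i _ => ((hf i).aesm.enorm.pow_const 2)]
    refine lintegral_congr_ae ?_
    filter_upwards [hG] with ξ hξ
    have : ‖G ξ‖ₑ ^ 2 = ENNReal.ofReal (G ξ ^ 2) := by
      rw [← ofReal_norm, ← ENNReal.ofReal_pow (norm_nonneg _), Real.norm_eq_abs, sq_abs]
    rw [this, hξ, ENNReal.ofReal_sum_of_nonneg (fun i _ => by positivity)]
    refine Finset.sum_congr rfl fun i _ => ?_
    rw [← ofReal_norm, ENNReal.ofReal_pow (norm_nonneg _)]
  rw [l2NormV, h, ← ENNReal.rpow_natCast, ← ENNReal.rpow_mul]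
  norm_num

/-! ### Fourier transform of a product -/

/-- A square-integrable function whose `L²` Fourier transform `F` is integrable is the inverse
Fourier integral of `F`. -/
lemma ae_eq_fourierInv {f : L2} {F : E3 → ℂ} (hF : ((𝓕 f : L2) : E3 → ℂ) =ᵐ[volume] F)
    (hFi : Integrable F volume) : (f : E3 → ℂ) =ᵐ[volume] 𝓕⁻ F := by
  have hcont : Continuous (𝓕⁻ F) := by
    have := VectorFourier.fourierIntegral_continuous (V := E3) (W := E3) (μ := volume)
      (L := -innerₗ E3) Real.continuous_fourierChar (by exact continuous_inner.neg) hFi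
    exact this
  refine ae_eq_of_integral_contDiff_smul_eq ((Lp.memLp _).locallyIntegrable (by norm_num))
    hcont.locallyIntegrable fun g hg hc => ?_
  have hg₁ : HasCompactSupport (Complex.ofRealCLM ∘ g) := hc.comp_left rfl
  have hg₂ : ContDiff ℝ ((⊤ : ℕ∞) : WithTop ℕ∞) (Complex.ofRealCLM ∘ g) := by fun_prop
  set G : 𝓢(E3, ℂ) := hg₁.toSchwartzMap hg₂ with hG
  have hGx : ∀ x, G x = (g x : ℂ) := fun x => by simp [hG]
  have h1 := ((hasFourier_td f).2 (𝓕⁻ G)).2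
  rw [TemperedDistribution.fourier_apply, FourierTransform.fourier_fourierInv_eq] at h1
  unfold td at h1
  rw [Lp.toTemperedDistribution_apply] at h1
  have h2 : ∫ x, (𝓕⁻ (G : E3 → ℂ)) x • F x = ∫ x, G x • (𝓕⁻ F) x := by
    have := VectorFourier.integral_fourierIntegral_smul_eq_flip (V := E3) (W := E3) (F := ℂ)
      (μ := volume) (ν := volume) (L := -innerₗ E3) (f := (G : E3 → ℂ)) (g := F)
      Real.continuous_fourierChar (by exact continuous_inner.neg) G.integrable hFi
    have hfl : (-innerₗ E3).flip = -innerₗ E3 := by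
      ext x y; simp [real_inner_comm]
    rw [hfl] at this
    exact this
  have h3 : ∀ x, g x • (f : E3 → ℂ) x = G x • (f : E3 → ℂ) x := fun x => by
    rw [hGx]; simp
  have h4 : ∀ x, g x • (𝓕⁻ F) x = G x • (𝓕⁻ F) x := fun x => by
    rw [hGx]; simp
  simp only [h3, h4]
  rw [h1, ← h2]
  refine integral_congr_ae ?_
  filter_upwards [hF] with x hx
  rw [hx, smul_eq_mul, ← SchwartzMap.fourierInv_coe]

open scoped Convolution in
/-- The product of two square-integrable functions whose Fourier transforms are integrable has the
convolution of the Fourier transforms as Fourier transform. -/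
lemma exists_mul_hasFourier {f g : L2} (hf : Integrable ((𝓕 f : L2) : E3 → ℂ) volume)
    (hg : Integrable ((𝓕 g : L2) : E3 → ℂ) volume)
    (h2 : MemLp (((𝓕 f : L2) : E3 → ℂ) ⋆[ContinuousLinearMap.mul ℂ ℂ] ((𝓕 g : L2) : E3 → ℂ)) 2
      volume) :
    ∃ n : L2, (n : E3 → ℂ) =ᵐ[volume] (fun x => f x * g x) ∧
      ((𝓕 n : L2) : E3 → ℂ) =ᵐ[volume]
        ((𝓕 f : L2) : E3 → ℂ) ⋆[ContinuousLinearMap.mul ℂ ℂ] ((𝓕 g : L2) : E3 → ℂ) := by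
  obtain ⟨n, hn, -⟩ := exists_hasFourier h2
  refine ⟨n, ?_, hn⟩
  have hi := hf.integrable_convolution (ContinuousLinearMap.mul ℂ ℂ) hg
  filter_upwards [ae_eq_fourierInv hn hi, ae_eq_fourierInv (ae_eq_refl _) hf,
    ae_eq_fourierInv (ae_eq_refl _) hg] with x h1 h2 h3
  rw [h1, h2, h3, Real.fourierInv_eq_fourier_neg, Real.fourier_mul_convolution_eq hf hg,
    ← Real.fourierInv_eq_fourier_neg, ← Real.fourierInv_eq_fourier_neg]

lemma enorm_convolution_le (F G : E3 → ℂ) (x : E3) :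
    ‖(MeasureTheory.convolution F G (ContinuousLinearMap.mul ℂ ℂ) volume) x‖ₑ ≤
      ∫⁻ y, ‖F y‖ₑ * ‖G (x - y)‖ₑ := by
  refine (enorm_integral_le_lintegral_enorm _).trans (le_of_eq ?_)
  simp [enorm_mul]

lemma lintegral_mul_le_two {α : Type*} [MeasurableSpace α] {μ : Measure α} {f g : α → ℝ≥0∞}
    (hf : AEMeasurable f μ) (hg : AEMeasurable g μ) :
    (∫⁻ x, f x * g x ∂μ) ^ 2 ≤ (∫⁻ x, f x ^ 2 ∂μ) * ∫⁻ x, g x ^ 2 ∂μ := by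
  have h := ENNReal.lintegral_mul_le_Lp_mul_Lq μ Real.HolderConjugate.two_two hf hg
  have h' := pow_le_pow_left' h 2
  simp only [Pi.mul_apply] at h'
  refine h'.trans (le_of_eq ?_)
  rw [mul_pow, ← ENNReal.rpow_natCast, ← ENNReal.rpow_natCast, ← ENNReal.rpow_mul,
    ← ENNReal.rpow_mul]
  norm_num

lemma lintegral_sub_left_eq (g : E3 → ℝ≥0∞) (x : E3) : ∫⁻ y, g (x - y) = ∫⁻ y, g y :=
  lintegral_sub_left_eq_self g x

lemma AEMeasurable.comp_sub_left {g : E3 → ℝ≥0∞} (hg : AEMeasurable g volume) (x : E3) :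
    AEMeasurable (fun y => g (x - y)) volume :=
  hg.comp_quasiMeasurePreserving (quasiMeasurePreserving_sub_left volume x)

lemma aemeasurable_conv {f g : E3 → ℝ≥0∞} (hf : AEMeasurable f volume)
    (hg : AEMeasurable g volume) : AEMeasurable (fun x => ∫⁻ y, f y * g (x - y)) volume := by
  have := aemeasurable_lconvolution (μ := (volume : Measure E3)) hf hg
  refine this.congr (.of_forall fun x => ?_)
  simp only [lconvolution]
  refine lintegral_congr fun y => ?_
  rw [neg_add_eq_sub]

/-- Cauchy-Schwarz inequality for a convolution. -/
lemma conv_sq_le_sup {f g : E3 → ℝ≥0∞} (hf : AEMeasurable f volume) (hg : AEMeasurable g volume)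
    (x : E3) : (∫⁻ y, f y * g (x - y)) ^ 2 ≤ (∫⁻ y, f y ^ 2) * ∫⁻ y, g y ^ 2 := by
  refine (lintegral_mul_le_two hf (AEMeasurable.comp_sub_left hg x)).trans (le_of_eq ?_)
  rw [lintegral_sub_left_eq (fun y => g y ^ 2)]

/-- Young's inequality `L² * L¹ ⊂ L²`. -/
lemma lintegral_conv_sq_le {f g : E3 → ℝ≥0∞} (hf : AEMeasurable f volume)
    (hg : AEMeasurable g volume) :
    ∫⁻ x, (∫⁻ y, f y * g (x - y)) ^ 2 ≤ (∫⁻ y, f y ^ 2) * (∫⁻ y, g y) ^ 2 := by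
  have key : ∀ x, (∫⁻ y, f y * g (x - y)) ^ 2 ≤
      (∫⁻ y, f y ^ 2 * g (x - y)) * ∫⁻ y, g y := by
    intro x
    have hgx := AEMeasurable.comp_sub_left hg x
    have h := lintegral_mul_le_two (μ := volume) (f := fun y => f y * g (x - y) ^ (1 / 2 : ℝ))
      (g := fun y => g (x - y) ^ (1 / 2 : ℝ)) (hf.mul (hgx.pow_const _)) (hgx.pow_const _)
    have e : ∀ a : ℝ≥0∞, a ^ (1 / 2 : ℝ) * a ^ (1 / 2 : ℝ) = a := fun a => by
      rw [← ENNReal.rpow_add_of_nonneg _ _ (by norm_num) (by norm_num)]; norm_num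
    simp only [mul_assoc, mul_pow, sq (_ ^ (1 / 2 : ℝ)), e] at h
    rwa [lintegral_sub_left_eq] at h
  refine (lintegral_mono key).trans ?_
  rw [lintegral_mul_const'' _ (aemeasurable_conv (hf.pow_const 2) hg), sq (∫⁻ y, g y), ← mul_assoc]
  refine mul_le_mul_left (le_of_eq ?_) _
  have hm : AEMeasurable (fun p : E3 × E3 => f p.2 ^ 2 * g (p.1 - p.2)) (volume.prod volume) := by
    refine ((hf.pow_const 2).comp_snd).mul ?_
    exact hg.comp_quasiMeasurePreserving (quasiMeasurePreserving_sub volume volume)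
  rw [lintegral_lintegral_swap hm]
  have : ∀ y, ∫⁻ x, f y ^ 2 * g (x - y) = f y ^ 2 * ∫⁻ x, g x := by
    intro y
    have hgy : AEMeasurable (fun x => g (x - y)) volume := hg.comp_quasiMeasurePreserving
      (measurePreserving_sub_right volume y).quasiMeasurePreserving
    rw [lintegral_const_mul'' _ hgy, lintegral_sub_right_eq_self]
  simp only [this]
  rw [lintegral_mul_const'' _ (hf.pow_const 2)]

/-! ### The Sobolev size of the state -/

/-- The sum of the amplitudes, at each frequency, of the four quantities `v + τ w`,
`∇(u + τ v)`, `∇v` and `w`. -/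
noncomputable def ampl (τ : ℝ) (u v w : L2) (ξ : E3) : ℝ :=
  ‖(𝓕 v : L2) ξ + τ * (𝓕 w : L2) ξ‖ + freq ξ * ‖(𝓕 u : L2) ξ + τ * (𝓕 v : L2) ξ‖ +
    freq ξ * ‖(𝓕 v : L2) ξ‖ + ‖(𝓕 w : L2) ξ‖

/-- The `H²` size of the four quantities `v + τ w`, `∇(u + τ v)`, `∇v` and `w`. -/
noncomputable def sobSize (τ : ℝ) (u v w : L2) : ℝ≥0∞ :=
  eLpNorm (fun ξ => (1 + freq ξ ^ 2) * ampl τ u v w ξ) 2 volume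

lemma freq_nonneg (ξ : E3) : 0 ≤ freq ξ := by unfold freq; positivity

lemma continuous_freq : Continuous freq := by unfold freq; fun_prop

lemma freq_add_le (ξ η : E3) : freq ξ ≤ freq η + freq (ξ - η) := by
  unfold freq
  have : ‖ξ‖ ≤ ‖η‖ + ‖ξ - η‖ := by simpa using norm_add_le η (ξ - η)
  nlinarith [Real.pi_pos]

lemma ampl_nonneg (τ : ℝ) (u v w : L2) (ξ : E3) : 0 ≤ ampl τ u v w ξ := by
  have := freq_nonneg ξ
  unfold ampl; positivity

lemma aesm_fourier (f : L2) : AEStronglyMeasurable ((𝓕 f : L2) : E3 → ℂ) volume :=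
  (Lp.memLp _).1

lemma aesm_ampl (τ : ℝ) (u v w : L2) : AEStronglyMeasurable (ampl τ u v w) volume := by
  have hu := aesm_fourier u
  have hv := aesm_fourier v
  have hw := aesm_fourier w
  have hk := continuous_freq.aestronglyMeasurable (μ := (volume : Measure E3))
  unfold ampl
  exact (((hv.add (hw.const_mul _)).norm.add (hk.mul (hu.add (hv.const_mul _)).norm)).add
    (hk.mul hv.norm)).add hw.norm

/-- The square of the constant of the embedding of `H²` into the space of functions with
integrable Fourier transform. -/
noncomputable def embConst : ℝ≥0∞ := ∫⁻ ξ : E3, ‖(1 + freq ξ ^ 2)⁻¹‖ₑ ^ 2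

lemma embConst_lt_top : embConst < ∞ := by
  have h := finite_integral_one_add_norm (E := E3) (μ := volume) (r := 4) (by simp; norm_num)
  refine lt_of_le_of_lt ?_ (ENNReal.mul_lt_top (a := 4) (by simp) h)
  rw [embConst, ← lintegral_const_mul' _ _ (by simp)]
  refine lintegral_mono fun ξ => ?_
  have e4 : (4 : ℝ≥0∞) = ENNReal.ofReal 4 := by simp
  rw [← ofReal_norm, ← ENNReal.ofReal_pow (norm_nonneg _), e4,
    ← ENNReal.ofReal_mul (by norm_num)]
  refine ENNReal.ofReal_le_ofReal ?_
  have h0 := norm_nonneg ξ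
  have hk : ‖ξ‖ ≤ freq ξ := by
    unfold freq; nlinarith [Real.pi_gt_three]
  have h1 : (1 + ‖ξ‖) ^ 2 ≤ 2 * (1 + freq ξ ^ 2) := by nlinarith [sq_nonneg (1 - ‖ξ‖)]
  rw [Real.norm_eq_abs, sq_abs, Real.rpow_neg (by positivity), inv_pow]
  have h2 : (1 + ‖ξ‖) ^ (4 : ℝ) = ((1 + ‖ξ‖) ^ 2) ^ 2 := by norm_cast; ring
  rw [h2]
  have h3 : ((1 + ‖ξ‖) ^ 2) ^ 2 ≤ 4 * (1 + freq ξ ^ 2) ^ 2 := by nlinarith [sq_nonneg (1 + ‖ξ‖)]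
  rw [← div_eq_mul_inv, inv_le_comm₀ (by positivity) (by positivity), inv_div]
  rw [div_le_iff₀ (by norm_num)]
  linarith

lemma lintegral_ampl_sq_le (τ : ℝ) (u v w : L2) :
    (∫⁻ ξ, ‖ampl τ u v w ξ‖ₑ) ^ 2 ≤ embConst * sobSize τ u v w ^ 2 := by
  have hm : AEStronglyMeasurable (fun ξ => (1 + freq ξ ^ 2) * ampl τ u v w ξ) volume :=
    ((continuous_const.add (continuous_freq.pow 2)).aestronglyMeasurable).mul (aesm_ampl τ u v w)
  have hc : Continuous fun ξ => (1 + freq ξ ^ 2)⁻¹ :=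
    (continuous_const.add (continuous_freq.pow 2)).inv₀ fun ξ =>
      (by positivity : 0 < 1 + freq ξ ^ 2).ne'
  have h := lintegral_mul_le_two (μ := volume) (f := fun ξ : E3 => ‖(1 + freq ξ ^ 2)⁻¹‖ₑ)
    (g := fun ξ => ‖(1 + freq ξ ^ 2) * ampl τ u v w ξ‖ₑ) hc.aestronglyMeasurable.enorm hm.enorm
  rw [sobSize, eLpNorm_two_sq]
  refine le_trans (le_of_eq ?_) h
  congr 1
  refine lintegral_congr fun ξ => ?_
  rw [← enorm_mul, inv_mul_cancel_left₀ (by positivity)]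

/-- The convolution of the amplitude with itself. -/
noncomputable def amplConv (τ : ℝ) (u v w : L2) (ξ : E3) : ℝ≥0∞ :=
  ∫⁻ η, ‖ampl τ u v w η‖ₑ * ‖ampl τ u v w (ξ - η)‖ₑ

lemma eLpNorm_ampl_le (τ : ℝ) (u v w : L2) :
    eLpNorm (ampl τ u v w) 2 volume ≤ sobSize τ u v w := by
  refine eLpNorm_mono fun ξ => ?_
  have := ampl_nonneg τ u v w ξ
  rw [Real.norm_of_nonneg this, Real.norm_of_nonneg (by positivity)]
  nlinarith [sq_nonneg (freq ξ)]

lemma amplConv_le (τ : ℝ) (u v w : L2) (ξ : E3) :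
    amplConv τ u v w ξ ≤ sobSize τ u v w ^ 2 := by
  have h := conv_sq_le_sup (aesm_ampl τ u v w).enorm (aesm_ampl τ u v w).enorm ξ
  rw [← eLpNorm_two_sq, ← sq] at h
  have h2 := (ENNReal.pow_le_pow_left_iff (two_ne_zero)).1 h
  exact h2.trans (pow_le_pow_left' (eLpNorm_ampl_le τ u v w) 2)

lemma enorm_mono_real {a b : ℝ} (ha : 0 ≤ a) (h : a ≤ b) : ‖a‖ₑ ≤ ‖b‖ₑ := by
  rw [Real.enorm_of_nonneg ha, Real.enorm_of_nonneg (ha.trans h)]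
  exact ENNReal.ofReal_le_ofReal h

/-- Since `1 + |ξ|² ≤ 2 (1 + |η|²) + 2 (1 + |ξ - η|²)`, the weight falls on one of the factors. -/
lemma lintegral_amplConv_sq_le (τ : ℝ) (u v w : L2) :
    ∫⁻ ξ, (‖1 + freq ξ ^ 2‖ₑ * amplConv τ u v w ξ) ^ 2 ≤
      16 * embConst * sobSize τ u v w ^ 4 := by
  set f : E3 → ℝ≥0∞ := fun ξ => ‖(1 + freq ξ ^ 2) * ampl τ u v w ξ‖ₑ with hf
  set g : E3 → ℝ≥0∞ := fun ξ => ‖ampl τ u v w ξ‖ₑ with hg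
  have hgm : AEMeasurable g volume := (aesm_ampl τ u v w).enorm
  have hfm : AEMeasurable f volume := AEStronglyMeasurable.enorm
    (((continuous_const.add (continuous_freq.pow 2)).aestronglyMeasurable).mul (aesm_ampl τ u v w))
  have key : ∀ ξ, ‖1 + freq ξ ^ 2‖ₑ * amplConv τ u v w ξ ≤ 4 * ∫⁻ η, f η * g (ξ - η) := by
    intro ξ
    have e : ∫⁻ η, g η * f (ξ - η) = ∫⁻ η, f η * g (ξ - η) := by
      rw [← lintegral_sub_left_eq (fun η => g η * f (ξ - η)) ξ]
      refine lintegral_congr fun η => ?_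
      rw [sub_sub_cancel, mul_comm]
    have e4 : 4 * ∫⁻ η, f η * g (ξ - η) =
        2 * ∫⁻ η, (f η * g (ξ - η) + g η * f (ξ - η)) := by
      have h := lintegral_add_left' (f := fun η => f η * g (ξ - η))
        (hfm.mul (AEMeasurable.comp_sub_left hgm ξ)) (fun η => g η * f (ξ - η))
      rw [h, e]
      ring
    rw [e4, amplConv, ← lintegral_const_mul' _ _ (by simp), ← lintegral_const_mul' _ _ (by simp)]
    refine lintegral_mono fun η => ?_
    simp only [hf, hg, ← enorm_mul]
    have h1 := ampl_nonneg τ u v w η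
    have h2 := ampl_nonneg τ u v w (ξ - η)
    have h3 := freq_add_le ξ η
    have h0 := freq_nonneg ξ
    rw [Real.enorm_of_nonneg (by positivity), Real.enorm_of_nonneg (by positivity),
      Real.enorm_of_nonneg (by positivity), ← ENNReal.ofReal_add (by positivity) (by positivity)]
    have e2 : ∀ x : ℝ, 2 * ENNReal.ofReal x = ENNReal.ofReal (2 * x) := fun x => by
      rw [ENNReal.ofReal_mul (by norm_num)]; simp
    rw [e2]
    refine ENNReal.ofReal_le_ofReal ?_
    have h4 : 1 + freq ξ ^ 2 ≤ 2 * ((1 + freq η ^ 2) + (1 + freq (ξ - η) ^ 2)) := by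
      nlinarith [sq_nonneg (freq η - freq (ξ - η)), freq_nonneg η, freq_nonneg (ξ - η)]
    calc (1 + freq ξ ^ 2) * (ampl τ u v w η * ampl τ u v w (ξ - η))
        ≤ 2 * ((1 + freq η ^ 2) + (1 + freq (ξ - η) ^ 2)) *
          (ampl τ u v w η * ampl τ u v w (ξ - η)) := by gcongr
      _ = _ := by ring
  calc ∫⁻ ξ, (‖1 + freq ξ ^ 2‖ₑ * amplConv τ u v w ξ) ^ 2
      ≤ ∫⁻ ξ, 16 * (∫⁻ η, f η * g (ξ - η)) ^ 2 := by
        refine lintegral_mono fun ξ => (pow_le_pow_left' (key ξ) 2).trans (le_of_eq ?_)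
        rw [mul_pow]; norm_num
    _ = 16 * ∫⁻ ξ, (∫⁻ η, f η * g (ξ - η)) ^ 2 := lintegral_const_mul' _ _ (by simp)
    _ ≤ 16 * ((∫⁻ η, f η ^ 2) * (∫⁻ η, g η) ^ 2) := by
        gcongr; exact lintegral_conv_sq_le hfm hgm
    _ ≤ 16 * (sobSize τ u v w ^ 2 * (embConst * sobSize τ u v w ^ 2)) := by
        gcongr
        · rw [sobSize, eLpNorm_two_sq]
        · exact lintegral_ampl_sq_le τ u v w
    _ = _ := by ring

/-! ### The nonlinear term -/

lemma fourier_add_ae (f g : L2) :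
    ((𝓕 (f + g) : L2) : E3 → ℂ) =ᵐ[volume] fun ξ => (𝓕 f : L2) ξ + (𝓕 g : L2) ξ := by
  rw [FourierTransform.fourier_add]
  exact Lp.coeFn_add _ _

lemma fourier_smul_ae (c : ℂ) (f : L2) :
    ((𝓕 (c • f) : L2) : E3 → ℂ) =ᵐ[volume] fun ξ => c * (𝓕 f : L2) ξ := by
  rw [FourierTransform.fourier_smul]
  exact Lp.coeFn_smul _ _

/-- The product of two functions with Fourier transforms dominated by the amplitude. -/
lemma exists_mul_of_le_ampl {τ : ℝ} {u v w : L2} (hE : sobSize τ u v w < ∞) {f g : L2} {a b : ℝ}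
    (ha : 0 ≤ a) (hb : 0 ≤ b)
    (hf : ∀ᵐ ξ, ‖(𝓕 f : L2) ξ‖ ≤ a * ampl τ u v w ξ)
    (hg : ∀ᵐ ξ, ‖(𝓕 g : L2) ξ‖ ≤ b * ampl τ u v w ξ) :
    ∃ n : L2, (n : E3 → ℂ) =ᵐ[volume] (fun x => f x * g x) ∧
      ∀ᵐ ξ, ‖(𝓕 n : L2) ξ‖ₑ ≤ ENNReal.ofReal (a * b) * amplConv τ u v w ξ := by
  have hI : ∫⁻ ξ, ‖ampl τ u v w ξ‖ₑ < ∞ := by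
    have h := lintegral_ampl_sq_le τ u v w
    have h2 : embConst * sobSize τ u v w ^ 2 < ∞ :=
      ENNReal.mul_lt_top embConst_lt_top (ENNReal.pow_lt_top hE)
    by_contra hc
    rw [not_lt, top_le_iff] at hc
    rw [hc] at h
    simp only [ne_eq, OfNat.ofNat_ne_zero, not_false_eq_true, ENNReal.top_pow, top_le_iff] at h
    exact h2.ne h
  have hAi : Integrable (ampl τ u v w) volume := ⟨aesm_ampl τ u v w, hI⟩
  have hfi : Integrable ((𝓕 f : L2) : E3 → ℂ) volume :=
    (hAi.const_mul a).mono' (aesm_fourier f) hf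
  have hgi : Integrable ((𝓕 g : L2) : E3 → ℂ) volume :=
    (hAi.const_mul b).mono' (aesm_fourier g) hg
  set c := MeasureTheory.convolution ((𝓕 f : L2) : E3 → ℂ) ((𝓕 g : L2) : E3 → ℂ)
    (ContinuousLinearMap.mul ℂ ℂ) volume with hc
  have hb' : ∀ ξ, ‖c ξ‖ₑ ≤ ENNReal.ofReal (a * b) * amplConv τ u v w ξ := by
    intro ξ
    refine (enorm_convolution_le _ _ ξ).trans ?_
    rw [amplConv, ← lintegral_const_mul' _ _ (by simp)]
    refine lintegral_mono_ae ?_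
    have hg' := (quasiMeasurePreserving_sub_left (volume : Measure E3) ξ).ae hg
    filter_upwards [hf, hg'] with η h1 h2
    have h3 := ampl_nonneg τ u v w η
    have h4 := ampl_nonneg τ u v w (ξ - η)
    rw [← ofReal_norm, ← ofReal_norm, Real.enorm_of_nonneg h3, Real.enorm_of_nonneg h4,
      ← ENNReal.ofReal_mul (norm_nonneg _), ← ENNReal.ofReal_mul h3,
      ← ENNReal.ofReal_mul (by positivity)]
    refine ENNReal.ofReal_le_ofReal ?_
    calc _ ≤ (a * ampl τ u v w η) * (b * ampl τ u v w (ξ - η)) := by gcongr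
      _ = _ := by ring
  have hc2 : MemLp c 2 volume := by
    refine ⟨(hfi.integrable_convolution (ContinuousLinearMap.mul ℂ ℂ) hgi).1, ?_⟩
    have h1 : eLpNorm c 2 volume ^ 2 < ∞ := by
      rw [eLpNorm_two_sq]
      calc ∫⁻ ξ, ‖c ξ‖ₑ ^ 2
          ≤ ∫⁻ ξ, ENNReal.ofReal (a * b) ^ 2 * (‖1 + freq ξ ^ 2‖ₑ * amplConv τ u v w ξ) ^ 2 := by
            refine lintegral_mono fun ξ => ?_
            rw [← mul_pow]
            refine pow_le_pow_left' ((hb' ξ).trans ?_) 2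
            gcongr
            refine le_mul_of_one_le_left zero_le ?_
            rw [Real.enorm_of_nonneg (by positivity), ENNReal.one_le_ofReal]
            nlinarith [sq_nonneg (freq ξ)]
        _ = ENNReal.ofReal (a * b) ^ 2 * ∫⁻ ξ, (‖1 + freq ξ ^ 2‖ₑ * amplConv τ u v w ξ) ^ 2 :=
            lintegral_const_mul' _ _ (by finiteness)
        _ ≤ ENNReal.ofReal (a * b) ^ 2 * (16 * embConst * sobSize τ u v w ^ 4) := by
            gcongr; exact lintegral_amplConv_sq_le τ u v w
        _ < ∞ := by
            have := embConst_lt_top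
            finiteness
    by_contra h
    rw [not_lt, top_le_iff] at h
    rw [h] at h1
    simp at h1
  obtain ⟨n, hn1, hn2⟩ := exists_mul_hasFourier hfi hgi hc2
  refine ⟨n, hn1, ?_⟩
  filter_upwards [hn2] with ξ hξ
  rw [hξ]
  exact hb' ξ

lemma norm_fourier_grad_le {f : L2} {p : L2} {i : Fin 3} (hp : td p = grad (td f) i) :
    ∀ᵐ ξ, ‖(𝓕 p : L2) ξ‖ ≤ freq ξ * ‖(𝓕 f : L2) ξ‖ := by
  have h1 := hasFourier_td p
  rw [hp] at h1
  filter_upwards [h1.unique ((hasFourier_td f).grad i)] with ξ hξ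
  rw [hξ]
  simp only [norm_mul, Complex.norm_I, Complex.norm_real, Complex.norm_ofNat, mul_one, freq]
  have : ‖ξ i‖ ≤ ‖ξ‖ := PiLp.norm_apply_le ξ i
  rw [Real.norm_of_nonneg Real.pi_pos.le]
  gcongr

/-- A constant dominating the nonlinear term by the convolution of the amplitude with itself. -/
noncomputable def nlCoeff (τ κ : ℝ) : ℝ := |κ| * (1 + |τ|) + 6 * (1 + |τ|)

/-- Only the sizes of the transforms of `v`, `w`, `∇u` and `∇v` matter, and each of them is controlled
by the amplitude; for `∇u` this holds as `u = (u + τ v) - τ v`. -/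
lemma enorm_fourier_nonlinearity_le {τ κ : ℝ} {u v w N : L2} (hE : sobSize τ u v w < ∞)
    (hN : IsNonlinearity κ u v w N) :
    ∀ᵐ ξ, ‖(𝓕 N : L2) ξ‖ₑ ≤ ENNReal.ofReal (nlCoeff τ κ) * amplConv τ u v w ξ := by
  obtain ⟨p, r, hp, hr, hN⟩ := hN
  have hv : ∀ᵐ ξ, ‖(𝓕 v : L2) ξ‖ ≤ (1 + |τ|) * ampl τ u v w ξ := by
    refine .of_forall fun ξ => ?_
    have h1 : ‖(𝓕 v : L2) ξ‖ ≤ ‖(𝓕 v : L2) ξ + τ * (𝓕 w : L2) ξ‖ + |τ| * ‖(𝓕 w : L2) ξ‖ := by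
      have := norm_sub_le ((𝓕 v : L2) ξ + τ * (𝓕 w : L2) ξ) (τ * (𝓕 w : L2) ξ)
      rwa [add_sub_cancel_right, norm_mul (τ : ℂ), Complex.norm_real, Real.norm_eq_abs] at this
    unfold ampl
    have := freq_nonneg ξ
    have h2 : 0 ≤ freq ξ * ‖(𝓕 u : L2) ξ + τ * (𝓕 v : L2) ξ‖ := by positivity
    have h3 : 0 ≤ freq ξ * ‖(𝓕 v : L2) ξ‖ := by positivity
    nlinarith [abs_nonneg τ, norm_nonneg ((𝓕 v : L2) ξ + τ * (𝓕 w : L2) ξ),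
      norm_nonneg ((𝓕 w : L2) ξ)]
  have hw : ∀ᵐ ξ, ‖(𝓕 w : L2) ξ‖ ≤ 1 * ampl τ u v w ξ := by
    refine .of_forall fun ξ => ?_
    unfold ampl
    have := freq_nonneg ξ
    have h2 : 0 ≤ freq ξ * ‖(𝓕 u : L2) ξ + τ * (𝓕 v : L2) ξ‖ := by positivity
    have h3 : 0 ≤ freq ξ * ‖(𝓕 v : L2) ξ‖ := by positivity
    nlinarith [norm_nonneg ((𝓕 v : L2) ξ + τ * (𝓕 w : L2) ξ)]
  have hp' : ∀ i, ∀ᵐ ξ, ‖(𝓕 (p i) : L2) ξ‖ ≤ (1 + |τ|) * ampl τ u v w ξ := by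
    intro i
    filter_upwards [norm_fourier_grad_le (hp i)] with ξ hξ
    refine hξ.trans ?_
    have h1 : ‖(𝓕 u : L2) ξ‖ ≤ ‖(𝓕 u : L2) ξ + τ * (𝓕 v : L2) ξ‖ + |τ| * ‖(𝓕 v : L2) ξ‖ := by
      have := norm_sub_le ((𝓕 u : L2) ξ + τ * (𝓕 v : L2) ξ) (τ * (𝓕 v : L2) ξ)
      rwa [add_sub_cancel_right, norm_mul (τ : ℂ), Complex.norm_real, Real.norm_eq_abs] at this
    unfold ampl
    have := freq_nonneg ξ
    have h2 : 0 ≤ freq ξ * ‖(𝓕 u : L2) ξ + τ * (𝓕 v : L2) ξ‖ := by positivity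
    have h3 : 0 ≤ freq ξ * ‖(𝓕 v : L2) ξ‖ := by positivity
    have h4 := mul_le_mul_of_nonneg_left h1 this
    nlinarith [abs_nonneg τ, norm_nonneg ((𝓕 v : L2) ξ + τ * (𝓕 w : L2) ξ),
      norm_nonneg ((𝓕 w : L2) ξ), mul_nonneg (abs_nonneg τ) h2,
      mul_nonneg (abs_nonneg τ) (norm_nonneg ((𝓕 v : L2) ξ + τ * (𝓕 w : L2) ξ)),
      mul_nonneg (abs_nonneg τ) (norm_nonneg ((𝓕 w : L2) ξ))]
  have hr' : ∀ i, ∀ᵐ ξ, ‖(𝓕 (r i) : L2) ξ‖ ≤ 1 * ampl τ u v w ξ := by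
    intro i
    filter_upwards [norm_fourier_grad_le (hr i)] with ξ hξ
    refine hξ.trans ?_
    unfold ampl
    have := freq_nonneg ξ
    have h2 : 0 ≤ freq ξ * ‖(𝓕 u : L2) ξ + τ * (𝓕 v : L2) ξ‖ := by positivity
    nlinarith [norm_nonneg ((𝓕 v : L2) ξ + τ * (𝓕 w : L2) ξ), norm_nonneg ((𝓕 w : L2) ξ)]
  obtain ⟨n0, hn0, hb0⟩ := exists_mul_of_le_ampl hE (by positivity) zero_le_one hv hw
  have := fun i => exists_mul_of_le_ampl hE (by positivity) zero_le_one (hp' i) (hr' i)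
  choose n hn hb using this
  have hNeq : N = (κ : ℂ) • n0 + (2 : ℂ) • (n 0 + n 1 + n 2) := by
    refine Lp.ext ?_
    filter_upwards [hN, hn0, hn 0, hn 1, hn 2, Lp.coeFn_add ((κ : ℂ) • n0)
      ((2 : ℂ) • (n 0 + n 1 + n 2)), Lp.coeFn_smul (κ : ℂ) n0,
      Lp.coeFn_smul (2 : ℂ) (n 0 + n 1 + n 2), Lp.coeFn_add (n 0 + n 1) (n 2),
      Lp.coeFn_add (n 0) (n 1)] with x h1 h2 h3 h4 h5 h6 h7 h8 h9 h10
    rw [h6, Pi.add_apply, h7, h8, Pi.smul_apply, Pi.smul_apply, h9, Pi.add_apply, h10,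
      Pi.add_apply, h1, h2, h3, h4, h5, Fin.sum_univ_three]
    simp only [smul_eq_mul]
    ring
  rw [hNeq]
  filter_upwards [hb0, hb 0, hb 1, hb 2, fourier_add_ae ((κ : ℂ) • n0)
      ((2 : ℂ) • (n 0 + n 1 + n 2)), fourier_smul_ae (κ : ℂ) n0,
      fourier_smul_ae (2 : ℂ) (n 0 + n 1 + n 2), fourier_add_ae (n 0 + n 1) (n 2),
      fourier_add_ae (n 0) (n 1)] with x h2 h3 h4 h5 h6 h7 h8 h9 h10
  rw [h6, h7, h8, h9, h10]
  refine (enorm_add_le _ _).trans ?_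
  rw [enorm_mul, enorm_mul]
  have hs : ‖(𝓕 (n 0) : L2) x + (𝓕 (n 1) : L2) x + (𝓕 (n 2) : L2) x‖ₑ ≤
      3 * (ENNReal.ofReal ((1 + |τ|) * 1) * amplConv τ u v w x) := by
    calc _ ≤ ‖(𝓕 (n 0) : L2) x‖ₑ + ‖(𝓕 (n 1) : L2) x‖ₑ + ‖(𝓕 (n 2) : L2) x‖ₑ :=
          (enorm_add_le _ _).trans (by gcongr; exact enorm_add_le _ _)
      _ ≤ _ := by
          refine (add_le_add (add_le_add h3 h4) h5).trans (le_of_eq ?_)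
          ring
  have e1 : ‖(κ : ℂ)‖ₑ = ENNReal.ofReal |κ| := by
    rw [← ofReal_norm, Complex.norm_real, Real.norm_eq_abs]
  have e2 : ‖(2 : ℂ)‖ₑ = 2 := by
    rw [← ofReal_norm]; simp
  rw [e1, e2]
  refine (add_le_add (mul_le_mul_right h2 _) (mul_le_mul_right hs 2)).trans (le_of_eq ?_)
  have e6 : (6 : ℝ≥0∞) = ENNReal.ofReal 6 := by simp
  rw [nlCoeff, ENNReal.ofReal_add (by positivity) (by positivity), ENNReal.ofReal_mul (p := |κ|)
    (by positivity), ENNReal.ofReal_mul (p := 6) (by positivity), ← e6, mul_one]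
  ring

/-- The constant in the bounds of the nonlinear term. -/
noncomputable def nlConst (τ κ : ℝ) : ℝ≥0∞ :=
  ENNReal.ofReal (nlCoeff τ κ) * (1 + (16 * embConst) ^ (1 / 2 : ℝ))

lemma nlConst_lt_top (τ κ : ℝ) : nlConst τ κ < ∞ := by
  have := embConst_lt_top
  unfold nlConst
  exact ENNReal.mul_lt_top (by simp) (ENNReal.add_lt_top.2 ⟨by simp,
    ENNReal.rpow_lt_top_of_nonneg (by norm_num) (by finiteness)⟩)

/-- The Fourier transform of the nonlinear term is bounded. -/
lemma enorm_fourier_nonlinearity_le_sq {τ κ : ℝ} {u v w N : L2} (hE : sobSize τ u v w < ∞)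
    (hN : IsNonlinearity κ u v w N) :
    ∀ᵐ ξ, ‖(𝓕 N : L2) ξ‖ₑ ≤ nlConst τ κ * sobSize τ u v w ^ 2 := by
  filter_upwards [enorm_fourier_nonlinearity_le hE hN] with ξ hξ
  refine hξ.trans ?_
  rw [nlConst]
  gcongr
  · exact le_mul_of_one_le_right zero_le (by simp)
  · exact amplConv_le τ u v w ξ

/-- The nonlinear term is bounded in `H²`. -/
lemma eLpNorm_nonlinearity_le {τ κ : ℝ} {u v w N : L2} (hE : sobSize τ u v w < ∞)
    (hN : IsNonlinearity κ u v w N) :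
    eLpNorm (fun ξ => (1 + freq ξ ^ 2) * ‖(𝓕 N : L2) ξ‖) 2 volume ≤
      nlConst τ κ * sobSize τ u v w ^ 2 := by
  have h1 : eLpNorm (fun ξ => (1 + freq ξ ^ 2) * ‖(𝓕 N : L2) ξ‖) 2 volume ^ 2 ≤
      ENNReal.ofReal (nlCoeff τ κ) ^ 2 * (16 * embConst * sobSize τ u v w ^ 4) := by
    rw [eLpNorm_two_sq]
    calc _ ≤ ∫⁻ ξ, ENNReal.ofReal (nlCoeff τ κ) ^ 2 *
          (‖1 + freq ξ ^ 2‖ₑ * amplConv τ u v w ξ) ^ 2 := by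
          refine lintegral_mono_ae ?_
          filter_upwards [enorm_fourier_nonlinearity_le hE hN] with ξ hξ
          rw [← mul_pow, enorm_mul, enorm_norm, mul_left_comm]
          gcongr
      _ = _ := lintegral_const_mul' _ _ (by finiteness)
      _ ≤ _ := by gcongr; exact lintegral_amplConv_sq_le τ u v w
  have h2 : (ENNReal.ofReal (nlCoeff τ κ) * ((16 * embConst) ^ (1 / 2 : ℝ) *
      sobSize τ u v w ^ 2)) ^ 2 =
      ENNReal.ofReal (nlCoeff τ κ) ^ 2 * (16 * embConst * sobSize τ u v w ^ 4) := by
    rw [mul_pow, mul_pow, ← ENNReal.rpow_natCast, ← ENNReal.rpow_natCast (_ ^ (1 / 2 : ℝ)),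
      ← ENNReal.rpow_mul]
    norm_num
    ring
  rw [← h2] at h1
  refine ((ENNReal.pow_le_pow_left_iff two_ne_zero).1 h1).trans ?_
  rw [nlConst, mul_assoc]
  gcongr
  exact le_add_self

/-! ### Differential inequalities -/

/-- A comparison principle for the square root of a nonnegative function `L` satisfying
`L' ≤ -2 μ L + 2 f √L`: formally `(√L)' ≤ -μ √L + f`, but `√L` need not be differentiable. -/
lemma sqrt_le_of_deriv_le {L L' f g g' : ℝ → ℝ} {μ a b : ℝ} (hμ : 0 ≤ μ) (hab : a ≤ b)
    (hLc : ContinuousOn L (Icc a b))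
    (hLd : ∀ t ∈ Ico a b, HasDerivWithinAt L (L' t) (Ici t) t)
    (hL : ∀ t ∈ Ico a b, L' t ≤ -2 * μ * L t + 2 * f t * √(L t))
    (hgd : ∀ t ∈ Icc a b, HasDerivAt g (g' t) t) (hg0 : ∀ t ∈ Icc a b, 0 ≤ g t)
    (hg : ∀ t ∈ Icc a b, f t ≤ g' t + μ * g t) (ha : √(L a) ≤ g a) : √(L b) ≤ g b := by
  have key : ∀ ε : ℝ, 0 < ε → √(L b) ≤ g b + ε * (1 + (b - a)) := by
    intro ε hε
    have hpos : ∀ t ∈ Icc a b, 0 < g t + ε * (1 + (t - a)) := fun t ht => by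
      have := hg0 t ht; have := ht.1
      have : 0 < ε * (1 + (t - a)) := by apply mul_pos hε; linarith
      linarith [hg0 t ht]
    have hd : ∀ t ∈ Icc a b, HasDerivAt (fun t => (g t + ε * (1 + (t - a))) ^ 2)
        (2 * (g t + ε * (1 + (t - a))) * (g' t + ε)) t := fun t ht => by
      have h1 : HasDerivAt (fun t => ε * (1 + (t - a))) ε t := by
        have := ((((hasDerivAt_id t).sub_const a).const_add 1).const_mul ε)
        simpa using this
      have := ((hgd t ht).add h1).pow 2
      convert! this using 1
      simp
    have h := image_le_of_deriv_right_lt_deriv_boundary' (f := L) (f' := L') (a := a) (b := b)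
      (B := fun t => (g t + ε * (1 + (t - a))) ^ 2)
      (B' := fun t => 2 * (g t + ε * (1 + (t - a))) * (g' t + ε)) hLc hLd ?_ ?_ ?_ ?_
      (right_mem_Icc.2 hab)
    · have := Real.sqrt_le_sqrt h
      rwa [Real.sqrt_sq (hpos b (right_mem_Icc.2 hab)).le] at this
    · have hp := hpos a (left_mem_Icc.2 hab)
      rw [← Real.sqrt_le_sqrt_iff (by positivity), Real.sqrt_sq hp.le]
      simp only [sub_self, add_zero, mul_one]
      linarith
    · exact fun t ht => (hd t ht).continuousAt.continuousWithinAt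
    · exact fun t ht => (hd t (Ico_subset_Icc_self ht)).hasDerivWithinAt
    · intro t ht he
      have ht' := Ico_subset_Icc_self ht
      have hp := hpos t ht'
      have h1 := hL t ht
      have h2 := hg t ht'
      rw [he, Real.sqrt_sq hp.le] at h1
      have h3 : 0 ≤ ε * (1 + (t - a)) := by
        apply mul_nonneg hε.le; linarith [ht.1]
      refine h1.trans_lt ?_
      have h4 : f t < g' t + ε + μ * (g t + ε * (1 + (t - a))) := by
        nlinarith [mul_nonneg hμ h3]
      nlinarith [mul_lt_mul_of_pos_left h4 hp]
  refine le_of_forall_pos_le_add fun ε hε => ?_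
  have hb : 0 < 1 + (b - a) := by linarith
  have := key (ε / (1 + (b - a))) (by positivity)
  rwa [div_mul_cancel₀ _ hb.ne'] at this

/-- Exponential damping with a bounded source. -/
lemma sqrt_le_exp_add {L L' : ℝ → ℝ} {μ a b K : ℝ} (hμ : 0 < μ) (hab : a ≤ b) (hK : 0 ≤ K)
    (hLc : ContinuousOn L (Icc a b))
    (hLd : ∀ t ∈ Ico a b, HasDerivWithinAt L (L' t) (Ici t) t)
    (hL : ∀ t ∈ Ico a b, L' t ≤ -2 * μ * L t + 2 * K * √(L t)) :
    √(L b) ≤ Real.exp (-μ * (b - a)) * √(L a) + K * min (1 / μ) (b - a) := by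
  have he : ∀ t, HasDerivAt (fun t => Real.exp (-μ * (t - a)) * √(L a))
      (-μ * (Real.exp (-μ * (t - a)) * √(L a))) t := fun t => by
    have h1 : HasDerivAt (fun t => -μ * (t - a)) (-μ) t := by
      simpa using ((hasDerivAt_id t).sub_const a).const_mul (-μ)
    have := (h1.exp).mul_const √(L a)
    convert! this using 1
    ring
  rw [mul_min_of_nonneg _ _ hK, ← min_add_add_left, le_min_iff]
  constructor
  · refine sqrt_le_of_deriv_le (f := fun _ => K)
      (g := fun t => Real.exp (-μ * (t - a)) * √(L a) + K * (1 / μ))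
      hμ.le hab hLc hLd hL (fun t _ => (he t).add_const _) (fun t _ => by positivity)
      (fun t _ => ?_) ?_
    · have : μ * (K * (1 / μ)) = K := by field_simp
      linarith
    · simp only [sub_self, mul_zero, Real.exp_zero, one_mul]
      have : 0 ≤ K * (1 / μ) := by positivity
      linarith
  · refine sqrt_le_of_deriv_le (f := fun _ => K)
      (g := fun t => Real.exp (-μ * (t - a)) * √(L a) + K * (t - a))
      (g' := fun t => -μ * (Real.exp (-μ * (t - a)) * √(L a)) + K)
      hμ.le hab hLc hLd hL (fun t _ => (he t).add ?_) (fun t ht => ?_)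
      (fun t ht => ?_) ?_
    · simpa using ((hasDerivAt_id t).sub_const a).const_mul K
    · have : 0 ≤ t - a := by linarith [ht.1]
      positivity
    · have : 0 ≤ t - a := by linarith [ht.1]
      have : 0 ≤ μ * (K * (t - a)) := by positivity
      linarith
    · simp

/-- A source of size `K (1 + t)^{-3/2}` has a bounded effect. -/
lemma sqrt_le_add_two_mul {L L' : ℝ → ℝ} {μ b K : ℝ} (hμ : 0 ≤ μ) (hb : 0 ≤ b) (hK : 0 ≤ K)
    (hLc : ContinuousOn L (Icc 0 b))
    (hLd : ∀ t ∈ Ico 0 b, HasDerivWithinAt L (L' t) (Ici t) t)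
    (hL : ∀ t ∈ Ico 0 b, L' t ≤ -2 * μ * L t + 2 * (K * (1 + t) ^ (-3 / 2 : ℝ)) * √(L t)) :
    √(L b) ≤ √(L 0) + 2 * K := by
  have h := sqrt_le_of_deriv_le (f := fun t => K * (1 + t) ^ (-3 / 2 : ℝ))
      (g := fun t => √(L 0) + 2 * K * (1 - (1 + t) ^ (-1 / 2 : ℝ)))
      (g' := fun t => K * (1 + t) ^ (-3 / 2 : ℝ)) hμ hb hLc hLd hL ?_ ?_ ?_ ?_
  · refine h.trans ?_
    have : 0 ≤ (1 + b) ^ (-1 / 2 : ℝ) := by positivity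
    nlinarith
  · intro t ht
    have ht0 : 1 + t ≠ 0 := by linarith [ht.1]
    have h1 : HasDerivAt (fun t : ℝ => (1 + t) ^ (-1 / 2 : ℝ))
        (-1 / 2 * (1 + t) ^ (-3 / 2 : ℝ)) t := by
      have := ((hasDerivAt_id t).const_add 1).rpow_const (p := -1 / 2) (Or.inl ht0)
      convert! this using 1
      simp only [id_eq]; norm_num
    have := (((h1.const_sub 1).const_mul (2 * K)).const_add √(L 0))
    convert! this using 1
    ring
  · intro t ht
    have : (1 + t) ^ (-1 / 2 : ℝ) ≤ 1 :=
      Real.rpow_le_one_of_one_le_of_nonpos (by linarith [ht.1]) (by norm_num)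
    have h2 : 0 ≤ 2 * K * (1 - (1 + t) ^ (-1 / 2 : ℝ)) :=
      mul_nonneg (by positivity) (by linarith)
    have := Real.sqrt_nonneg (L 0)
    linarith
  · intro t ht
    have : (1 + t) ^ (-1 / 2 : ℝ) ≤ 1 :=
      Real.rpow_le_one_of_one_le_of_nonpos (by linarith [ht.1]) (by norm_num)
    have h2 : 0 ≤ 2 * K * (1 - (1 + t) ^ (-1 / 2 : ℝ)) :=
      mul_nonneg (by positivity) (by linarith)
    have := Real.sqrt_nonneg (L 0)
    have : 0 ≤ μ * (√(L 0) + 2 * K * (1 - (1 + t) ^ (-1 / 2 : ℝ))) := by positivity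
    linarith
  · simp

/-- Damping at the rate `μ` with a source of size `K (1 + t)^{-3/2}`: the source is integrable on
the first half of `[0, t]`, and as small as at time `t` on the second half. -/
lemma sqrt_le_decay {L L' : ℝ → ℝ} {μ t K : ℝ} (hμ : 0 < μ) (ht : 0 ≤ t) (hK : 0 ≤ K)
    (hLc : ContinuousOn L (Icc 0 t))
    (hLd : ∀ s ∈ Ico 0 t, HasDerivWithinAt L (L' s) (Ici s) s)
    (hL : ∀ s ∈ Ico 0 t, L' s ≤ -2 * μ * L s + 2 * (K * (1 + s) ^ (-3 / 2 : ℝ)) * √(L s)) :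
    √(L t) ≤ Real.exp (-μ * t / 2) * (√(L 0) + 2 * K) +
      3 * K * (1 + t) ^ (-3 / 2 : ℝ) * min (1 / μ) (1 + t) := by
  have ht2 : 0 ≤ t / 2 := by linarith
  have h1 := sqrt_le_add_two_mul (L := L) (L' := L') (b := t / 2) hμ.le ht2 hK
    (hLc.mono (Icc_subset_Icc le_rfl (by linarith)))
    (fun s hs => hLd s ⟨hs.1, by linarith [hs.2]⟩) (fun s hs => hL s ⟨hs.1, by linarith [hs.2]⟩)
  have h23 : (2 : ℝ) ^ (3 / 2 : ℝ) ≤ 3 := by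
    rw [← Real.rpow_le_rpow_iff (z := 2) (by positivity) (by norm_num) (by norm_num),
      ← Real.rpow_mul (by norm_num)]
    norm_num
  have hhalf : ∀ s, t / 2 ≤ s → (1 + s) ^ (-3 / 2 : ℝ) ≤ 3 * (1 + t) ^ (-3 / 2 : ℝ) := by
    intro s hs
    calc (1 + s) ^ (-3 / 2 : ℝ) ≤ ((1 + t) / 2) ^ (-3 / 2 : ℝ) :=
          Real.rpow_le_rpow_of_nonpos (by linarith) (by linarith) (by norm_num)
      _ = 2 ^ (3 / 2 : ℝ) * (1 + t) ^ (-3 / 2 : ℝ) := by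
          rw [Real.div_rpow (by linarith) (by norm_num), div_eq_mul_inv, ← Real.rpow_neg (by norm_num),
            mul_comm]
          norm_num
      _ ≤ _ := by gcongr
  have h2 := sqrt_le_exp_add (L := L) (L' := L') (a := t / 2) (b := t) (μ := μ)
    (K := 3 * K * (1 + t) ^ (-3 / 2 : ℝ)) hμ (by linarith) (by positivity)
    (hLc.mono (Icc_subset_Icc ht2 le_rfl))
    (fun s hs => hLd s ⟨by linarith [hs.1], hs.2⟩) (fun s hs => by
      refine (hL s ⟨by linarith [hs.1], hs.2⟩).trans ?_
      have := mul_le_mul_of_nonneg_left (hhalf s hs.1) hK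
      have := mul_le_mul_of_nonneg_right this (Real.sqrt_nonneg (L s))
      linarith)
  refine h2.trans ?_
  have e : -μ * (t - t / 2) = -μ * t / 2 := by ring
  rw [e]
  gcongr
  linarith

/-- Damping at the rate `μ` with a source bounded by `K₁` on the first half of `[0, t]`, and by
`K₂` on the second half. -/
lemma sqrt_le_two_stage {L L' f : ℝ → ℝ} {μ t K₁ K₂ : ℝ} (hμ : 0 < μ) (ht : 0 ≤ t) (hK₁ : 0 ≤ K₁)
    (hK₂ : 0 ≤ K₂) (hLc : ContinuousOn L (Icc 0 t))
    (hLd : ∀ s ∈ Ico 0 t, HasDerivWithinAt L (L' s) (Ici s) s)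
    (hL : ∀ s ∈ Ico 0 t, L' s ≤ -2 * μ * L s + 2 * f s * √(L s))
    (hf₁ : ∀ s ∈ Ico 0 (t / 2), f s ≤ K₁) (hf₂ : ∀ s ∈ Ico (t / 2) t, f s ≤ K₂) :
    √(L t) ≤ Real.exp (-μ * t / 2) * (√(L 0) + K₁ / μ) + K₂ / μ := by
  have ht2 : 0 ≤ t / 2 := by linarith
  have h1 := sqrt_le_exp_add (L := L) (L' := L') (a := 0) (b := t / 2) (μ := μ) (K := K₁) hμ
    ht2 hK₁ (hLc.mono (Icc_subset_Icc le_rfl (by linarith)))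
    (fun s hs => hLd s ⟨hs.1, by linarith [hs.2]⟩) (fun s hs => by
      refine (hL s ⟨hs.1, by linarith [hs.2]⟩).trans ?_
      have := mul_le_mul_of_nonneg_right (hf₁ s hs) (Real.sqrt_nonneg (L s))
      linarith)
  have h2 := sqrt_le_exp_add (L := L) (L' := L') (a := t / 2) (b := t) (μ := μ) (K := K₂) hμ
    (by linarith) hK₂ (hLc.mono (Icc_subset_Icc ht2 le_rfl))
    (fun s hs => hLd s ⟨by linarith [hs.1], hs.2⟩) (fun s hs => by
      refine (hL s ⟨by linarith [hs.1], hs.2⟩).trans ?_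
      have := mul_le_mul_of_nonneg_right (hf₂ s hs) (Real.sqrt_nonneg (L s))
      linarith)
  have e : -μ * (t - t / 2) = -μ * t / 2 := by ring
  rw [e] at h2
  have h3 : √(L (t / 2)) ≤ √(L 0) + K₁ / μ := by
    refine h1.trans (add_le_add ?_ ?_)
    · refine mul_le_of_le_one_left (Real.sqrt_nonneg _) (Real.exp_le_one_iff.2 ?_)
      have : 0 ≤ μ * (t / 2 - 0) := by rw [sub_zero]; positivity
      linarith
    · rw [div_eq_mul_one_div K₁ μ]
      exact mul_le_mul_of_nonneg_left (min_le_left _ _) hK₁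
  refine h2.trans (add_le_add ?_ ?_)
  · gcongr
  · rw [div_eq_mul_one_div K₂ μ]
    exact mul_le_mul_of_nonneg_left (min_le_left _ _) hK₂

/-! ### The Lyapunov functional of the linearised equation at a fixed frequency -/

/-- The dissipation of the Lyapunov functional. Here `x = |ξ|²`, `y = x / (1 + x)`, and `a`, `p`,
`d` are real or imaginary parts of the Fourier transforms of `v + τ w`, `u + τ v` and `v`. The
energy identity damps `d` only; the corrector with `e₁` damps `a`, the one with `e₂` damps `p`. -/
lemma exists_lyapunov {τ γ : ℝ} (hτ : 0 < τ) (hγ : 0 < γ) :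
    ∃ e₁ e₂ c : ℝ, 0 < e₁ ∧ 0 < e₂ ∧ 0 < c ∧ e₁ + e₂ ≤ 1 / 4 ∧ e₁ + e₂ ≤ γ * τ / 4 ∧
      ∀ x y a p d : ℝ, 0 ≤ x → 0 ≤ y → y ≤ x → y ≤ 1 →
        -γ * x * d ^ 2 + y * (e₂ * a ^ 2 - e₁ * a ^ 2 / τ + e₁ * d * a / τ - e₂ * x * p ^ 2
          - e₂ * γ * x * p * d + e₁ * x * d * p + e₁ * γ * x * d ^ 2) ≤
        -c * y * (a ^ 2 + x * p ^ 2 + x * d ^ 2) := by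
  -- `e₁ M ≤ γ / 2` lets the dissipation of `d` absorb the error terms in `d`, while `e₂ = e₁ / (4 τ)`
  -- lets the damping of `a` absorb the term `e₂ a²`.
  set M := 1 / τ + 2 * τ * (γ / (4 * τ) + 1) ^ 2 + γ with hM
  have hMpos : 0 < M := by positivity
  set σ := 1 + 1 / (4 * τ) with hσ
  have hσpos : 0 < σ := by positivity
  set e₁ := min (γ / (2 * M)) (min (1 / (4 * σ)) (γ * τ / (4 * σ))) with he₁
  have h1 : 0 < e₁ := by positivity
  have hb1 : e₁ * M ≤ γ / 2 := by
    have : e₁ ≤ γ / (2 * M) := min_le_left _ _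
    calc e₁ * M ≤ γ / (2 * M) * M := by gcongr
      _ = γ / 2 := by field_simp
  have hs : e₁ + e₁ / (4 * τ) = e₁ * σ := by rw [hσ]; field_simp
  have hb2 : e₁ * σ ≤ 1 / 4 := by
    have : e₁ ≤ 1 / (4 * σ) := (min_le_right _ _).trans (min_le_left _ _)
    calc e₁ * σ ≤ 1 / (4 * σ) * σ := by gcongr
      _ = _ := by field_simp
  have hb3 : e₁ * σ ≤ γ * τ / 4 := by
    have : e₁ ≤ γ * τ / (4 * σ) := (min_le_right _ _).trans (min_le_right _ _)
    calc e₁ * σ ≤ γ * τ / (4 * σ) * σ := by gcongr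
      _ = _ := by field_simp
  clear_value e₁
  refine ⟨e₁, e₁ / (4 * τ), min (e₁ / (2 * τ)) (min (e₁ / (8 * τ)) (γ / 2)), h1, by positivity,
    by positivity, hs ▸ hb2, hs ▸ hb3, fun x y a p d hx hy hyx hy1 => ?_⟩
  set c := min (e₁ / (2 * τ)) (min (e₁ / (8 * τ)) (γ / 2)) with hc
  have hc1 : c ≤ e₁ / (2 * τ) := min_le_left _ _
  have hc2 : c ≤ e₁ / (8 * τ) := (min_le_right _ _).trans (min_le_left _ _)
  have hc3 : c ≤ γ / 2 := (min_le_right _ _).trans (min_le_right _ _)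
  clear_value c
  have i1 : e₁ * d * a / τ ≤ e₁ / τ * (a ^ 2 / 4 + d ^ 2) := by
    have : 0 ≤ e₁ / τ * (a / 2 - d) ^ 2 := by positivity
    have e : e₁ / τ * (a / 2 - d) ^ 2 =
      e₁ / τ * (a ^ 2 / 4 + d ^ 2) - e₁ * d * a / τ := by ring
    linarith
  have i2 : -(e₁ / (4 * τ)) * γ * p * d + e₁ * d * p ≤
      e₁ / (8 * τ) * p ^ 2 + e₁ * (2 * τ * (γ / (4 * τ) + 1) ^ 2) * d ^ 2 := by
    have h0 : 0 ≤ e₁ / (8 * τ) * (p - 4 * τ * (1 - γ / (4 * τ)) * d) ^ 2 := by positivity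
    have e : e₁ / (8 * τ) * (p - 4 * τ * (1 - γ / (4 * τ)) * d) ^ 2 =
      e₁ / (8 * τ) * p ^ 2 - (-(e₁ / (4 * τ)) * γ * p * d + e₁ * d * p) +
        e₁ * (2 * τ * (1 - γ / (4 * τ)) ^ 2) * d ^ 2 := by
      field_simp; ring
    have h2 : (1 - γ / (4 * τ)) ^ 2 ≤ (γ / (4 * τ) + 1) ^ 2 := by
      have : 0 < γ / (4 * τ) := by positivity
      nlinarith
    have h3 : e₁ * (2 * τ * (1 - γ / (4 * τ)) ^ 2) * d ^ 2 ≤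
      e₁ * (2 * τ * (γ / (4 * τ) + 1) ^ 2) * d ^ 2 := by gcongr
    linarith
  have j1 : y * (e₁ * d * a / τ) ≤ y * (e₁ / τ * (a ^ 2 / 4)) + x * (e₁ / τ * d ^ 2) := by
    have h0 : y * (e₁ / τ * d ^ 2) ≤ x * (e₁ / τ * d ^ 2) := by gcongr
    linarith [mul_le_mul_of_nonneg_left i1 hy]
  have j2 : y * x * (-(e₁ / (4 * τ)) * γ * p * d + e₁ * d * p) ≤
      y * x * (e₁ / (8 * τ) * p ^ 2) +
        x * (e₁ * (2 * τ * (γ / (4 * τ) + 1) ^ 2) * d ^ 2) := by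
    have h0 : y * x * (e₁ * (2 * τ * (γ / (4 * τ) + 1) ^ 2) * d ^ 2) ≤
      1 * x * (e₁ * (2 * τ * (γ / (4 * τ) + 1) ^ 2) * d ^ 2) := by gcongr
    linarith [mul_le_mul_of_nonneg_left i2 (mul_nonneg hy hx)]
  have j3 : y * (e₁ * γ * x * d ^ 2) ≤ x * (e₁ * γ * d ^ 2) := by
    have h0 : y * (x * (e₁ * γ * d ^ 2)) ≤ 1 * (x * (e₁ * γ * d ^ 2)) := by gcongr
    linarith
  have j4 : x * (e₁ * M * d ^ 2) ≤ x * (γ / 2 * d ^ 2) := by gcongr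
  have j5 : c * y * (x * d ^ 2) ≤ γ / 2 * 1 * (x * d ^ 2) := by gcongr
  have j6 : y * (c * a ^ 2) ≤ y * (e₁ / (2 * τ) * a ^ 2) := by gcongr
  have j7 : y * (c * (x * p ^ 2)) ≤ y * (e₁ / (8 * τ) * (x * p ^ 2)) := by gcongr
  have k3 : x * (e₁ * M * d ^ 2) = x * (e₁ / τ * d ^ 2) +
      x * (e₁ * (2 * τ * (γ / (4 * τ) + 1) ^ 2) * d ^ 2) + x * (e₁ * γ * d ^ 2) := by
    rw [hM]; ring
  rw [k3] at j4
  have q1 : e₁ * d * a / τ = e₁ / τ * (d * a) := by ring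
  have q2 : e₁ * a ^ 2 / τ = e₁ / τ * a ^ 2 := by ring
  have q4 : e₁ / (4 * τ) = e₁ / τ / 4 := by field_simp
  have q8 : e₁ / (8 * τ) = e₁ / τ / 8 := by field_simp
  have q5 : e₁ / (2 * τ) = e₁ / τ / 2 := by field_simp
  clear i1 i2 hc1 hc2 k3 hb1 hb2 hb3 hs hσ hM
  simp only [q1, q2, q4, q8, q5] at *
  generalize e₁ / τ = r at *
  generalize 2 * τ * (γ / (4 * τ) + 1) ^ 2 = G at *
  linarith

/-! ### Quadratic functionals on `L²` and their time derivatives -/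

/-- The real part of the product of two square-integrable functions, integrated against a weight. -/
noncomputable def qform (g : E3 → ℝ) (f h : L2) : ℝ :=
  ∫ ξ, g ξ * ((f ξ).re * (h ξ).re + (f ξ).im * (h ξ).im)

/-- Multiplication by a bounded function. -/
noncomputable def mulOp {g : E3 → ℝ} (hg : MemLp (fun ξ => (g ξ : ℂ)) ∞ volume) : L2 →L[ℂ] L2 :=
  (ContinuousLinearMap.mul ℂ ℂ).holderL volume ∞ 2 2 hg.toLp

lemma mulOp_ae {g : E3 → ℝ} (hg : MemLp (fun ξ => (g ξ : ℂ)) ∞ volume) (f : L2) :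
    (mulOp hg f : E3 → ℂ) =ᵐ[volume] fun ξ => (g ξ : ℂ) * f ξ := by
  have h := (ContinuousLinearMap.mul ℂ ℂ).coeFn_holder (μ := (volume : Measure E3)) (r := 2)
    hg.toLp f
  filter_upwards [h, hg.coeFn_toLp] with ξ h1 h2
  unfold mulOp
  rw [ContinuousLinearMap.holderL_apply_apply, h1, h2]
  rfl

lemma qform_integrable {g : E3 → ℝ} (hg : MemLp (fun ξ => (g ξ : ℂ)) ∞ volume) (f h : L2) :
    Integrable (fun ξ => g ξ * ((f ξ).re * (h ξ).re + (f ξ).im * (h ξ).im)) volume := by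
  have := (L2.integrable_inner (𝕜 := ℂ) f (mulOp hg h)).re
  refine this.congr ?_
  filter_upwards [mulOp_ae hg h] with ξ hξ
  rw [hξ]
  simp [RCLike.inner_apply]
  ring

lemma qform_eq {g : E3 → ℝ} (hg : MemLp (fun ξ => (g ξ : ℂ)) ∞ volume) (f h : L2) :
    qform g f h = (inner ℂ f (mulOp hg h)).re := by
  rw [L2.inner_def]
  have := integral_re (L2.integrable_inner (𝕜 := ℂ) f (mulOp hg h))
  simp only [RCLike.re_to_complex] at this
  rw [← this, qform]
  refine integral_congr_ae ?_
  filter_upwards [mulOp_ae hg h] with ξ hξ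
  rw [hξ]
  simp [RCLike.inner_apply]
  ring

lemma qform_hasDerivWithinAt {g : E3 → ℝ} (hg : MemLp (fun ξ => (g ξ : ℂ)) ∞ volume)
    {f h : ℝ → L2} {f' h' : L2} {s : Set ℝ} {t : ℝ} (hf : HasDerivWithinAt f f' s t)
    (hh : HasDerivWithinAt h h' s t) :
    HasDerivWithinAt (fun t => qform g (f t) (h t)) (qform g f' (h t) + qform g (f t) h') s t := by
  have h1 : HasDerivWithinAt (fun t => mulOp hg (h t)) (mulOp hg h') s t :=
    ((mulOp hg).restrictScalars ℝ).hasFDerivAt.comp_hasDerivWithinAt t hh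
  have h2 := (hf.inner ℂ h1)
  have h3 := Complex.reCLM.hasFDerivAt.comp_hasDerivWithinAt t h2
  simp only [qform_eq hg]
  convert! h3 using 1
  simp [add_comm]

/-! ### Decay of frequency-localised solutions of the linearised equation -/

/-- The squared length of the Fourier transform of `(v + τ w, ∇(u + τ v), ∇v)`, in terms of the
Fourier transforms `a`, `p`, `d` of `v + τ w`, `u + τ v`, `v`. -/
noncomputable def quad (a p d : ℂ) (ξ : E3) : ℝ :=
  ‖a‖ ^ 2 + freq ξ ^ 2 * ‖p‖ ^ 2 + freq ξ ^ 2 * ‖d‖ ^ 2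

lemma quad_nonneg (a p d : ℂ) (ξ : E3) : 0 ≤ quad a p d ξ := by unfold quad; positivity

/-- The damping rate at a given frequency. -/
noncomputable def rate (ξ : E3) : ℝ := freq ξ ^ 2 / (1 + freq ξ ^ 2)

lemma rate_nonneg (ξ : E3) : 0 ≤ rate ξ := by unfold rate; positivity
lemma rate_le_one (ξ : E3) : rate ξ ≤ 1 := by
  unfold rate; rw [div_le_one (by positivity)]; linarith
lemma rate_le_sq (ξ : E3) : rate ξ ≤ freq ξ ^ 2 := by
  unfold rate; exact div_le_self (by positivity) (by nlinarith [sq_nonneg (freq ξ)])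

/-- A weight on the frequency side, bounded and with support in a bounded region on which the damping
rate is at least `l`. -/
structure IsWeight (m : E3 → ℝ) (l : ℝ) : Prop where
  meas : AEStronglyMeasurable m volume
  nonneg : ∀ ξ, 0 ≤ m ξ
  bdd : ∃ M R : ℝ, ∀ ξ, m ξ ≤ M ∧ (m ξ ≠ 0 → freq ξ ≤ R)
  rate_ge : ∀ ξ, m ξ ≠ 0 → l ≤ rate ξ

lemma IsWeight.memLp {m : E3 → ℝ} {l : ℝ} (hm : IsWeight m l) {g : E3 → ℝ} (hg : Continuous g)
    {B : ℝ → ℝ} (hB : ∀ R ξ, freq ξ ≤ R → |g ξ| ≤ B R) :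
    MemLp (fun ξ => ((m ξ * g ξ : ℝ) : ℂ)) ∞ volume := by
  obtain ⟨M, R, h⟩ := hm.bdd
  refine memLp_top_of_bound (Complex.continuous_ofReal.comp_aestronglyMeasurable
    (hm.meas.mul hg.aestronglyMeasurable)) (|M| * |B R|) (.of_forall fun ξ => ?_)
  rw [Complex.norm_real, norm_mul]
  by_cases h0 : m ξ = 0
  · rw [h0]; simp only [norm_zero, zero_mul]; positivity
  · have h1 := (h ξ).1
    have h2 := hB R ξ ((h ξ).2 h0)
    have h3 : ‖m ξ‖ ≤ |M| := by
      rw [Real.norm_of_nonneg (hm.nonneg ξ)]; exact h1.trans (le_abs_self _)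
    have h4 : ‖g ξ‖ ≤ |B R| := h2.trans (le_abs_self _)
    gcongr

lemma IsWeight.memLp_one {m : E3 → ℝ} {l : ℝ} (hm : IsWeight m l) :
    MemLp (fun ξ => (m ξ : ℂ)) ∞ volume := by
  have := hm.memLp (g := fun _ => 1) continuous_const (B := fun _ => 1) (by simp)
  simpa using this

lemma IsWeight.memLp_sq {m : E3 → ℝ} {l : ℝ} (hm : IsWeight m l) :
    MemLp (fun ξ => ((m ξ * freq ξ ^ 2 : ℝ) : ℂ)) ∞ volume :=
  hm.memLp (continuous_freq.pow 2) (B := fun R => R ^ 2) fun R ξ h => by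
    rw [abs_of_nonneg (by positivity)]
    exact pow_le_pow_left₀ (freq_nonneg ξ) h 2

lemma IsWeight.memLp_rate {m : E3 → ℝ} {l : ℝ} (hm : IsWeight m l) :
    MemLp (fun ξ => ((m ξ * rate ξ : ℝ) : ℂ)) ∞ volume :=
  hm.memLp (by
    unfold rate
    exact (continuous_freq.pow 2).div (continuous_const.add (continuous_freq.pow 2))
      fun ξ => (by positivity : 0 < 1 + freq ξ ^ 2).ne') (B := fun _ => 1) fun R ξ _ => by
    rw [abs_of_nonneg (rate_nonneg ξ)]; exact rate_le_one ξ

/-- The squared weighted norm of `(v + τ w, ∇(u + τ v), ∇v)`. -/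
noncomputable def wnormSq (m : E3 → ℝ) (a p d : L2) : ℝ := ∫ ξ, m ξ * quad (a ξ) (p ξ) (d ξ) ξ

/-- The squared weighted norm of a scalar function. -/
noncomputable def wnormSq₁ (m : E3 → ℝ) (f : L2) : ℝ := ∫ ξ, m ξ * ‖f ξ‖ ^ 2

lemma norm_sq_re_im (z : ℂ) : ‖z‖ ^ 2 = z.re * z.re + z.im * z.im := by
  rw [← Complex.normSq_eq_norm_sq, Complex.normSq_apply]

lemma wnormSq₁_eq (m : E3 → ℝ) (f : L2) : wnormSq₁ m f = qform m f f := by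
  simp only [wnormSq₁, qform, norm_sq_re_im]

lemma IsWeight.integrable₁ {m : E3 → ℝ} {l : ℝ} (hm : IsWeight m l) (f : L2) :
    Integrable (fun ξ => m ξ * ‖f ξ‖ ^ 2) volume := by
  simp only [norm_sq_re_im]
  exact qform_integrable hm.memLp_one f f

lemma IsWeight.integrable_quad {m : E3 → ℝ} {l : ℝ} (hm : IsWeight m l) (a p d : L2) :
    Integrable (fun ξ => m ξ * quad (a ξ) (p ξ) (d ξ) ξ) volume := by
  have h1 := qform_integrable hm.memLp_one a a
  have h2 := qform_integrable hm.memLp_sq p p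
  have h3 := qform_integrable hm.memLp_sq d d
  refine ((h1.add h2).add h3).congr (.of_forall fun ξ => ?_)
  simp only [Pi.add_apply, quad, norm_sq_re_im]
  ring

lemma wnormSq_nonneg {m : E3 → ℝ} {l : ℝ} (hm : IsWeight m l) (a p d : L2) :
    0 ≤ wnormSq m a p d :=
  integral_nonneg fun ξ => mul_nonneg (hm.nonneg ξ) (quad_nonneg _ _ _ _)

/-- The Lyapunov functional at a given frequency. -/
noncomputable def lyapAt (κ e₁ e₂ : ℝ) (a p d : ℂ) (ξ : E3) : ℝ :=
  1 / 2 * ‖a‖ ^ 2 + 1 / 2 * (freq ξ ^ 2 * ‖p‖ ^ 2) + κ / 2 * (freq ξ ^ 2 * ‖d‖ ^ 2) +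
    e₂ * (rate ξ * (p.re * a.re + p.im * a.im)) - e₁ * (rate ξ * (d.re * a.re + d.im * a.im))

lemma rate_mul_le (ξ : E3) (a p : ℂ) :
    |rate ξ * (p.re * a.re + p.im * a.im)| ≤ 1 / 2 * (‖a‖ ^ 2 + freq ξ ^ 2 * ‖p‖ ^ 2) := by
  have h0 := rate_nonneg ξ
  have h1 : rate ξ ^ 2 ≤ freq ξ ^ 2 := by nlinarith [rate_le_sq ξ, rate_le_one ξ]
  have h2 : rate ξ ^ 2 * ‖p‖ ^ 2 ≤ freq ξ ^ 2 * ‖p‖ ^ 2 := by gcongr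
  rw [norm_sq_re_im, norm_sq_re_im] at *
  rw [abs_le]
  constructor <;> nlinarith [sq_nonneg (rate ξ * p.re - a.re), sq_nonneg (rate ξ * p.im - a.im),
    sq_nonneg (rate ξ * p.re + a.re), sq_nonneg (rate ξ * p.im + a.im)]

/-- The correctors are small: the Lyapunov functional is equivalent to the squared length. -/
lemma lyapAt_bounds {κ e₁ e₂ : ℝ} (he₁ : 0 < e₁) (he₂ : 0 < e₂)
    (h1 : e₁ + e₂ ≤ 1 / 4) (h2 : e₁ + e₂ ≤ κ / 4) (a p d : ℂ) (ξ : E3) :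
    min 1 κ / 4 * quad a p d ξ ≤ lyapAt κ e₁ e₂ a p d ξ ∧
      lyapAt κ e₁ e₂ a p d ξ ≤ (1 + κ) * quad a p d ξ := by
  have i1 := abs_le.1 (rate_mul_le ξ a p)
  have i2 := abs_le.1 (rate_mul_le ξ a d)
  have hp : 0 ≤ freq ξ ^ 2 * ‖p‖ ^ 2 := by positivity
  have hd : 0 ≤ freq ξ ^ 2 * ‖d‖ ^ 2 := by positivity
  have ha : 0 ≤ ‖a‖ ^ 2 := by positivity
  unfold lyapAt quad
  generalize freq ξ ^ 2 * ‖p‖ ^ 2 = x at *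
  generalize freq ξ ^ 2 * ‖d‖ ^ 2 = z at *
  generalize ‖a‖ ^ 2 = y at *
  generalize rate ξ * (p.re * a.re + p.im * a.im) = r at *
  generalize rate ξ * (d.re * a.re + d.im * a.im) = s at *
  have m1 : min 1 κ ≤ 1 := min_le_left _ _
  have m2 : min 1 κ ≤ κ := min_le_right _ _
  constructor
  · have b1 : min 1 κ * y ≤ 1 * y := by gcongr
    have b2 : min 1 κ * x ≤ 1 * x := by gcongr
    have b3 : min 1 κ * z ≤ κ * z := by gcongr
    nlinarith [mul_le_mul_of_nonneg_left i1.1 he₂.le, mul_le_mul_of_nonneg_left i2.2 he₁.le,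
      mul_nonneg he₁.le hd, mul_nonneg he₂.le hp, mul_nonneg he₁.le hp, mul_nonneg he₂.le hd,
      mul_le_mul_of_nonneg_right h1 ha, mul_le_mul_of_nonneg_right h1 hp,
      mul_le_mul_of_nonneg_right h2 hd]
  · have hκ : 0 ≤ κ := by linarith
    nlinarith [mul_le_mul_of_nonneg_left i1.2 he₂.le, mul_le_mul_of_nonneg_left i2.1 he₁.le,
      mul_nonneg he₁.le hd, mul_nonneg he₂.le hp, mul_nonneg he₁.le hp, mul_nonneg he₂.le hd,
      mul_le_mul_of_nonneg_right h1 ha, mul_le_mul_of_nonneg_right h1 hp,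
      mul_le_mul_of_nonneg_right h2 hd, mul_nonneg hκ ha, mul_nonneg hκ hp, mul_nonneg hκ hd]

/-- The time derivative of the Lyapunov functional at a given frequency, where `r` and `s` are the
time derivatives of `a` and `d`, and that of `p` is `a`. -/
noncomputable def lyapDeriv (κ e₁ e₂ : ℝ) (a p d r s : ℂ) (ξ : E3) : ℝ :=
  (a.re * r.re + a.im * r.im) + freq ξ ^ 2 * (p.re * a.re + p.im * a.im) +
    κ * (freq ξ ^ 2 * (d.re * s.re + d.im * s.im)) +
    e₂ * (rate ξ * (‖a‖ ^ 2 + (p.re * r.re + p.im * r.im))) -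
    e₁ * (rate ξ * ((s.re * a.re + s.im * a.im) + (d.re * r.re + d.im * r.im)))

lemma re_im_le (z n : ℂ) : z.re * n.re + z.im * n.im ≤ ‖z‖ * ‖n‖ := by
  refine le_trans (Complex.re_le_norm ((starRingEnd ℂ z) * n) |> le_of_eq_of_le ?_) (by simp)
  simp [Complex.mul_re]

/-- The contribution of the source `n` to the derivative of the Lyapunov functional. -/
lemma lyapSource_le {e₁ e₂ : ℝ} (he₁ : 0 < e₁) (he₂ : 0 < e₂) (h1 : e₁ + e₂ ≤ 1 / 4)
    (a p d n : ℂ) (ξ : E3) :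
    (a.re * n.re + a.im * n.im) + rate ξ * (e₂ * (p.re * n.re + p.im * n.im)
      - e₁ * (d.re * n.re + d.im * n.im)) ≤ 2 * ‖n‖ * √(quad a p d ξ) := by
  have hr0 := rate_nonneg ξ
  have hr1 := rate_le_one ξ
  have hr2 := rate_le_sq ξ
  have hx : 0 ≤ freq ξ ^ 2 := by positivity
  set z : ℂ := a + (rate ξ : ℝ) * ((e₂ : ℝ) * p - (e₁ : ℝ) * d) with hz
  have e : (a.re * n.re + a.im * n.im) + rate ξ * (e₂ * (p.re * n.re + p.im * n.im)
    - e₁ * (d.re * n.re + d.im * n.im)) = z.re * n.re + z.im * n.im := by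
    simp [hz]; ring
  rw [e]
  refine (re_im_le z n).trans ?_
  have hrk : rate ξ ≤ freq ξ := by
    rw [← abs_of_nonneg hr0, ← abs_of_nonneg (freq_nonneg ξ), ← sq_le_sq]
    nlinarith
  have s1 : ‖a‖ ≤ √(quad a p d ξ) := Real.le_sqrt_of_sq_le (by
    unfold quad; nlinarith [mul_nonneg hx (sq_nonneg ‖p‖), mul_nonneg hx (sq_nonneg ‖d‖)])
  have s2 : freq ξ * ‖p‖ ≤ √(quad a p d ξ) := Real.le_sqrt_of_sq_le (by
    unfold quad; nlinarith [mul_nonneg hx (sq_nonneg ‖d‖), sq_nonneg ‖a‖])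
  have s3 : freq ξ * ‖d‖ ≤ √(quad a p d ξ) := Real.le_sqrt_of_sq_le (by
    unfold quad; nlinarith [mul_nonneg hx (sq_nonneg ‖p‖), sq_nonneg ‖a‖])
  have hz2 : ‖z‖ ≤ 2 * √(quad a p d ξ) := by
    calc ‖z‖ ≤ ‖a‖ + rate ξ * (e₂ * ‖p‖ + e₁ * ‖d‖) := by
          refine (norm_add_le _ _).trans ?_
          rw [norm_mul, Complex.norm_real, Real.norm_of_nonneg hr0]
          gcongr
          refine (norm_sub_le _ _).trans ?_
          rw [norm_mul, norm_mul, Complex.norm_real, Complex.norm_real,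
            Real.norm_of_nonneg he₁.le, Real.norm_of_nonneg he₂.le]
      _ ≤ ‖a‖ + freq ξ * (e₂ * ‖p‖ + e₁ * ‖d‖) := by gcongr
      _ = ‖a‖ + (e₂ * (freq ξ * ‖p‖) + e₁ * (freq ξ * ‖d‖)) := by ring
      _ ≤ √(quad a p d ξ) + (e₂ * √(quad a p d ξ) + e₁ * √(quad a p d ξ)) := by gcongr
      _ ≤ _ := by linarith [mul_le_mul_of_nonneg_right h1 (Real.sqrt_nonneg (quad a p d ξ)),
          Real.sqrt_nonneg (quad a p d ξ)]
  calc ‖z‖ * ‖n‖ ≤ 2 * √(quad a p d ξ) * ‖n‖ := by gcongr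
    _ = _ := by ring

/-- The Lyapunov functional decays along the linearised equation at a rate proportional to `rate`,
up to the source `n`: real and imaginary parts satisfy the real inequality `hc` separately. -/
lemma lyapDeriv_le {τ γ e₁ e₂ c : ℝ} (hτ : 0 < τ) (he₁ : 0 < e₁) (he₂ : 0 < e₂)
    (h1 : e₁ + e₂ ≤ 1 / 4)
    (hc : ∀ x y a p d : ℝ, 0 ≤ x → 0 ≤ y → y ≤ x → y ≤ 1 →
        -γ * x * d ^ 2 + y * (e₂ * a ^ 2 - e₁ * a ^ 2 / τ + e₁ * d * a / τ - e₂ * x * p ^ 2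
          - e₂ * γ * x * p * d + e₁ * x * d * p + e₁ * γ * x * d ^ 2) ≤
        -c * y * (a ^ 2 + x * p ^ 2 + x * d ^ 2)) (a p d n : ℂ) (ξ : E3) :
    lyapDeriv (γ * τ) e₁ e₂ a p d (-(freq ξ ^ 2 : ℝ) * p - (γ * freq ξ ^ 2 : ℝ) * d + n)
      ((1 / τ : ℝ) * (a - d)) ξ ≤ -c * rate ξ * quad a p d ξ + 2 * ‖n‖ * √(quad a p d ξ) := by
  have hr0 := rate_nonneg ξ
  have hr1 := rate_le_one ξ
  have hr2 := rate_le_sq ξ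
  have hx : 0 ≤ freq ξ ^ 2 := by positivity
  have c1 := hc _ _ a.re p.re d.re hx hr0 hr2 hr1
  have c2 := hc _ _ a.im p.im d.im hx hr0 hr2 hr1
  have hn := lyapSource_le he₁ he₂ h1 a p d n ξ
  refine le_trans (le_of_eq ?_) (add_le_add (add_le_add c1 c2) hn) |>.trans (le_of_eq ?_)
  · unfold lyapDeriv
    simp only [norm_sq_re_im, Complex.add_re, Complex.sub_re, Complex.neg_re, Complex.mul_re,
      Complex.ofReal_re, Complex.ofReal_im, Complex.add_im, Complex.sub_im, Complex.neg_im,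
      Complex.mul_im, zero_mul, sub_zero, add_zero, neg_zero]
    field_simp
    ring
  · simp only [quad, norm_sq_re_im]; ring

/-! ### Solutions of the linearised equation -/

/-- On the Fourier side, `a`, `p`, `d` (standing for `v + τ w`, `u + τ v` and `v`) solve the
linearised equation with source `n`; the functions `r` and `s` are the time derivatives of `a` and
`d`, that of `p` is `a`. -/
structure IsLinearSolution (τ γ : ℝ) (a p d n r s : ℝ → L2) : Prop where
  deriv_a : ∀ t, 0 ≤ t → HasDerivWithinAt a (r t) (Ici 0) t
  deriv_p : ∀ t, 0 ≤ t → HasDerivWithinAt p (a t) (Ici 0) t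
  deriv_d : ∀ t, 0 ≤ t → HasDerivWithinAt d (s t) (Ici 0) t
  eq_r : ∀ t, 0 ≤ t → ∀ᵐ ξ, r t ξ =
    -(freq ξ ^ 2 : ℝ) * p t ξ - (γ * freq ξ ^ 2 : ℝ) * d t ξ + n t ξ
  eq_s : ∀ t, 0 ≤ t → ∀ᵐ ξ, s t ξ = (1 / τ : ℝ) * (a t ξ - d t ξ)

lemma integral_comb {f₁ f₂ f₃ f₄ f₅ : E3 → ℝ} (h₁ : Integrable f₁ volume)
    (h₂ : Integrable f₂ volume) (h₃ : Integrable f₃ volume) (h₄ : Integrable f₄ volume)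
    (h₅ : Integrable f₅ volume) :
    Integrable (fun ξ => f₁ ξ + f₂ ξ + f₃ ξ + f₄ ξ - f₅ ξ) volume ∧
    ∫ ξ, (f₁ ξ + f₂ ξ + f₃ ξ + f₄ ξ - f₅ ξ) =
      (∫ ξ, f₁ ξ) + (∫ ξ, f₂ ξ) + (∫ ξ, f₃ ξ) + (∫ ξ, f₄ ξ) - ∫ ξ, f₅ ξ := by
  have h₁₂ : Integrable (fun ξ => f₁ ξ + f₂ ξ) volume := h₁.add h₂
  have h₁₃ : Integrable (fun ξ => f₁ ξ + f₂ ξ + f₃ ξ) volume := h₁₂.add h₃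
  have h₁₄ : Integrable (fun ξ => f₁ ξ + f₂ ξ + f₃ ξ + f₄ ξ) volume := h₁₃.add h₄
  exact ⟨h₁₄.sub h₅, by rw [integral_sub h₁₄ h₅, integral_add h₁₃ h₄, integral_add h₁₂ h₃,
    integral_add h₁ h₂]⟩

lemma qform_add_eq {g : E3 → ℝ} (hg : MemLp (fun ξ => (g ξ : ℂ)) ∞ volume) (f h f' h' : L2) :
    Integrable (fun ξ => g ξ * ((f ξ).re * (h ξ).re + (f ξ).im * (h ξ).im) +
      g ξ * ((f' ξ).re * (h' ξ).re + (f' ξ).im * (h' ξ).im)) volume ∧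
    qform g f h + qform g f' h' =
      ∫ ξ, (g ξ * ((f ξ).re * (h ξ).re + (f ξ).im * (h ξ).im) +
        g ξ * ((f' ξ).re * (h' ξ).re + (f' ξ).im * (h' ξ).im)) :=
  ⟨(qform_integrable hg f h).add (qform_integrable hg f' h'),
    (integral_add (qform_integrable hg f h) (qform_integrable hg f' h')).symm⟩

/-- The Lyapunov functional integrated against a weight. -/
noncomputable def lyapInt (m : E3 → ℝ) (κ e₁ e₂ : ℝ) (a p d : L2) : ℝ :=
  1 / 2 * qform m a a + 1 / 2 * qform (fun ξ => m ξ * freq ξ ^ 2) p p +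
    κ / 2 * qform (fun ξ => m ξ * freq ξ ^ 2) d d +
    e₂ * qform (fun ξ => m ξ * rate ξ) p a - e₁ * qform (fun ξ => m ξ * rate ξ) d a

lemma lyapInt_eq {m : E3 → ℝ} {l : ℝ} (hm : IsWeight m l) (κ e₁ e₂ : ℝ) (a p d : L2) :
    Integrable (fun ξ => m ξ * lyapAt κ e₁ e₂ (a ξ) (p ξ) (d ξ) ξ) volume ∧
      lyapInt m κ e₁ e₂ a p d = ∫ ξ, m ξ * lyapAt κ e₁ e₂ (a ξ) (p ξ) (d ξ) ξ := by
  have i1 := (qform_integrable hm.memLp_one a a).const_mul (1 / 2)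
  have i2 := (qform_integrable hm.memLp_sq p p).const_mul (1 / 2)
  have i3 := (qform_integrable hm.memLp_sq d d).const_mul (κ / 2)
  have i4 := (qform_integrable hm.memLp_rate p a).const_mul e₂
  have i5 := (qform_integrable hm.memLp_rate d a).const_mul e₁
  obtain ⟨i, hi⟩ := integral_comb i1 i2 i3 i4 i5
  have e : ∀ ξ, m ξ * lyapAt κ e₁ e₂ (a ξ) (p ξ) (d ξ) ξ = _ := fun ξ => by
    unfold lyapAt
    rw [norm_sq_re_im, norm_sq_re_im, norm_sq_re_im]
  refine ⟨i.congr (.of_forall fun ξ => ?_), ?_⟩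
  · simp only [e]
    ring
  · simp only [lyapInt, qform, ← integral_const_mul]
    rw [← hi]
    refine integral_congr_ae (.of_forall fun ξ => ?_)
    simp only [e]
    ring

lemma lyapInt_hasDerivWithinAt {τ γ : ℝ} {a p d n r s : ℝ → L2}
    (h : IsLinearSolution τ γ a p d n r s) {m : E3 → ℝ} {l : ℝ} (hm : IsWeight m l)
    (κ e₁ e₂ : ℝ) {t : ℝ} (ht : 0 ≤ t) :
    Integrable (fun ξ => m ξ * lyapDeriv κ e₁ e₂ (a t ξ) (p t ξ) (d t ξ) (r t ξ) (s t ξ) ξ) volume ∧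
    HasDerivWithinAt (fun t => lyapInt m κ e₁ e₂ (a t) (p t) (d t))
      (∫ ξ, m ξ * lyapDeriv κ e₁ e₂ (a t ξ) (p t ξ) (d t ξ) (r t ξ) (s t ξ) ξ) (Ici 0) t := by
  have ha := h.deriv_a t ht
  have hp := h.deriv_p t ht
  have hd := h.deriv_d t ht
  have d1 := (qform_hasDerivWithinAt hm.memLp_one ha ha).const_mul (1 / 2)
  have d2 := (qform_hasDerivWithinAt hm.memLp_sq hp hp).const_mul (1 / 2)
  have d3 := (qform_hasDerivWithinAt hm.memLp_sq hd hd).const_mul (κ / 2)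
  have d4 := (qform_hasDerivWithinAt hm.memLp_rate hp ha).const_mul e₂
  have d5 := (qform_hasDerivWithinAt hm.memLp_rate hd ha).const_mul e₁
  have D := (((d1.add d2).add d3).add d4).sub d5
  have q1 := qform_add_eq hm.memLp_one (r t) (a t) (a t) (r t)
  have q2 := qform_add_eq hm.memLp_sq (a t) (p t) (p t) (a t)
  have q3 := qform_add_eq hm.memLp_sq (s t) (d t) (d t) (s t)
  have q4 := qform_add_eq hm.memLp_rate (a t) (a t) (p t) (r t)
  have q5 := qform_add_eq hm.memLp_rate (s t) (a t) (d t) (r t)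
  obtain ⟨i, hi⟩ := integral_comb (q1.1.const_mul (1 / 2)) (q2.1.const_mul (1 / 2))
    (q3.1.const_mul (κ / 2)) (q4.1.const_mul e₂) (q5.1.const_mul e₁)
  refine ⟨i.congr (.of_forall fun ξ => ?_), ?_⟩
  · simp only [lyapDeriv, norm_sq_re_im]
    ring
  · convert! D using 1
    rw [q1.2, q2.2, q3.2, q4.2, q5.2]
    simp only [← integral_const_mul]
    rw [← hi]
    refine integral_congr_ae (.of_forall fun ξ => ?_)
    simp only [lyapDeriv, norm_sq_re_im]
    ring

/-- Cauchy-Schwarz inequality with a weight. -/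
lemma IsWeight.integral_mul_le {m : E3 → ℝ} {l : ℝ} (hm : IsWeight m l) {f g : E3 → ℝ}
    (hf0 : ∀ ξ, 0 ≤ f ξ) (hg0 : ∀ ξ, 0 ≤ g ξ) (hfm : AEStronglyMeasurable f volume)
    (hgm : AEStronglyMeasurable g volume)
    (hf : Integrable (fun ξ => m ξ * f ξ ^ 2) volume)
    (hg : Integrable (fun ξ => m ξ * g ξ ^ 2) volume) :
    Integrable (fun ξ => m ξ * (f ξ * g ξ)) volume ∧
      ∫ ξ, m ξ * (f ξ * g ξ) ≤ √(∫ ξ, m ξ * f ξ ^ 2) * √(∫ ξ, m ξ * g ξ ^ 2) := by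
  have hsm : AEStronglyMeasurable (fun ξ => √(m ξ)) volume :=
    Real.continuous_sqrt.comp_aestronglyMeasurable hm.meas
  have hs : ∀ ξ, √(m ξ) ^ 2 = m ξ := fun ξ => Real.sq_sqrt (hm.nonneg ξ)
  have h1 : MemLp (fun ξ => √(m ξ) * f ξ) 2 volume := by
    refine (memLp_two_iff_integrable_sq (hsm.mul hfm)).2 ?_
    simpa only [Pi.mul_apply, mul_pow, hs] using hf
  have h2 : MemLp (fun ξ => √(m ξ) * g ξ) 2 volume := by
    refine (memLp_two_iff_integrable_sq (hsm.mul hgm)).2 ?_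
    simpa only [Pi.mul_apply, mul_pow, hs] using hg
  have e : ∀ ξ, m ξ * (f ξ * g ξ) = (√(m ξ) * f ξ) * (√(m ξ) * g ξ) := fun ξ => by
    conv_lhs => rw [← hs ξ]
    ring
  have hi := h1.integrable_mul h2
  refine ⟨hi.congr (.of_forall fun ξ => (e ξ).symm), ?_⟩
  have := integral_mul_le_Lp_mul_Lq_of_nonneg (μ := volume) Real.HolderConjugate.two_two
    (f := fun ξ => √(m ξ) * f ξ) (g := fun ξ => √(m ξ) * g ξ)
    (.of_forall fun ξ => mul_nonneg (Real.sqrt_nonneg _) (hf0 ξ))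
    (.of_forall fun ξ => mul_nonneg (Real.sqrt_nonneg _) (hg0 ξ))
    (by simpa using h1) (by simpa using h2)
  simp only [Real.rpow_ofNat, mul_pow, hs, ← Real.sqrt_eq_rpow] at this
  simpa only [e] using this

/-- A solution of the linearised equation, localised to frequencies with damping rate at least
`l`, decays at a rate proportional to `l`, up to the effect of a decaying source. -/
theorem exists_linear_decay {τ γ : ℝ} (hτ : 0 < τ) (hγ : 0 < γ) :
    ∃ c C : ℝ, 0 < c ∧ 0 < C ∧ ∀ {m : E3 → ℝ} {l : ℝ}, 0 < l → IsWeight m l →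
      ∀ {a p d n r s : ℝ → L2}, IsLinearSolution τ γ a p d n r s → ∀ {t K : ℝ}, 0 ≤ t → 0 ≤ K →
        (∀ σ ∈ Icc 0 t, √(wnormSq₁ m (n σ)) ≤ K * (1 + σ) ^ (-3 / 2 : ℝ)) →
        √(wnormSq m (a t) (p t) (d t)) ≤
          C * (Real.exp (-c * l * t) * (√(wnormSq m (a 0) (p 0) (d 0)) + K) +
            K * (1 + t) ^ (-3 / 2 : ℝ) * min (1 / l) (1 + t)) := by
  obtain ⟨e₁, e₂, c, he₁, he₂, hc, hs1, hs2, hlyap⟩ := exists_lyapunov hτ hγ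
  -- With this coefficient of `|ξ|² |d|²` the cross terms of the energy identity cancel.
  set κ := γ * τ with hκ
  have hκ0 : 0 < κ := by positivity
  set κ₁ := min 1 κ / 4 with hκ₁
  have hκ₁0 : 0 < κ₁ := by positivity
  set κ₂ := 1 + κ with hκ₂
  have hκ₂0 : 0 < κ₂ := by positivity
  set c₀ := c / (2 * κ₂) with hc₀
  have hc₀0 : 0 < c₀ := by positivity
  set k := 1 / √κ₁ with hk
  have hk0 : 0 < k := by positivity
  have hkk : √κ₁ * k = 1 := by rw [hk]; field_simp
  refine ⟨c₀ / 2, k * (√κ₂ + 2 * k + 3 * k * max 1 (1 / c₀)), by positivity, by positivity, ?_⟩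
  intro m l hl hm a p d n r s hsol t K ht hK hn
  set L : ℝ → ℝ := fun t => lyapInt m κ e₁ e₂ (a t) (p t) (d t) with hL
  set X : ℝ → ℝ := fun t => wnormSq m (a t) (p t) (d t) with hX
  have hX0 : ∀ t, 0 ≤ X t := fun t => wnormSq_nonneg hm _ _ _
  have hLX : ∀ t, κ₁ * X t ≤ L t ∧ L t ≤ κ₂ * X t := by
    intro t
    obtain ⟨hi, he⟩ := lyapInt_eq hm κ e₁ e₂ (a t) (p t) (d t)
    have hq := hm.integrable_quad (a t) (p t) (d t)
    simp only [hL, hX, wnormSq, he, ← integral_const_mul]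
    constructor
    · refine integral_mono (hq.const_mul _) hi fun ξ => ?_
      have := (lyapAt_bounds he₁ he₂ hs1 hs2 (a t ξ) (p t ξ) (d t ξ) ξ).1
      rw [← hκ₁] at this
      have := mul_le_mul_of_nonneg_left this (hm.nonneg ξ)
      simp only
      linarith
    · refine integral_mono hi (hq.const_mul _) fun ξ => ?_
      have := (lyapAt_bounds he₁ he₂ hs1 hs2 (a t ξ) (p t ξ) (d t ξ) ξ).2
      have := mul_le_mul_of_nonneg_left this (hm.nonneg ξ)
      simp only
      linarith
  set L' : ℝ → ℝ := fun t =>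
    ∫ ξ, m ξ * lyapDeriv κ e₁ e₂ (a t ξ) (p t ξ) (d t ξ) (r t ξ) (s t ξ) ξ with hL'
  have hLd : ∀ σ, 0 ≤ σ → HasDerivWithinAt L (L' σ) (Ici 0) σ := fun σ hσ =>
    (lyapInt_hasDerivWithinAt hsol hm κ e₁ e₂ hσ).2
  have hsX : ∀ σ, √(X σ) ≤ k * √(L σ) := fun σ => by
    have h1 : √κ₁ * √(X σ) ≤ √(L σ) := by
      rw [← Real.sqrt_mul hκ₁0.le]; exact Real.sqrt_le_sqrt (hLX σ).1
    calc √(X σ) = k * (√κ₁ * √(X σ)) := by rw [← mul_assoc, mul_comm k, hkk, one_mul]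
      _ ≤ _ := by gcongr
  have hdiss : ∀ σ ∈ Ico 0 t, L' σ ≤ -2 * (c₀ * l) * L σ +
      2 * (k * K * (1 + σ) ^ (-3 / 2 : ℝ)) * √(L σ) := by
    intro σ hσ
    have hσ0 : 0 ≤ σ := hσ.1
    have hq := hm.integrable_quad (a σ) (p σ) (d σ)
    have hmeas : AEStronglyMeasurable (fun ξ => quad (a σ ξ) (p σ ξ) (d σ ξ) ξ) volume := by
      have ha := (Lp.memLp (a σ)).1.norm.pow 2
      have hp := (Lp.memLp (p σ)).1.norm.pow 2
      have hd := (Lp.memLp (d σ)).1.norm.pow 2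
      have hf := (continuous_freq.pow 2).aestronglyMeasurable (μ := (volume : Measure E3))
      exact (ha.add (hf.mul hp)).add (hf.mul hd)
    have hsq : ∀ ξ, √(quad (a σ ξ) (p σ ξ) (d σ ξ) ξ) ^ 2 = quad (a σ ξ) (p σ ξ) (d σ ξ) ξ :=
      fun ξ => Real.sq_sqrt (quad_nonneg _ _ _ _)
    obtain ⟨hi, hCS⟩ := hm.integral_mul_le (f := fun ξ => ‖n σ ξ‖)
      (g := fun ξ => √(quad (a σ ξ) (p σ ξ) (d σ ξ) ξ)) (fun ξ => norm_nonneg _)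
      (fun ξ => Real.sqrt_nonneg _) (Lp.memLp (n σ)).1.norm
      (Real.continuous_sqrt.comp_aestronglyMeasurable hmeas) (hm.integrable₁ (n σ))
      (by simpa only [hsq] using hq)
    simp only [hsq] at hCS
    have h1 : L' σ ≤ -(c * l) * X σ + 2 * (√(wnormSq₁ m (n σ)) * √(X σ)) := by
      calc L' σ ≤ ∫ ξ, (-(c * l) * (m ξ * quad (a σ ξ) (p σ ξ) (d σ ξ) ξ) +
            2 * (m ξ * (‖n σ ξ‖ * √(quad (a σ ξ) (p σ ξ) (d σ ξ) ξ)))) := by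
            refine integral_mono_ae (lyapInt_hasDerivWithinAt hsol hm κ e₁ e₂ hσ0).1
              ((hq.const_mul _).add (hi.const_mul 2)) ?_
            filter_upwards [hsol.eq_r σ hσ0, hsol.eq_s σ hσ0] with ξ h1 h2
            rw [h1, h2]
            have := lyapDeriv_le hτ he₁ he₂ hs1 hlyap (a σ ξ) (p σ ξ) (d σ ξ) (n σ ξ) ξ
            have h3 := mul_le_mul_of_nonneg_left this (hm.nonneg ξ)
            refine h3.trans ?_
            by_cases h0 : m ξ = 0
            · simp [h0]
            · have h4 := hm.rate_ge ξ h0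
              have h5 : l * (m ξ * quad (a σ ξ) (p σ ξ) (d σ ξ) ξ) ≤
                  rate ξ * (m ξ * quad (a σ ξ) (p σ ξ) (d σ ξ) ξ) :=
                mul_le_mul_of_nonneg_right h4 (mul_nonneg (hm.nonneg ξ) (quad_nonneg _ _ _ _))
              have h6 := mul_le_mul_of_nonneg_left h5 hc.le
              linarith
        _ = -(c * l) * X σ + 2 * ∫ ξ, m ξ * (‖n σ ξ‖ * √(quad (a σ ξ) (p σ ξ) (d σ ξ) ξ)) := by
            rw [integral_add (hq.const_mul _) (hi.const_mul 2), integral_const_mul,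
              integral_const_mul]
            rfl
        _ ≤ _ := by
            gcongr
            exact hCS
    have h2 : 2 * (c₀ * l) * L σ ≤ c * l * X σ := by
      calc 2 * (c₀ * l) * L σ ≤ 2 * (c₀ * l) * (κ₂ * X σ) := by gcongr; exact (hLX σ).2
        _ = _ := by rw [hc₀]; field_simp
    have h3 : √(wnormSq₁ m (n σ)) * √(X σ) ≤ K * (1 + σ) ^ (-3 / 2 : ℝ) * (k * √(L σ)) := by
      have : 0 ≤ (1 + σ) ^ (-3 / 2 : ℝ) := by
        have : 0 ≤ 1 + σ := by linarith
        positivity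
      gcongr
      · exact hn σ ⟨hσ.1, hσ.2.le⟩
      · exact hsX σ
    linarith
  have hdec := sqrt_le_decay (L := L) (L' := L') (μ := c₀ * l) (K := k * K) (by positivity) ht
    (by positivity)
    (fun σ hσ => ((hLd σ hσ.1).continuousWithinAt).mono Icc_subset_Ici_self)
    (fun σ hσ => (hLd σ hσ.1).mono (Ici_subset_Ici.2 hσ.1)) hdiss
  have hL0 : √(L 0) ≤ √κ₂ * √(X 0) := by
    rw [← Real.sqrt_mul hκ₂0.le]; exact Real.sqrt_le_sqrt (hLX 0).2
  have hmin : min (1 / (c₀ * l)) (1 + t) ≤ max 1 (1 / c₀) * min (1 / l) (1 + t) := by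
    rw [mul_min_of_nonneg _ _ (by positivity)]
    refine min_le_min ?_ ?_
    · rw [← one_div_mul_one_div]
      gcongr
      exact le_max_right _ _
    · exact le_mul_of_one_le_left (by linarith) (le_max_left _ _)
  have ee : -(c₀ * l) * t / 2 = -(c₀ / 2) * l * t := by ring
  rw [ee] at hdec
  set E := Real.exp (-(c₀ / 2) * l * t) with hE
  have hE0 : 0 < E := Real.exp_pos _
  set T := (1 + t) ^ (-3 / 2 : ℝ) with hT
  have hT0 : 0 < T := by have : 0 < 1 + t := by linarith
                         positivity
  set M := max 1 (1 / c₀) with hM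
  have hM0 : 0 < M := by positivity
  have hmn : 0 ≤ min (1 / l) (1 + t) := le_min (by positivity) (by linarith)
  have hX00 := Real.sqrt_nonneg (X 0)
  calc √(X t) ≤ k * √(L t) := hsX t
    _ ≤ k * (E * (√κ₂ * √(X 0) + 2 * (k * K)) + 3 * (k * K) * T * (M * min (1 / l) (1 + t))) := by
        gcongr
        refine hdec.trans ?_
        gcongr
    _ ≤ k * ((√κ₂ + 2 * k + 3 * k * M) * (E * (√(X 0) + K)) +
          (√κ₂ + 2 * k + 3 * k * M) * (K * T * min (1 / l) (1 + t))) := by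
        have q0 := Real.sqrt_nonneg κ₂
        refine mul_le_mul_of_nonneg_left (add_le_add ?_ ?_) hk0.le
        · have q1 : √κ₂ * √(X 0) + 2 * (k * K) ≤ (√κ₂ + 2 * k + 3 * k * M) * (√(X 0) + K) := by
            have : 0 ≤ (2 * k + 3 * k * M) * √(X 0) + (√κ₂ + 3 * k * M) * K := by positivity
            linarith
          calc _ ≤ E * ((√κ₂ + 2 * k + 3 * k * M) * (√(X 0) + K)) := by gcongr
            _ = _ := by ring
        · have q1 : 0 ≤ (√κ₂ + 2 * k) * (K * T * min (1 / l) (1 + t)) := by positivity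
          linarith
    _ = _ := by ring

/-! ### The damped equation for `w` -/

/-- Decay of a frequency-localised solution `s` of the damped equation `τ s' = r - s`. -/
lemma damped_decay {τ : ℝ} (hτ : 0 < τ) {r s s' : ℝ → L2}
    (hs : ∀ t, 0 ≤ t → HasDerivWithinAt s (s' t) (Ici 0) t)
    (he : ∀ t, 0 ≤ t → ∀ᵐ ξ, s' t ξ = (1 / τ : ℝ) * (r t ξ - s t ξ))
    {m : E3 → ℝ} {l : ℝ} (hm : IsWeight m l) {t K₁ K₂ : ℝ} (ht : 0 ≤ t) (hK₁ : 0 ≤ K₁)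
    (hK₂ : 0 ≤ K₂) (h₁ : ∀ σ ∈ Ico 0 (t / 2), √(wnormSq₁ m (r σ)) ≤ K₁)
    (h₂ : ∀ σ ∈ Ico (t / 2) t, √(wnormSq₁ m (r σ)) ≤ K₂) :
    √(wnormSq₁ m (s t)) ≤ Real.exp (-(1 / τ) * t / 2) * (√(wnormSq₁ m (s 0)) + K₁) + K₂ := by
  set L : ℝ → ℝ := fun t => wnormSq₁ m (s t) with hL
  set L' : ℝ → ℝ := fun t => qform m (s' t) (s t) + qform m (s t) (s' t) with hL'
  have hLd : ∀ σ, 0 ≤ σ → HasDerivWithinAt L (L' σ) (Ici 0) σ := fun σ hσ => by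
    simp only [hL, wnormSq₁_eq]
    exact qform_hasDerivWithinAt hm.memLp_one (hs σ hσ) (hs σ hσ)
  have hdiss : ∀ σ ∈ Ico 0 t, L' σ ≤ -2 * (1 / τ) * L σ +
      2 * (1 / τ * √(wnormSq₁ m (r σ))) * √(L σ) := by
    intro σ hσ
    obtain ⟨hi, hq⟩ := qform_add_eq hm.memLp_one (s' σ) (s σ) (s σ) (s' σ)
    obtain ⟨hc, hCS⟩ := hm.integral_mul_le (f := fun ξ => ‖r σ ξ‖) (g := fun ξ => ‖s σ ξ‖)
      (fun ξ => norm_nonneg _) (fun ξ => norm_nonneg _) (Lp.memLp (r σ)).1.norm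
      (Lp.memLp (s σ)).1.norm (hm.integrable₁ (r σ)) (hm.integrable₁ (s σ))
    have h1 : L' σ ≤ ∫ ξ, (-2 * (1 / τ) * (m ξ * ‖s σ ξ‖ ^ 2) +
        2 * (1 / τ) * (m ξ * (‖r σ ξ‖ * ‖s σ ξ‖))) := by
      simp only [hL', hq]
      refine integral_mono_ae hi (((hm.integrable₁ (s σ)).const_mul _).add (hc.const_mul _)) ?_
      filter_upwards [he σ hσ.1] with ξ hξ
      rw [hξ, norm_sq_re_im]
      have h3 := re_im_le (r σ ξ) (s σ ξ)
      have h4 : 0 ≤ 2 * (1 / τ) * m ξ := mul_nonneg (by positivity) (hm.nonneg ξ)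
      have h5 := mul_le_mul_of_nonneg_left h3 h4
      simp only [Complex.mul_re, Complex.mul_im, Complex.ofReal_re, Complex.ofReal_im, zero_mul,
        sub_zero, add_zero, Complex.sub_re, Complex.sub_im]
      linarith
    rw [integral_add ((hm.integrable₁ (s σ)).const_mul _) (hc.const_mul _), integral_const_mul,
      integral_const_mul] at h1
    have h2 : 2 * (1 / τ) * ∫ ξ, m ξ * (‖r σ ξ‖ * ‖s σ ξ‖) ≤
        2 * (1 / τ) * (√(wnormSq₁ m (r σ)) * √(L σ)) := by
      gcongr
      exact hCS
    have h3 : ∫ ξ, m ξ * ‖s σ ξ‖ ^ 2 = L σ := rfl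
    rw [h3] at h1
    linarith
  have := sqrt_le_two_stage (L := L) (L' := L') (μ := 1 / τ)
    (f := fun σ => 1 / τ * √(wnormSq₁ m (r σ))) (K₁ := 1 / τ * K₁) (K₂ := 1 / τ * K₂)
    (by positivity) ht (by positivity) (by positivity)
    (fun σ hσ => ((hLd σ hσ.1).continuousWithinAt).mono Icc_subset_Ici_self)
    (fun σ hσ => (hLd σ hσ.1).mono (Ici_subset_Ici.2 hσ.1)) hdiss
    (fun σ hσ => by gcongr; exact h₁ σ hσ) (fun σ hσ => by gcongr; exact h₂ σ hσ)
  have hne : (1 / τ) ≠ 0 := by positivity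
  rwa [mul_div_cancel_left₀ _ hne, mul_div_cancel_left₀ _ hne] at this

/-- The right-hand side `r = τ w' + w` of the damped equation for `w`, on frequencies at most `R`. -/
lemma sqrt_wnormSq₁_le {γ : ℝ} (hγ : 0 < γ) {m : E3 → ℝ} {l R : ℝ} (hm : IsWeight m l)
    (hR : ∀ ξ, m ξ ≠ 0 → freq ξ ≤ R) (hR0 : 0 ≤ R) {a p d n r : L2}
    (he : ∀ᵐ ξ, r ξ = -(freq ξ ^ 2 : ℝ) * p ξ - (γ * freq ξ ^ 2 : ℝ) * d ξ + n ξ) :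
    √(wnormSq₁ m r) ≤ 2 * (1 + γ) * R * √(wnormSq m a p d) + 2 * √(wnormSq₁ m n) := by
  have hX := wnormSq_nonneg hm a p d
  have hn0 : 0 ≤ wnormSq₁ m n := integral_nonneg fun ξ => mul_nonneg (hm.nonneg ξ) (by positivity)
  have h : wnormSq₁ m r ≤ 4 * ((1 + γ) * R) ^ 2 * wnormSq m a p d + 2 * wnormSq₁ m n := by
    unfold wnormSq₁ wnormSq
    rw [← integral_const_mul, ← integral_const_mul, ← integral_add
      ((hm.integrable_quad a p d).const_mul _) ((hm.integrable₁ n).const_mul _)]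
    refine integral_mono_ae (hm.integrable₁ r) (((hm.integrable_quad a p d).const_mul _).add
      ((hm.integrable₁ n).const_mul _)) ?_
    filter_upwards [he] with ξ hξ
    rw [hξ]
    by_cases h0 : m ξ = 0
    · simp [h0]
    have hf := hR ξ h0
    have hf0 := freq_nonneg ξ
    have h1 : ‖-(freq ξ ^ 2 : ℝ) * p ξ - (γ * freq ξ ^ 2 : ℝ) * d ξ + n ξ‖ ≤
        (1 + γ) * R * (freq ξ * ‖p ξ‖ + freq ξ * ‖d ξ‖) + ‖n ξ‖ := by
      refine (norm_add_le _ _).trans (add_le_add_left ?_ _)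
      refine (norm_sub_le _ _).trans ?_
      rw [norm_mul, norm_mul, norm_neg, Complex.norm_real, Complex.norm_real,
        Real.norm_of_nonneg (by positivity), Real.norm_of_nonneg (by positivity)]
      have h2 : freq ξ ^ 2 * ‖p ξ‖ ≤ R * (freq ξ * ‖p ξ‖) := by
        rw [sq, mul_assoc]; gcongr
      have h3 : freq ξ ^ 2 * ‖d ξ‖ ≤ R * (freq ξ * ‖d ξ‖) := by
        rw [sq, mul_assoc]; gcongr
      have h4 : 0 ≤ γ * (R * (freq ξ * ‖p ξ‖)) := by positivity
      have h5 : 0 ≤ R * (freq ξ * ‖d ξ‖) := by positivity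
      have h6 := mul_le_mul_of_nonneg_left h3 hγ.le
      linarith
    have h2 : ‖-(freq ξ ^ 2 : ℝ) * p ξ - (γ * freq ξ ^ 2 : ℝ) * d ξ + n ξ‖ ^ 2 ≤
        4 * ((1 + γ) * R) ^ 2 * quad (a ξ) (p ξ) (d ξ) ξ + 2 * ‖n ξ‖ ^ 2 := by
      have h3 := pow_le_pow_left₀ (norm_nonneg _) h1 2
      refine h3.trans ?_
      have h4 : (freq ξ * ‖p ξ‖ + freq ξ * ‖d ξ‖) ^ 2 ≤ 2 * quad (a ξ) (p ξ) (d ξ) ξ := by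
        unfold quad
        nlinarith [sq_nonneg (freq ξ * ‖p ξ‖ - freq ξ * ‖d ξ‖), sq_nonneg ‖a ξ‖]
      have h5 := mul_le_mul_of_nonneg_left h4 (sq_nonneg ((1 + γ) * R))
      nlinarith [sq_nonneg ((1 + γ) * R * (freq ξ * ‖p ξ‖ + freq ξ * ‖d ξ‖) - ‖n ξ‖)]
    have := mul_le_mul_of_nonneg_left h2 (hm.nonneg ξ)
    linarith
  refine Real.sqrt_le_iff.2 ⟨by positivity, h.trans ?_⟩
  have e1 := Real.sq_sqrt hX
  have e2 := Real.sq_sqrt hn0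
  have : 0 ≤ 2 * (1 + γ) * R * √(wnormSq m a p d) * (2 * √(wnormSq₁ m n)) := by positivity
  calc _ = (2 * (1 + γ) * R * √(wnormSq m a p d)) ^ 2 + 2 * √(wnormSq₁ m n) ^ 2 := by
        have e3 : (2 * (1 + γ) * R * √(wnormSq m a p d)) ^ 2 =
          4 * ((1 + γ) * R) ^ 2 * √(wnormSq m a p d) ^ 2 := by ring
        rw [e3, e1, e2]
    _ ≤ _ := by nlinarith [sq_nonneg (√(wnormSq₁ m n))]

/-! ### Dyadic sums -/

/-- The profile of the decay of the dyadic block at frequency `h`, at time `T - 1`. The first term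
comes from the initial data, the second one from the source. -/
noncomputable def profile (h T : ℝ) : ℝ :=
  (1 + h ^ 2 * T)⁻¹ ^ 2 + T ^ (-1 / 2 : ℝ) * (1 + h ^ 2 * T)⁻¹

lemma profile_nonneg {h T : ℝ} (hT : 0 < T) : 0 ≤ profile h T := by
  unfold profile; positivity

lemma half_pow_sum_le (N : ℕ) : ∑ n ∈ Finset.range N, ((1 : ℝ) / 2) ^ (n + 1) ≤ 1 := by
  have h : ∀ N : ℕ, ∑ n ∈ Finset.range N, ((1 : ℝ) / 2) ^ (n + 1) = 1 - (1 / 2) ^ N := by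
    intro N
    induction N with
    | zero => simp
    | succ k ih => rw [Finset.sum_range_succ, ih]; ring
  rw [h]
  have : (0 : ℝ) < (1 / 2) ^ N := by positivity
  linarith

/-- The summand is comparable to `min (x, 1/x)` at `x = y 2^{-(n+1)}`, and it is the increment of
`x / (1 + x)` between `x` and `2 x`, so that the sum telescopes. -/
lemma sum_bump_le {y : ℝ} (hy : 0 < y) (N : ℕ) :
    ∑ n ∈ Finset.range N, (y * (1 / 2) ^ (n + 1)) /
      ((1 + 2 * (y * (1 / 2) ^ (n + 1))) * (1 + y * (1 / 2) ^ (n + 1))) ≤ 1 := by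
  have e : ∀ n : ℕ, (y * (1 / 2) ^ (n + 1)) /
      ((1 + 2 * (y * (1 / 2) ^ (n + 1))) * (1 + y * (1 / 2) ^ (n + 1))) =
      y * (1 / 2) ^ n / (1 + y * (1 / 2) ^ n) -
        y * (1 / 2) ^ (n + 1) / (1 + y * (1 / 2) ^ (n + 1)) := by
    intro n
    have h0 : (0 : ℝ) < y * (1 / 2) ^ (n + 1) := by positivity
    have h1 : y * (1 / 2) ^ n = 2 * (y * (1 / 2) ^ (n + 1)) := by rw [pow_succ]; ring
    rw [h1]
    generalize y * (1 / 2) ^ (n + 1) = x at *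
    field_simp
    ring
  simp only [e]
  rw [Finset.sum_range_sub' (fun n : ℕ => y * (1 / 2) ^ n / (1 + y * (1 / 2) ^ n))]
  have h1 : 0 ≤ y * (1 / 2) ^ N / (1 + y * (1 / 2) ^ N) := by positivity
  have h2 : y * (1 / 2) ^ 0 / (1 + y * (1 / 2) ^ 0) ≤ 1 := by
    rw [div_le_one (by positivity)]; linarith
  linarith

lemma bump_ge {x b : ℝ} (hx : 0 < x) (hb1 : b ≤ x) (hb2 : b ≤ 1 / x) :
    b ≤ 6 * (x / ((1 + 2 * x) * (1 + x))) := by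
  rcases le_total x 1 with h | h
  · refine hb1.trans ?_
    rw [← mul_div_assoc, le_div_iff₀ (by positivity)]
    have h2 : (1 + 2 * x) * (1 + x) ≤ 6 := by nlinarith
    nlinarith [mul_le_mul_of_nonneg_left h2 hx.le]
  · refine hb2.trans ?_
    rw [← mul_div_assoc, div_le_div_iff₀ hx (by positivity)]
    nlinarith

/-- In the variable `x = h T^{1/2}`, the contribution of the first term of the profile is `T^{-σ/2}` times
a function of `x` of size at most `min (x, 1/x)`, and that of the second term is at most
`T^{-σ/2} T^{-1/2} x = T^{-σ/2} h`. Both are summable over dyadic `h ≤ 1/2`, uniformly in `T`; the endpoint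
`σ = 3` is the critical one for the second term. -/
lemma sum_profile_le {σ : ℝ} (h1σ : 1 ≤ σ) (h3σ : σ ≤ 3) {T : ℝ} (hT : 1 ≤ T) (N : ℕ) :
    ∑ n ∈ Finset.range N, (((1 : ℝ) / 2) ^ (n + 1)) ^ σ * profile ((1 / 2) ^ (n + 1)) T ≤
      7 * T ^ (-σ / 2) := by
  have hT0 : 0 < T := by linarith
  set y := T ^ (1 / 2 : ℝ) with hy
  have hy0 : 0 < y := by positivity
  have hy2 : y ^ 2 = T := by rw [hy, ← Real.rpow_natCast, ← Real.rpow_mul hT0.le]; norm_num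
  have key : ∀ n : ℕ, (((1 : ℝ) / 2) ^ (n + 1)) ^ σ * profile ((1 / 2) ^ (n + 1)) T ≤
      T ^ (-σ / 2) * (6 * ((y * (1 / 2) ^ (n + 1)) /
      ((1 + 2 * (y * (1 / 2) ^ (n + 1))) * (1 + y * (1 / 2) ^ (n + 1)))) + (1 / 2) ^ (n + 1)) := by
    intro n
    set h : ℝ := (1 / 2) ^ (n + 1) with hh
    have h0 : 0 < h := by positivity
    set x := y * h with hx
    have hx0 : 0 < x := by positivity
    have e1 : h ^ σ = T ^ (-σ / 2) * x ^ σ := by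
      rw [hx, Real.mul_rpow hy0.le h0.le, hy, ← Real.rpow_mul hT0.le, ← mul_assoc,
        ← Real.rpow_add hT0]
      ring_nf; simp
    have e2 : h ^ 2 * T = x ^ 2 := by rw [hx, ← hy2]; ring
    have e3 : T ^ (-1 / 2 : ℝ) * x = h := by
      rw [hx, hy, ← mul_assoc, ← Real.rpow_add hT0]; norm_num
    have hxs : x ^ σ * (1 + x ^ 2)⁻¹ ^ 2 ≤ min x (1 / x) ∧ x ^ σ * (1 + x ^ 2)⁻¹ ≤ x := by
      have b1 : x ≤ 1 → x ^ σ ≤ x := fun hle => by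
        calc x ^ σ ≤ x ^ (1 : ℝ) := Real.rpow_le_rpow_of_exponent_ge hx0 hle h1σ
          _ = x := Real.rpow_one x
      have b2 : 1 ≤ x → x ^ σ ≤ x ^ 3 := fun hle => by
        calc x ^ σ ≤ x ^ (3 : ℝ) := Real.rpow_le_rpow_of_exponent_le hle h3σ
          _ = x ^ 3 := by norm_cast
      have p0 : 0 ≤ x ^ σ := by positivity
      have q1 : (1 + x ^ 2)⁻¹ ≤ 1 := inv_le_one_of_one_le₀ (by nlinarith)
      have q0 : 0 ≤ (1 + x ^ 2)⁻¹ := by positivity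
      rw [le_min_iff, inv_pow, ← div_eq_mul_inv, ← div_eq_mul_inv]
      rcases le_total x 1 with hle | hle
      · have := b1 hle
        refine ⟨⟨?_, ?_⟩, ?_⟩
        · rw [div_le_iff₀ (by positivity)]; nlinarith [sq_nonneg x, sq_nonneg (x ^ 2)]
        · rw [div_le_div_iff₀ (by positivity) hx0]; nlinarith [sq_nonneg x, sq_nonneg (x ^ 2)]
        · rw [div_le_iff₀ (by positivity)]; nlinarith [sq_nonneg x]
      · have := b2 hle
        refine ⟨⟨?_, ?_⟩, ?_⟩
        · rw [div_le_iff₀ (by positivity)]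
          have : 0 < x ^ 5 := by positivity
          nlinarith [sq_nonneg x]
        · rw [div_le_div_iff₀ (by positivity) hx0]
          have : x ^ σ * x ≤ x ^ 3 * x := by gcongr
          nlinarith [sq_nonneg x]
        · rw [div_le_iff₀ (by positivity)]; nlinarith
    have e4 : h ^ σ * profile h T = T ^ (-σ / 2) * (x ^ σ * (1 + x ^ 2)⁻¹ ^ 2 +
        T ^ (-1 / 2 : ℝ) * (x ^ σ * (1 + x ^ 2)⁻¹)) := by
      unfold profile; rw [e1, e2]; ring
    rw [e4]
    refine mul_le_mul_of_nonneg_left (add_le_add ?_ ?_) (by positivity)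
    · exact bump_ge hx0 (hxs.1.trans (min_le_left _ _)) (hxs.1.trans (min_le_right _ _))
    · calc T ^ (-1 / 2 : ℝ) * (x ^ σ * (1 + x ^ 2)⁻¹) ≤ T ^ (-1 / 2 : ℝ) * x := by
            gcongr; exact hxs.2
        _ = h := e3
  refine (Finset.sum_le_sum fun n _ => key n).trans ?_
  rw [← Finset.mul_sum, Finset.sum_add_distrib, ← Finset.mul_sum, mul_comm (7 : ℝ)]
  have := sum_bump_le hy0 N
  have := half_pow_sum_le N
  gcongr
  linarith

/-! ### Littlewood-Paley symbols and frequency weights -/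

lemma norm_two_pi_smul (ξ : E3) : ‖(2 * Real.pi) • ξ‖ = freq ξ := by
  rw [norm_smul, Real.norm_of_nonneg (by positivity), freq]

lemma blockSym_supp (P : LittlewoodPaley) {q : ℤ} {ξ : E3} (h : blockSym P q ξ ≠ 0) :
    3 / 4 * (2 : ℝ) ^ q ≤ freq ξ ∧ freq ξ ≤ 8 / 3 * (2 : ℝ) ^ q := by
  have h1 := P.φ_supp _ h
  rw [norm_smul, norm_two_pi_smul, Real.norm_of_nonneg (by positivity), zpow_neg] at h1
  have h2 : (0 : ℝ) < 2 ^ q := by positivity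
  have e : ((2 : ℝ) ^ q)⁻¹ * freq ξ = freq ξ / 2 ^ q := by rw [div_eq_inv_mul]
  rw [e, le_div_iff₀ h2, div_le_iff₀ h2] at h1
  exact h1

lemma blockSym_nonneg (P : LittlewoodPaley) (q : ℤ) (ξ : E3) : 0 ≤ blockSym P q ξ :=
  (P.φ_mem _).1

lemma blockSym_le_one (P : LittlewoodPaley) (q : ℤ) (ξ : E3) : blockSym P q ξ ≤ 1 :=
  (P.φ_mem _).2

lemma lowSym_nonneg (P : LittlewoodPaley) (ξ : E3) : 0 ≤ lowSym P ξ := (P.χ_mem _).1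

lemma lowSym_le_one (P : LittlewoodPaley) (ξ : E3) : lowSym P ξ ≤ 1 := (P.χ_mem _).2

lemma lowSym_supp (P : LittlewoodPaley) {ξ : E3} (h : lowSym P ξ ≠ 0) : freq ξ ≤ 4 / 3 := by
  have h1 := P.χ_supp _ h
  rwa [norm_two_pi_smul] at h1

lemma continuous_blockSym (P : LittlewoodPaley) (q : ℤ) : Continuous (blockSym P q) := by
  unfold blockSym
  exact P.φ_smooth.continuous.comp (by fun_prop)

lemma tsum_blockSym (P : LittlewoodPaley) {ξ : E3} (hξ : ξ ≠ 0) :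
    ∑' q : ℤ, ‖blockSym P q ξ‖ₑ = 1 := by
  have h := P.sum_hom ((2 * Real.pi) • ξ) (smul_ne_zero (by positivity) hξ)
  have h2 := ENNReal.ofReal_tsum_of_nonneg (fun q => blockSym_nonneg P q ξ) h.summable
  have e : ∑' q : ℤ, blockSym P q ξ = 1 := h.tsum_eq
  rw [e, ENNReal.ofReal_one] at h2
  rw [h2]
  exact tsum_congr fun q => Real.enorm_of_nonneg (blockSym_nonneg P q ξ)

lemma tsum_int_eq (f : ℤ → ℝ≥0∞) :
    ∑' q : ℤ, f q = ∑' n : ℕ, f n + ∑' n : ℕ, f (-((n : ℤ) + 1)) :=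
  tsum_of_nat_of_neg_add_one ENNReal.summable ENNReal.summable

lemma zpow_neg_succ (n : ℕ) : (2 : ℝ) ^ (-((n : ℤ) + 1)) = (1 / 2) ^ (n + 1) := by
  rw [zpow_neg, one_div, inv_pow]; norm_cast

/-- The blocks of negative index form a partition of unity at low frequencies. -/
lemma one_le_tsum_blockSym (P : LittlewoodPaley) {ξ : E3} (hξ : ξ ≠ 0) (h : freq ξ < 1 / 2) :
    1 ≤ ∑' n : ℕ, ‖blockSym P (-((n : ℤ) + 1)) ξ‖ₑ := by
  have h1 := tsum_blockSym P hξ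
  rw [tsum_int_eq] at h1
  have h2 : ∑' n : ℕ, ‖blockSym P (n : ℤ) ξ‖ₑ = 0 := by
    refine ENNReal.tsum_eq_zero.2 fun n => ?_
    rw [enorm_eq_zero]
    by_contra hne
    have h3 := (blockSym_supp P hne).1
    have h4 : (1 : ℝ) ≤ 2 ^ (n : ℤ) := by rw [zpow_natCast]; exact one_le_pow₀ (by norm_num)
    linarith
  rw [h2, zero_add] at h1
  rw [h1]

/-- The damping rate is at least `b² / 2` on frequencies at least `b ≤ 1`. -/
lemma rate_ge_of_freq_ge {ξ : E3} {b : ℝ} (hb : 0 ≤ b) (hb1 : b ≤ 1) (h : b ≤ freq ξ) :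
    b ^ 2 / 2 ≤ rate ξ := by
  unfold rate
  rw [div_le_div_iff₀ (by norm_num) (by positivity)]
  have h1 : b ^ 2 ≤ freq ξ ^ 2 := by gcongr
  have h2 : b ^ 2 ≤ 1 := pow_le_one₀ hb hb1
  nlinarith [mul_le_mul_of_nonneg_right h2 (sq_nonneg (freq ξ))]

/-- The weight of a dyadic block. -/
noncomputable def blockWeight (P : LittlewoodPaley) (q : ℤ) (ξ : E3) : ℝ := blockSym P q ξ ^ 2

lemma blockWeight_supp (P : LittlewoodPaley) {q : ℤ} {ξ : E3} (h : blockWeight P q ξ ≠ 0) :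
    3 / 4 * (2 : ℝ) ^ q ≤ freq ξ ∧ freq ξ ≤ 8 / 3 * (2 : ℝ) ^ q :=
  blockSym_supp P fun h0 => h (by simp [blockWeight, h0])

lemma isWeight_block (P : LittlewoodPaley) {q : ℤ} (hq : (2 : ℝ) ^ q ≤ 1) :
    IsWeight (blockWeight P q) (((2 : ℝ) ^ q) ^ 2 / 4) where
  meas := ((continuous_blockSym P q).pow 2).aestronglyMeasurable
  nonneg ξ := sq_nonneg _
  bdd := ⟨1, 8 / 3 * 2 ^ q, fun ξ => ⟨pow_le_one₀ (blockSym_nonneg P q ξ) (blockSym_le_one P q ξ),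
    fun h => (blockWeight_supp P h).2⟩⟩
  rate_ge ξ h := by
    have h1 := (blockWeight_supp P h).1
    have h0 : (0 : ℝ) < 2 ^ q := by positivity
    have := rate_ge_of_freq_ge (b := 3 / 4 * 2 ^ q) (by positivity) (by linarith) h1
    nlinarith [sq_nonneg ((2 : ℝ) ^ q)]

/-- The weight of `H²` on bounded regions away from the low frequencies. -/
noncomputable def highWeight (R : ℝ) : E3 → ℝ :=
  {ξ | 1 / 2 ≤ freq ξ ∧ freq ξ ≤ R}.indicator fun ξ => freq ξ ^ 4

lemma measurableSet_highRegion (R : ℝ) : MeasurableSet {ξ : E3 | 1 / 2 ≤ freq ξ ∧ freq ξ ≤ R} :=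
  (measurableSet_le measurable_const continuous_freq.measurable).inter
    (measurableSet_le continuous_freq.measurable measurable_const)

lemma isWeight_high (R : ℝ) : IsWeight (highWeight R) (1 / 8) where
  meas := ((continuous_freq.pow 4).aestronglyMeasurable).indicator (measurableSet_highRegion R)
  nonneg ξ := indicator_nonneg (fun ξ _ => by have := freq_nonneg ξ; positivity) ξ
  bdd := by
    refine ⟨R ^ 4, R, fun ξ => ⟨?_, fun h => (mem_of_indicator_ne_zero h).2⟩⟩
    unfold highWeight
    by_cases h : ξ ∈ {ξ : E3 | 1 / 2 ≤ freq ξ ∧ freq ξ ≤ R}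
    · rw [indicator_of_mem h]
      exact pow_le_pow_left₀ (freq_nonneg ξ) h.2 4
    · rw [indicator_of_notMem h]
      positivity
  rate_ge ξ h := by
    have := rate_ge_of_freq_ge (b := 1 / 2) (by norm_num) (by norm_num)
      (mem_of_indicator_ne_zero h).1
    norm_num at this ⊢
    linarith

/-! ### Extended `L²` norms -/

lemma eLpNorm_eq_sqrt {g : E3 → ℝ} (hg : Integrable (fun ξ => g ξ ^ 2) volume) :
    eLpNorm g 2 volume = ENNReal.ofReal √(∫ ξ, g ξ ^ 2) := by
  have h : eLpNorm g 2 volume ^ 2 = ENNReal.ofReal √(∫ ξ, g ξ ^ 2) ^ 2 := by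
    rw [eLpNorm_two_sq, ← ENNReal.ofReal_pow (Real.sqrt_nonneg _),
      Real.sq_sqrt (integral_nonneg fun ξ => sq_nonneg _),
      ofReal_integral_eq_lintegral_ofReal hg (.of_forall fun ξ => sq_nonneg _)]
    refine lintegral_congr fun ξ => ?_
    rw [← ofReal_norm, ← ENNReal.ofReal_pow (norm_nonneg _), Real.norm_eq_abs, sq_abs]
  exact (ENNReal.pow_right_strictMono two_ne_zero).injective h

/-- Minkowski's inequality for a series. -/
lemma eLpNorm_le_tsum {ι : Type} [Countable ι] {G : E3 → ℝ} {g : ι → E3 → ℝ}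
    (hg : ∀ i, AEStronglyMeasurable (g i) volume)
    (h : ∀ᵐ ξ, ‖G ξ‖ₑ ≤ ∑' i, ‖g i ξ‖ₑ) :
    eLpNorm G 2 volume ≤ ∑' i, eLpNorm (g i) 2 volume := by
  classical
  have h1 : eLpNorm G 2 volume ^ 2 ≤ (∑' i, eLpNorm (g i) 2 volume) ^ 2 := by
    rw [eLpNorm_two_sq]
    have hmono : Monotone fun (s : Finset ι) (ξ : E3) => (∑ i ∈ s, ‖g i ξ‖ₑ) ^ 2 := fun s t hst ξ =>
      pow_le_pow_left' (Finset.sum_le_sum_of_subset hst) 2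
    calc ∫⁻ ξ, ‖G ξ‖ₑ ^ 2 ≤ ∫⁻ ξ, (∑' i, ‖g i ξ‖ₑ) ^ 2 := by
          refine lintegral_mono_ae ?_
          filter_upwards [h] with ξ hξ
          gcongr
      _ = ∫⁻ ξ, ⨆ s : Finset ι, (∑ i ∈ s, ‖g i ξ‖ₑ) ^ 2 := by
          refine lintegral_congr fun ξ => ?_
          rw [ENNReal.tsum_eq_iSup_sum]
          refine (Monotone.map_iSup_of_continuousAt (f := fun x : ℝ≥0∞ => x ^ 2)
            (by fun_prop) (fun a b hab => pow_le_pow_left' hab 2) (by simp))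
      _ = ⨆ s : Finset ι, ∫⁻ ξ, (∑ i ∈ s, ‖g i ξ‖ₑ) ^ 2 :=
          lintegral_iSup_directed (fun s => (Finset.aemeasurable_fun_sum s fun i _ =>
            (hg i).enorm).pow_const 2) hmono.directed_le
      _ ≤ (∑' i, eLpNorm (g i) 2 volume) ^ 2 := by
          refine iSup_le fun s => ?_
          have h2 : ∫⁻ ξ, (∑ i ∈ s, ‖g i ξ‖ₑ) ^ 2 =
              eLpNorm (∑ i ∈ s, fun ξ => ‖g i ξ‖) 2 volume ^ 2 := by
            rw [eLpNorm_two_sq]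
            refine lintegral_congr fun ξ => ?_
            rw [Finset.sum_apply, Real.enorm_of_nonneg (Finset.sum_nonneg fun i _ => norm_nonneg _),
              ENNReal.ofReal_sum_of_nonneg fun i _ => norm_nonneg _]
            simp only [ofReal_norm]
          rw [h2]
          refine pow_le_pow_left' ?_ 2
          refine (eLpNorm_sum_le (fun i _ => (hg i).norm) (by norm_num)).trans ?_
          simp only [eLpNorm_norm]
          exact ENNReal.sum_le_tsum s
  exact (ENNReal.pow_le_pow_left_iff two_ne_zero).1 h1

lemma eLpNorm_const_mul_real {c : ℝ} (hc : 0 ≤ c) (g : E3 → ℝ) :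
    eLpNorm (fun ξ => c * g ξ) 2 volume = ENNReal.ofReal c * eLpNorm g 2 volume := by
  have := eLpNorm_const_smul c g 2 (volume : Measure E3)
  rw [Real.enorm_of_nonneg hc] at this
  exact this

lemma ae_ne_zero : ∀ᵐ ξ : E3, ξ ≠ 0 := by
  simp [ae_iff]

/-- The derivative is controlled at high frequencies by the homogeneous norm of index `3/2`. -/
lemma eLpNorm_high_le (P : LittlewoodPaley) {G : E3 → ℝ} (hG : AEStronglyMeasurable G volume) :
    eLpNorm ({ξ | 1 ≤ freq ξ}.indicator fun ξ => freq ξ * G ξ) 2 volume ≤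
      5 * ∑' q : ℤ, weight q (3 / 2) * eLpNorm (fun ξ => blockSym P q ξ * G ξ) 2 volume := by
  have h := eLpNorm_le_tsum (G := {ξ | 1 ≤ freq ξ}.indicator fun ξ => freq ξ * G ξ)
    (g := fun (q : ℤ) ξ => 5 * (2 : ℝ) ^ ((q : ℝ) * (3 / 2)) * (blockSym P q ξ * G ξ))
    (fun q => ((continuous_blockSym P q).aestronglyMeasurable.mul hG).const_mul _) ?_
  · refine h.trans ?_
    rw [← ENNReal.tsum_mul_left]
    refine ENNReal.tsum_le_tsum fun q => ?_
    rw [eLpNorm_const_mul_real (by positivity), ENNReal.ofReal_mul (by norm_num), weight, mul_assoc]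
    simp
  · filter_upwards [ae_ne_zero] with ξ hξ
    by_cases hk : 1 ≤ freq ξ
    · rw [indicator_of_mem (by exact hk), enorm_mul]
      have h1 := tsum_blockSym P hξ
      calc ‖freq ξ‖ₑ * ‖G ξ‖ₑ = (∑' q : ℤ, ‖blockSym P q ξ‖ₑ) * (‖freq ξ‖ₑ * ‖G ξ‖ₑ) := by
            rw [h1, one_mul]
        _ = ∑' q : ℤ, ‖blockSym P q ξ‖ₑ * (‖freq ξ‖ₑ * ‖G ξ‖ₑ) := ENNReal.tsum_mul_right.symm
        _ ≤ _ := by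
            refine ENNReal.tsum_le_tsum fun q => ?_
            rw [enorm_mul (5 * (2 : ℝ) ^ ((q : ℝ) * (3 / 2))), enorm_mul (blockSym P q ξ),
              mul_left_comm]
            by_cases h0 : blockSym P q ξ = 0
            · simp [h0]
            refine mul_le_mul_left (enorm_mono_real (freq_nonneg ξ) ?_) _
            have h2 := (blockSym_supp P h0).2
            have hh : (0 : ℝ) < 2 ^ q := by positivity
            have e : (2 : ℝ) ^ ((q : ℝ) * (3 / 2)) = 2 ^ q * √(2 ^ q) := by
              rw [Real.sqrt_eq_rpow, ← Real.rpow_intCast, ← Real.rpow_mul (by norm_num),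
                ← Real.rpow_add (by norm_num)]
              ring_nf
            have h3 : 3 / 5 ≤ √((2 : ℝ) ^ q) := Real.le_sqrt_of_sq_le (by linarith)
            rw [e]
            nlinarith
    · rw [indicator_of_notMem (by exact hk)]
      simp

/-! ### The norms on the Fourier side -/

lemma sum_norm_grad_sq (ξ : E3) (z : ℂ) :
    ∑ i : Fin 3, ‖2 * Real.pi * Complex.I * (ξ i : ℝ) * z‖ ^ 2 = freq ξ ^ 2 * ‖z‖ ^ 2 := by
  have h : ‖ξ‖ ^ 2 = ∑ i : Fin 3, (ξ i) ^ 2 := by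
    rw [EuclideanSpace.norm_sq_eq]; simp
  simp only [norm_mul, Complex.norm_I, Complex.norm_real, Complex.norm_ofNat, mul_one, freq,
    mul_pow, Real.norm_eq_abs, sq_abs]
  rw [← Finset.sum_mul, ← Finset.mul_sum, h]

lemma blockNorm_sc {T : TD} {F : E3 → ℂ} (hT : HasFourier T F) (P : LittlewoodPaley) (q : ℤ) :
    blockNorm P q (sc T) = eLpNorm (fun ξ => blockSym P q ξ * ‖F ξ‖) 2 volume :=
  l2NormV_eq (fun _ => hT.block P q) (.of_forall fun ξ => by simp [mul_pow])

lemma blockNorm_grad {T : TD} {F : E3 → ℂ} (hT : HasFourier T F) (P : LittlewoodPaley) (q : ℤ) :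
    blockNorm P q (grad T) =
      eLpNorm (fun ξ => blockSym P q ξ * (freq ξ * ‖F ξ‖)) 2 volume :=
  l2NormV_eq (fun i => (hT.grad i).block P q) (.of_forall fun ξ => by
    simp only [norm_mul (blockSym P q ξ : ℂ), mul_pow _ _ 2]
    rw [← Finset.mul_sum]
    simp only [← mul_pow _ _ 2]
    rw [sum_norm_grad_sq]
    simp [mul_pow])

lemma l2NormV_grad {T : TD} {F : E3 → ℂ} (hT : HasFourier T F) :
    l2NormV (grad T) = eLpNorm (fun ξ => freq ξ * ‖F ξ‖) 2 volume :=
  l2NormV_eq (fun i => hT.grad i) (.of_forall fun ξ => by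
    simp only; rw [sum_norm_grad_sq, mul_pow])

lemma norm_laplacian_symbol (ξ : E3) (z : ℂ) :
    ‖-((freq ξ ^ 2 : ℝ) : ℂ) * z‖ = freq ξ ^ 2 * ‖z‖ := by
  rw [norm_mul, norm_neg, Complex.norm_real, Real.norm_of_nonneg (by positivity)]

lemma l2Norm_eq_norm {T : TD} {F : E3 → ℂ} (hT : HasFourier T F) :
    l2Norm T = eLpNorm (fun ξ => ‖F ξ‖) 2 volume := by
  rw [hT.l2Norm_eq, eLpNorm_norm]

lemma blockNorm_laplacian {T : TD} {F : E3 → ℂ} (hT : HasFourier T F) (P : LittlewoodPaley)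
    (q : ℤ) : blockNorm P q (sc (Δ T)) =
      eLpNorm (fun ξ => blockSym P q ξ * (freq ξ ^ 2 * ‖F ξ‖)) 2 volume := by
  rw [blockNorm_sc hT.laplacian]
  simp only [norm_laplacian_symbol]

lemma le_rpow_half {x y : ℝ≥0∞} (h : x ^ 2 ≤ y) : x ≤ y ^ (1 / 2 : ℝ) := by
  have := ENNReal.rpow_le_rpow (z := 1 / 2) h (by norm_num)
  rwa [← ENNReal.rpow_natCast, ← ENNReal.rpow_mul, Nat.cast_ofNat, mul_one_div_cancel two_ne_zero,
    ENNReal.rpow_one] at this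

section

variable (P : LittlewoodPaley) (τ s : ℝ) (u v w : L2)

lemma le_energyL2 :
    eLpNorm (fun ξ => ‖(𝓕 (v + (τ : ℂ) • w) : L2) ξ‖) 2 volume ≤ energyL2 τ u v w ∧
    eLpNorm (fun ξ => freq ξ * ‖(𝓕 v : L2) ξ‖) 2 volume ≤ energyL2 τ u v w ∧
    eLpNorm (fun ξ => freq ξ * ‖(𝓕 (u + (τ : ℂ) • v) : L2) ξ‖) 2 volume ≤ energyL2 τ u v w ∧
    eLpNorm (fun ξ => ‖(𝓕 w : L2) ξ‖) 2 volume ≤ energyL2 τ u v w := by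
  rw [← l2Norm_eq_norm (hasFourier_td _), ← l2NormV_grad (hasFourier_td _),
    ← l2NormV_grad (hasFourier_td _), ← l2Norm_eq_norm (hasFourier_td _)]
  unfold energyL2
  refine ⟨le_rpow_half ?_, le_rpow_half ?_, le_rpow_half ?_, le_rpow_half ?_⟩
  · simp only [add_assoc]; exact le_self_add
  · exact le_add_right (le_add_right (le_add_right le_add_self))
  · exact le_add_right le_add_self
  · exact le_add_self

lemma le_energyHom :
    ∑' q : ℤ, weight q s * eLpNorm (fun ξ => blockSym P q ξ *
      (freq ξ * ‖(𝓕 (v + (τ : ℂ) • w) : L2) ξ‖)) 2 volume ≤ energyHom P τ s u v w ∧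
    ∑' q : ℤ, weight q s * eLpNorm (fun ξ => blockSym P q ξ *
      (freq ξ ^ 2 * ‖(𝓕 v : L2) ξ‖)) 2 volume ≤ energyHom P τ s u v w ∧
    ∑' q : ℤ, weight q s * eLpNorm (fun ξ => blockSym P q ξ *
      (freq ξ ^ 2 * ‖(𝓕 (u + (τ : ℂ) • v) : L2) ξ‖)) 2 volume ≤ energyHom P τ s u v w := by
  simp only [← blockNorm_grad (hasFourier_td _), ← blockNorm_laplacian (hasFourier_td _)]
  unfold energyHom
  refine ⟨le_rpow_half ?_, le_rpow_half ?_, le_rpow_half ?_⟩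
  · exact le_add_right (le_add_right (le_add_right (le_add_right (le_add_right le_add_self))))
  · exact le_add_right (le_add_right (le_add_right (le_add_right le_add_self)))
  · exact le_add_right (le_add_right le_add_self)

lemma ampl_ae_eq : ∀ᵐ ξ, ampl τ u v w ξ = ‖(𝓕 (v + (τ : ℂ) • w) : L2) ξ‖ +
    freq ξ * ‖(𝓕 (u + (τ : ℂ) • v) : L2) ξ‖ + freq ξ * ‖(𝓕 v : L2) ξ‖ + ‖(𝓕 w : L2) ξ‖ := by
  filter_upwards [fourier_add_ae v ((τ : ℂ) • w), fourier_smul_ae τ w,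
    fourier_add_ae u ((τ : ℂ) • v), fourier_smul_ae τ v] with ξ h1 h2 h3 h4
  rw [ampl, h1, h2, h3, h4]

lemma fourier_w_ae (hτ : τ ≠ 0) : ∀ᵐ ξ, (𝓕 w : L2) ξ =
    (1 / τ : ℝ) * ((𝓕 (v + (τ : ℂ) • w) : L2) ξ - (𝓕 v : L2) ξ) := by
  filter_upwards [fourier_add_ae v ((τ : ℂ) • w), fourier_smul_ae τ w] with ξ h1 h2
  have : (τ : ℂ) ≠ 0 := by exact_mod_cast hτ
  rw [h1, h2]
  push_cast
  field_simp
  ring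

/-- The constant of the embedding of the energy space of index `3/2` into the Sobolev space. -/
noncomputable def energyConst (τ : ℝ) : ℝ := 38 + 20 / τ

lemma aesm_norm_fourier (f : L2) : AEStronglyMeasurable (fun ξ => ‖(𝓕 f : L2) ξ‖) volume :=
  (aesm_fourier f).norm

lemma measurableSet_freq_ge (b : ℝ) : MeasurableSet {ξ : E3 | b ≤ freq ξ} :=
  measurableSet_le measurable_const continuous_freq.measurable

/-- The energy norm of index `3/2` is stronger than the Sobolev size. For `v + τ w`, `∇(u + τ v)` and
`∇v` the Sobolev size has one derivative more than the `L²` part of the energy norm; at high frequencies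
it is controlled by the homogeneous part, as `1 ≤ 3/2`. Two derivatives of `w` are recovered from
`τ w = (v + τ w) - v`. -/
lemma sobSize_le_energyNorm (hτ : 0 < τ) :
    sobSize τ u v w ≤ ENNReal.ofReal (energyConst τ) * energyNorm P τ (3 / 2) u v w := by
  set a : L2 := 𝓕 (v + (τ : ℂ) • w)
  set p : L2 := 𝓕 (u + (τ : ℂ) • v)
  set d : L2 := 𝓕 v
  set e : L2 := 𝓕 w
  obtain ⟨l1, l2, l3, l4⟩ := le_energyL2 τ u v w
  obtain ⟨h1, h2, h3⟩ := le_energyHom P τ (3 / 2) u v w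
  have hk := continuous_freq.aestronglyMeasurable (μ := (volume : Measure E3))
  have ha : AEStronglyMeasurable (fun ξ => ‖a ξ‖) volume := aesm_norm_fourier _
  have hp : AEStronglyMeasurable (fun ξ => ‖p ξ‖) volume := aesm_norm_fourier _
  have hd : AEStronglyMeasurable (fun ξ => ‖d ξ‖) volume := aesm_norm_fourier _
  have he : AEStronglyMeasurable (fun ξ => ‖e ξ‖) volume := aesm_norm_fourier _
  have b1 := (eLpNorm_high_le P (hk.mul ha)).trans (mul_le_mul_right h1 5)
  have b2 := (eLpNorm_high_le P ((hk.pow 2).mul hd)).trans (mul_le_mul_right h2 5)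
  have b3 := (eLpNorm_high_le P ((hk.pow 2).mul hp)).trans (mul_le_mul_right h3 5)
  set S := {ξ : E3 | 1 ≤ freq ξ} with hS
  have hSm : MeasurableSet S := measurableSet_freq_ge 1
  have m1 := (hk.mul (hk.mul ha)).indicator hSm
  have m2 := (hk.mul ((hk.pow 2).mul hd)).indicator hSm
  have m3 := (hk.mul ((hk.pow 2).mul hp)).indicator hSm
  set g : Fin 7 → E3 → ℝ := ![fun ξ => 2 * ‖a ξ‖, fun ξ => 2 * (freq ξ * ‖p ξ‖),
    fun ξ => 2 * (freq ξ * ‖d ξ‖), fun ξ => 2 * ‖e ξ‖,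
    fun ξ => (2 + 2 / τ) * S.indicator (fun ξ => freq ξ * (freq ξ * ‖a ξ‖)) ξ,
    fun ξ => (2 + 2 / τ) * S.indicator (fun ξ => freq ξ * (freq ξ ^ 2 * ‖d ξ‖)) ξ,
    fun ξ => 2 * S.indicator (fun ξ => freq ξ * (freq ξ ^ 2 * ‖p ξ‖)) ξ] with hg
  have hgm : ∀ i, AEStronglyMeasurable (g i) volume := by
    intro i
    fin_cases i
    · exact ha.const_mul _
    · exact (hk.mul hp).const_mul _
    · exact (hk.mul hd).const_mul _
    · exact he.const_mul _
    · exact m1.const_mul _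
    · exact m2.const_mul _
    · exact m3.const_mul _
  have hτ' : 0 < 1 / τ := by positivity
  have key : sobSize τ u v w ≤ ∑' i, eLpNorm (g i) 2 volume := by
    refine eLpNorm_le_tsum hgm ?_
    filter_upwards [ampl_ae_eq τ u v w, fourier_w_ae τ v w hτ.ne'] with ξ e1 e2
    have hk0 := freq_nonneg ξ
    have hg0 : ∀ i, 0 ≤ g i ξ := by
      intro i
      have i1 : ∀ f : E3 → ℝ, (∀ ξ, 0 ≤ f ξ) → 0 ≤ S.indicator f ξ := fun f hf =>
        indicator_nonneg (fun ξ _ => hf ξ) ξ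
      fin_cases i
      · change 0 ≤ 2 * ‖a ξ‖; positivity
      · change 0 ≤ 2 * (freq ξ * ‖p ξ‖); positivity
      · change 0 ≤ 2 * (freq ξ * ‖d ξ‖); positivity
      · change 0 ≤ 2 * ‖e ξ‖; positivity
      · exact mul_nonneg (by positivity) (i1 _ fun ξ => by have := freq_nonneg ξ; positivity)
      · exact mul_nonneg (by positivity) (i1 _ fun ξ => by have := freq_nonneg ξ; positivity)
      · exact mul_nonneg (by positivity) (i1 _ fun ξ => by have := freq_nonneg ξ; positivity)
    rw [tsum_fintype]
    have e3 : ∑ i, ‖g i ξ‖ₑ = ENNReal.ofReal (∑ i, g i ξ) := by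
      rw [ENNReal.ofReal_sum_of_nonneg fun i _ => hg0 i]
      exact Finset.sum_congr rfl fun i _ => Real.enorm_of_nonneg (hg0 i)
    have hA := ampl_nonneg τ u v w ξ
    rw [e3, Real.enorm_of_nonneg (by positivity)]
    refine ENNReal.ofReal_le_ofReal ?_
    have e4 : ∑ i, g i ξ = 2 * ‖a ξ‖ + 2 * (freq ξ * ‖p ξ‖) + 2 * (freq ξ * ‖d ξ‖) + 2 * ‖e ξ‖ +
      (2 + 2 / τ) * S.indicator (fun ξ => freq ξ * (freq ξ * ‖a ξ‖)) ξ +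
      (2 + 2 / τ) * S.indicator (fun ξ => freq ξ * (freq ξ ^ 2 * ‖d ξ‖)) ξ +
      2 * S.indicator (fun ξ => freq ξ * (freq ξ ^ 2 * ‖p ξ‖)) ξ := by
      rw [Fin.sum_univ_seven]; rfl
    rw [e4, e1]
    have na := norm_nonneg (a ξ)
    have np := norm_nonneg (p ξ)
    have nd := norm_nonneg (d ξ)
    have ne := norm_nonneg (e ξ)
    by_cases hξ : ξ ∈ S
    · rw [indicator_of_mem hξ, indicator_of_mem hξ, indicator_of_mem hξ]
      have hξ1 : 1 ≤ freq ξ := hξ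
      have e5 : ‖e ξ‖ ≤ 1 / τ * (‖a ξ‖ + ‖d ξ‖) := by
        rw [e2, norm_mul, Complex.norm_real, Real.norm_of_nonneg hτ'.le]
        gcongr
        exact norm_sub_le _ _
      have e6 : freq ξ ^ 2 * ‖e ξ‖ ≤ 1 / τ * (freq ξ ^ 2 * ‖a ξ‖ + freq ξ ^ 3 * ‖d ξ‖) := by
        calc freq ξ ^ 2 * ‖e ξ‖ ≤ freq ξ ^ 2 * (1 / τ * (‖a ξ‖ + ‖d ξ‖)) := by gcongr
          _ = 1 / τ * (freq ξ ^ 2 * ‖a ξ‖ + freq ξ ^ 2 * ‖d ξ‖) := by ring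
          _ ≤ _ := by
            gcongr
            · norm_num
      have e7 : 2 / τ = 2 * (1 / τ) := by ring
      rw [e7]
      have e8 : 0 ≤ freq ξ ^ 2 * ‖e ξ‖ := by positivity
      have e9 : 0 ≤ freq ξ ^ 2 * ‖a ξ‖ := by positivity
      have e10 : 0 ≤ freq ξ ^ 3 * ‖d ξ‖ := by positivity
      have e11 : 0 ≤ freq ξ ^ 3 * ‖p ξ‖ := by positivity
      have e12 : 0 ≤ freq ξ * ‖p ξ‖ := by positivity
      have e13 : 0 ≤ freq ξ * ‖d ξ‖ := by positivity
      nlinarith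
    · rw [indicator_of_notMem hξ, indicator_of_notMem hξ, indicator_of_notMem hξ]
      have hξ1 : freq ξ < 1 := by simpa [hS] using hξ
      have : freq ξ ^ 2 ≤ 1 := pow_le_one₀ hk0 hξ1.le
      have h0 : 0 ≤ ‖a ξ‖ + freq ξ * ‖p ξ‖ + freq ξ * ‖d ξ‖ + ‖e ξ‖ := by positivity
      nlinarith [mul_le_mul_of_nonneg_right this h0]
  refine key.trans ?_
  rw [tsum_fintype, Fin.sum_univ_seven]
  set EL := energyL2 τ u v w
  set EH := energyHom P τ (3 / 2) u v w
  have hL : EL ≤ energyNorm P τ (3 / 2) u v w := le_self_add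
  have hH : EH ≤ energyNorm P τ (3 / 2) u v w := le_add_self
  have hc : ∀ (c : ℝ) (f : E3 → ℝ) (X : ℝ≥0∞), 0 ≤ c → eLpNorm f 2 volume ≤ X →
      eLpNorm (fun ξ => c * f ξ) 2 volume ≤ ENNReal.ofReal c * X := fun c f X h0 h => by
    rw [eLpNorm_const_mul_real h0]; gcongr
  have h5 : (5 : ℝ≥0∞) = ENNReal.ofReal 5 := by simp
  calc _ ≤ ENNReal.ofReal 2 * EL + ENNReal.ofReal 2 * EL + ENNReal.ofReal 2 * EL +
        ENNReal.ofReal 2 * EL + ENNReal.ofReal (2 + 2 / τ) * (5 * EH) +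
        ENNReal.ofReal (2 + 2 / τ) * (5 * EH) + ENNReal.ofReal 2 * (5 * EH) := by
        refine add_le_add (add_le_add (add_le_add (add_le_add (add_le_add (add_le_add ?_ ?_) ?_)
          ?_) ?_) ?_) ?_
        · exact hc _ _ _ (by norm_num) l1
        · exact hc _ _ _ (by norm_num) l3
        · exact hc _ _ _ (by norm_num) l2
        · exact hc _ _ _ (by norm_num) l4
        · exact hc _ _ _ (by positivity) b1
        · exact hc _ _ _ (by positivity) b2
        · exact hc _ _ _ (by norm_num) b3
    _ = ENNReal.ofReal 8 * EL + ENNReal.ofReal (30 + 20 / τ) * EH := by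
        have hx : 0 ≤ 2 + 2 / τ := by positivity
        rw [h5, show (8 : ℝ) = 2 + 2 + 2 + 2 by norm_num,
          show 30 + 20 / τ = (2 + 2 / τ) * 5 + (2 + 2 / τ) * 5 + 2 * 5 by ring]
        generalize 2 + 2 / τ = x at hx
        rw [ENNReal.ofReal_add (by positivity) (by positivity),
          ENNReal.ofReal_add (by positivity) (by positivity),
          ENNReal.ofReal_add (by positivity) (by positivity),
          ENNReal.ofReal_add (by positivity) (by positivity),
          ENNReal.ofReal_add (by positivity) (by positivity),
          ENNReal.ofReal_mul (by positivity), ENNReal.ofReal_mul (by positivity)]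
        ring
    _ ≤ ENNReal.ofReal 8 * energyNorm P τ (3 / 2) u v w +
        ENNReal.ofReal (30 + 20 / τ) * energyNorm P τ (3 / 2) u v w := by gcongr
    _ = _ := by
        rw [← add_mul, ← ENNReal.ofReal_add (by positivity) (by positivity), energyConst]
        ring_nf

end

lemma sobSize_add_le (τ : ℝ) (u v w u' v' w' : L2) :
    sobSize τ (u + u') (v + v') (w + w') ≤ sobSize τ u v w + sobSize τ u' v' w' := by
  have hm : ∀ u v w : L2, AEStronglyMeasurable
      (fun ξ => (1 + freq ξ ^ 2) * ampl τ u v w ξ) volume := fun u v w =>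
    ((continuous_const.add (continuous_freq.pow 2)).aestronglyMeasurable).mul (aesm_ampl τ u v w)
  refine le_trans (eLpNorm_mono_ae_real ?_) (eLpNorm_add_le (hm u v w) (hm u' v' w') (by norm_num))
  filter_upwards [fourier_add_ae u u', fourier_add_ae v v', fourier_add_ae w w'] with ξ h1 h2 h3
  have hk := freq_nonneg ξ
  rw [Real.norm_of_nonneg (mul_nonneg (by positivity) (ampl_nonneg _ _ _ _ _)), Pi.add_apply,
    ← mul_add]
  gcongr
  unfold ampl
  rw [h1, h2, h3]
  have n1 := norm_add_le ((𝓕 v : L2) ξ + τ * (𝓕 w : L2) ξ) ((𝓕 v' : L2) ξ + τ * (𝓕 w' : L2) ξ)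
  have n2 := norm_add_le ((𝓕 u : L2) ξ + τ * (𝓕 v : L2) ξ) ((𝓕 u' : L2) ξ + τ * (𝓕 v' : L2) ξ)
  have n3 := norm_add_le ((𝓕 v : L2) ξ) ((𝓕 v' : L2) ξ)
  have n4 := norm_add_le ((𝓕 w : L2) ξ) ((𝓕 w' : L2) ξ)
  have e1 : (𝓕 v : L2) ξ + (𝓕 v' : L2) ξ + τ * ((𝓕 w : L2) ξ + (𝓕 w' : L2) ξ) =
    ((𝓕 v : L2) ξ + τ * (𝓕 w : L2) ξ) + ((𝓕 v' : L2) ξ + τ * (𝓕 w' : L2) ξ) := by ring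
  have e2 : (𝓕 u : L2) ξ + (𝓕 u' : L2) ξ + τ * ((𝓕 v : L2) ξ + (𝓕 v' : L2) ξ) =
    ((𝓕 u : L2) ξ + τ * (𝓕 v : L2) ξ) + ((𝓕 u' : L2) ξ + τ * (𝓕 v' : L2) ξ) := by ring
  rw [e1, e2]
  have m2 := mul_le_mul_of_nonneg_left n2 hk
  have m3 := mul_le_mul_of_nonneg_left n3 hk
  linarith

lemma sobSize_neg (τ : ℝ) (u v w : L2) : sobSize τ (-u) (-v) (-w) = sobSize τ u v w := by
  refine eLpNorm_congr_ae ?_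
  have hn : ∀ f : L2, ∀ᵐ ξ, (𝓕 (-f) : L2) ξ = -(𝓕 f : L2) ξ := fun f => by
    have := fourier_smul_ae (-1) f
    rw [neg_one_smul] at this
    filter_upwards [this] with ξ h
    rw [h]; ring
  filter_upwards [hn u, hn v, hn w] with ξ h1 h2 h3
  simp only [ampl, h1, h2, h3]
  rw [← norm_neg (-(𝓕 v : L2) ξ), ← norm_neg (-(𝓕 w : L2) ξ),
    ← norm_neg (-(𝓕 v : L2) ξ + _), ← norm_neg (-(𝓕 u : L2) ξ + _)]
  ring_nf

/-- The Sobolev size is continuous in time. -/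
lemma continuousOn_sobSize {P : LittlewoodPaley} {τ : ℝ} (hτ : 0 < τ) {u v w : ℝ → L2}
    (h : ContEnergy P τ (3 / 2) u v w) :
    (∀ t, 0 ≤ t → sobSize τ (u t) (v t) (w t) < ∞) ∧
      ContinuousOn (fun t => (sobSize τ (u t) (v t) (w t)).toReal) (Ici 0) := by
  have hfin : ∀ t, 0 ≤ t → sobSize τ (u t) (v t) (w t) < ∞ := fun t ht =>
    (sobSize_le_energyNorm P τ _ _ _ hτ).trans_lt (ENNReal.mul_lt_top (by simp) (h t ht).1)
  refine ⟨hfin, fun t ht => ?_⟩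
  have h0 : Tendsto (fun r => sobSize τ (u r - u t) (v r - v t) (w r - w t)) (𝓝[Ici 0] t)
      (𝓝 0) := by
    have h1 := ENNReal.Tendsto.const_mul (a := ENNReal.ofReal (energyConst τ)) (h t ht).2
      (Or.inr (by simp))
    rw [mul_zero] at h1
    exact tendsto_of_tendsto_of_tendsto_of_le_of_le tendsto_const_nhds h1 (fun _ => zero_le)
      fun r => sobSize_le_energyNorm P τ _ _ _ hτ
  have h1 : Tendsto (fun r => (sobSize τ (u r - u t) (v r - v t) (w r - w t)).toReal) (𝓝[Ici 0] t)
      (𝓝 0) := (ENNReal.tendsto_toReal (by simp)).comp h0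
  have hlt : ∀ᶠ r in 𝓝[Ici 0] t, sobSize τ (u r - u t) (v r - v t) (w r - w t) < ∞ :=
    h0.eventually (gt_mem_nhds (by simp))
  rw [ContinuousWithinAt, tendsto_iff_dist_tendsto_zero]
  refine tendsto_of_tendsto_of_tendsto_of_le_of_le' tendsto_const_nhds h1
    (.of_forall fun _ => dist_nonneg) ?_
  filter_upwards [hlt, self_mem_nhdsWithin] with r hr hr0
  have t1 := sobSize_add_le τ (u t) (v t) (w t) (u r - u t) (v r - v t) (w r - w t)
  have t2 := sobSize_add_le τ (u r) (v r) (w r) (-(u r - u t)) (-(v r - v t)) (-(w r - w t))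
  rw [sobSize_neg] at t2
  simp only [add_sub_cancel, neg_sub] at t1 t2
  have t1' := ENNReal.toReal_mono (by finiteness [hfin t ht]) t1
  have t2' := ENNReal.toReal_mono (by finiteness [hfin r hr0]) t2
  rw [ENNReal.toReal_add (hfin t ht).ne hr.ne] at t1'
  rw [ENNReal.toReal_add (hfin r hr0).ne hr.ne] at t2'
  rw [Real.dist_eq, abs_le]
  constructor <;> linarith

/-! ### The solution on the Fourier side -/

lemma hasDerivWithinAt_fourier {f : ℝ → L2} {f' : L2} {s : Set ℝ} {t : ℝ}
    (h : HasDerivWithinAt f f' s t) :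
    HasDerivWithinAt (fun t => (𝓕 (f t) : L2)) (𝓕 f') s t :=
  ((FourierTransform.fourierCLM ℂ L2).restrictScalars ℝ).hasFDerivAt.comp_hasDerivWithinAt t h

lemma hasDerivWithinAt_smul_complex {f : ℝ → L2} {f' : L2} {s : Set ℝ} {t : ℝ} (c : ℂ)
    (h : HasDerivWithinAt f f' s t) : HasDerivWithinAt (fun t => c • f t) (c • f') s t :=
  ((c • ContinuousLinearMap.id ℂ L2).restrictScalars ℝ).hasFDerivAt.comp_hasDerivWithinAt t h

/-- On the Fourier side, `v + τ w`, `u + τ v` and `v` solve the linearised equation with the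
nonlinear term as a source, and `w` solves a damped equation. Here `β - τ > 0` is the coefficient of
the dissipation. -/
lemma IsGlobalSolution.exists_fourier {P : LittlewoodPaley} {τ β κ : ℝ} (hτ : 0 < τ)
    {u₀ u₁ u₂ : L2} {u v w : ℝ → L2} (h : IsGlobalSolution P τ β κ u₀ u₁ u₂ u v w) :
    ∃ N w' : ℝ → L2, (∀ t, 0 ≤ t → IsNonlinearity κ (u t) (v t) (w t) (N t)) ∧
      IsLinearSolution τ (β - τ) (fun t => 𝓕 (v t + (τ : ℂ) • w t))
        (fun t => 𝓕 (u t + (τ : ℂ) • v t)) (fun t => 𝓕 (v t)) (fun t => 𝓕 (N t))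
        (fun t => 𝓕 (w t + (τ : ℂ) • w' t)) (fun t => 𝓕 (w t)) ∧
      (∀ t, 0 ≤ t → HasDerivWithinAt (fun t => (𝓕 (w t) : L2)) (𝓕 (w' t)) (Ici 0) t) ∧
      ∀ t, 0 ≤ t → ∀ᵐ ξ, (𝓕 (w' t) : L2) ξ =
        (1 / τ : ℝ) * ((𝓕 (w t + (τ : ℂ) • w' t) : L2) ξ - (𝓕 (w t) : L2) ξ) := by
  obtain ⟨-, -, -, -, w', -, h⟩ := h
  have hN : ∀ t : ℝ, ∃ N : L2, 0 ≤ t → IsNonlinearity κ (u t) (v t) (w t) N ∧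
      (τ : ℂ) • td (w' t) = Δ (td (u t)) + (β : ℂ) • Δ (td (v t)) - td (w t) + td N := by
    intro t
    by_cases ht : 0 ≤ t
    · obtain ⟨-, -, -, N, hN⟩ := h t ht
      exact ⟨N, fun _ => hN⟩
    · exact ⟨0, fun h => absurd h ht⟩
  choose N hN using hN
  refine ⟨N, w', fun t ht => (hN t ht).1, ⟨fun t ht => ?_, fun t ht => ?_, fun t ht => ?_,
    fun t ht => ?_, fun t ht => ?_⟩, fun t ht => hasDerivWithinAt_fourier (h t ht).2.2.1,
    fun t ht => fourier_w_ae τ _ _ hτ.ne'⟩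
  · exact hasDerivWithinAt_fourier
      ((h t ht).2.1.add (hasDerivWithinAt_smul_complex _ (h t ht).2.2.1))
  · exact hasDerivWithinAt_fourier
      ((h t ht).1.add (hasDerivWithinAt_smul_complex _ (h t ht).2.1))
  · exact hasDerivWithinAt_fourier (h t ht).2.1
  · have h1 := (hasFourier_td (w' t)).smul τ
    rw [(hN t ht).2] at h1
    have h2 := h1.unique ((((hasFourier_td (u t)).laplacian.add
      ((hasFourier_td (v t)).laplacian.smul β)).sub (hasFourier_td (w t))).add
      (hasFourier_td (N t)))
    filter_upwards [h2, fourier_add_ae (w t) ((τ : ℂ) • w' t), fourier_smul_ae τ (w' t),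
      fourier_add_ae (u t) ((τ : ℂ) • v t), fourier_smul_ae τ (v t)] with ξ e1 e2 e3 e4 e5
    rw [e2, e3, e1, e4, e5]
    push_cast
    ring
  · exact fourier_w_ae τ _ _ hτ.ne'

/-- The length of the Fourier transform of `(v + τ w, ∇(u + τ v), ∇v)`. -/
noncomputable def vlen (τ : ℝ) (u v w : L2) (ξ : E3) : ℝ :=
  √(quad ((𝓕 (v + (τ : ℂ) • w) : L2) ξ) ((𝓕 (u + (τ : ℂ) • v) : L2) ξ) ((𝓕 v : L2) ξ) ξ)

/-- The components of the Fourier transform of `(v + τ w, ∇(u + τ v), ∇v)`. -/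
noncomputable def vecFourier (τ : ℝ) (u v w : L2) : Unit ⊕ Fin 3 ⊕ Fin 3 → E3 → ℂ :=
  Sum.elim (fun _ => (𝓕 (v + (τ : ℂ) • w) : L2))
    (Sum.elim (fun i ξ => 2 * Real.pi * Complex.I * (ξ i : ℝ) * (𝓕 (u + (τ : ℂ) • v) : L2) ξ)
      (fun i ξ => 2 * Real.pi * Complex.I * (ξ i : ℝ) * (𝓕 v : L2) ξ))

section

variable (τ : ℝ) (u v w : L2)

lemma vlen_nonneg (ξ : E3) : 0 ≤ vlen τ u v w ξ := Real.sqrt_nonneg _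

lemma vlen_sq (ξ : E3) : vlen τ u v w ξ ^ 2 =
    quad ((𝓕 (v + (τ : ℂ) • w) : L2) ξ) ((𝓕 (u + (τ : ℂ) • v) : L2) ξ) ((𝓕 v : L2) ξ) ξ :=
  Real.sq_sqrt (quad_nonneg _ _ _ _)

lemma aesm_vlen : AEStronglyMeasurable (vlen τ u v w) volume := by
  have hk := (continuous_freq.pow 2).aestronglyMeasurable (μ := (volume : Measure E3))
  have h := ((((aesm_norm_fourier (v + (τ : ℂ) • w)).pow 2).add
    (hk.mul ((aesm_norm_fourier (u + (τ : ℂ) • v)).pow 2))).add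
    (hk.mul ((aesm_norm_fourier v).pow 2)))
  exact Real.continuous_sqrt.comp_aestronglyMeasurable h

lemma hasFourier_vecV (i : Unit ⊕ Fin 3 ⊕ Fin 3) :
    HasFourier (vecV τ u v w i) (vecFourier τ u v w i) := by
  rcases i with i | i | i
  · exact hasFourier_td _
  · exact (hasFourier_td _).grad i
  · exact (hasFourier_td _).grad i

lemma sum_norm_vecFourier_sq (ξ : E3) :
    ∑ i, ‖vecFourier τ u v w i ξ‖ ^ 2 = vlen τ u v w ξ ^ 2 := by
  rw [Fintype.sum_sum_type, Fintype.sum_sum_type, vlen_sq, quad]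
  simp only [vecFourier, Sum.elim_inl, Sum.elim_inr, sum_norm_grad_sq]
  simp [add_assoc]

lemma norm_vecFourier_le (i : Unit ⊕ Fin 3 ⊕ Fin 3) (ξ : E3) :
    ‖vecFourier τ u v w i ξ‖ ≤ vlen τ u v w ξ := by
  refine le_of_sq_le_sq ?_ (vlen_nonneg τ u v w ξ)
  rw [← sum_norm_vecFourier_sq]
  exact Finset.single_le_sum (f := fun i => ‖vecFourier τ u v w i ξ‖ ^ 2)
    (fun _ _ => by positivity) (Finset.mem_univ i)

lemma vlen_bounds (ξ : E3) :
    ‖(𝓕 (v + (τ : ℂ) • w) : L2) ξ‖ ≤ vlen τ u v w ξ ∧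
    freq ξ * ‖(𝓕 (u + (τ : ℂ) • v) : L2) ξ‖ ≤ vlen τ u v w ξ ∧
    freq ξ * ‖(𝓕 v : L2) ξ‖ ≤ vlen τ u v w ξ ∧
    vlen τ u v w ξ ≤ ‖(𝓕 (v + (τ : ℂ) • w) : L2) ξ‖ +
      freq ξ * ‖(𝓕 (u + (τ : ℂ) • v) : L2) ξ‖ + freq ξ * ‖(𝓕 v : L2) ξ‖ := by
  have hk := freq_nonneg ξ
  have h1 := norm_nonneg ((𝓕 (v + (τ : ℂ) • w) : L2) ξ)
  have h2 := mul_nonneg hk (norm_nonneg ((𝓕 (u + (τ : ℂ) • v) : L2) ξ))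
  have h3 := mul_nonneg hk (norm_nonneg ((𝓕 v : L2) ξ))
  unfold vlen quad
  rw [← mul_pow, ← mul_pow]
  refine ⟨Real.le_sqrt_of_sq_le ?_, Real.le_sqrt_of_sq_le ?_, Real.le_sqrt_of_sq_le ?_,
    Real.sqrt_le_iff.2 ⟨by positivity, ?_⟩⟩
  · nlinarith
  · nlinarith
  · nlinarith
  · nlinarith [mul_nonneg h1 h2, mul_nonneg h1 h3, mul_nonneg h2 h3]

lemma vlen_le_ampl : ∀ᵐ ξ, vlen τ u v w ξ ≤ ampl τ u v w ξ := by
  filter_upwards [ampl_ae_eq τ u v w] with ξ h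
  have := (vlen_bounds τ u v w ξ).2.2.2
  rw [h]
  linarith [norm_nonneg ((𝓕 w : L2) ξ)]

lemma ampl_le_vlen : ∀ᵐ ξ, ampl τ u v w ξ ≤ 3 * vlen τ u v w ξ + ‖(𝓕 w : L2) ξ‖ := by
  filter_upwards [ampl_ae_eq τ u v w] with ξ h
  obtain ⟨h1, h2, h3, -⟩ := vlen_bounds τ u v w ξ
  rw [h]
  linarith

/-- Away from the low frequencies the transform of `w` is controlled by that of the vector. -/
lemma norm_fourier_w_le (hτ : 0 < τ) : ∀ᵐ ξ, 1 / 2 ≤ freq ξ →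
    ‖(𝓕 w : L2) ξ‖ ≤ 3 / τ * vlen τ u v w ξ := by
  filter_upwards [fourier_w_ae τ v w hτ.ne'] with ξ h hξ
  obtain ⟨h1, -, h3, -⟩ := vlen_bounds τ u v w ξ
  have hτ' : 0 < 1 / τ := by positivity
  rw [h, norm_mul, Complex.norm_real, Real.norm_of_nonneg hτ'.le,
    show 3 / τ = 1 / τ * 3 by ring, mul_assoc]
  gcongr
  refine (norm_sub_le _ _).trans ?_
  nlinarith [norm_nonneg ((𝓕 v : L2) ξ)]

lemma norm_le_freq (ξ : E3) : ‖ξ‖ ≤ freq ξ / 6 := by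
  unfold freq
  nlinarith [Real.pi_gt_three, norm_nonneg ξ]

lemma rpow_norm_le {ℓ : ℝ} (h0 : 0 ≤ ℓ) (h2 : ℓ ≤ 2) (ξ : E3) :
    ‖ξ‖ ^ ℓ ≤ 1 + freq ξ ^ 2 := by
  have h1 := norm_le_freq ξ
  have hk := freq_nonneg ξ
  rcases le_total ‖ξ‖ 1 with h | h
  · have := Real.rpow_le_one (norm_nonneg ξ) h h0
    nlinarith
  · have h3 := Real.rpow_le_rpow_of_exponent_le h h2
    rw [Real.rpow_two] at h3
    nlinarith [norm_nonneg ξ]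

lemma memLp_lambda {ℓ : ℝ} (h0 : 0 ≤ ℓ) (h2 : ℓ ≤ 2) (hE : sobSize τ u v w < ∞)
    (i : Unit ⊕ Fin 3 ⊕ Fin 3) :
    MemLp (fun ξ => ((‖ξ‖ ^ ℓ : ℝ) : ℂ) * vecFourier τ u v w i ξ) 2 volume := by
  have hm : AEStronglyMeasurable (fun ξ : E3 => ((‖ξ‖ ^ ℓ : ℝ) : ℂ)) volume :=
    (Complex.continuous_ofReal.comp (continuous_norm.rpow_const
      fun _ => Or.inr h0)).aestronglyMeasurable
  refine ⟨hm.mul (hasFourier_vecV τ u v w i).aesm, lt_of_le_of_lt (eLpNorm_mono_ae ?_) hE⟩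
  filter_upwards [vlen_le_ampl τ u v w] with ξ h
  have hA := ampl_nonneg τ u v w ξ
  rw [norm_mul, Complex.norm_real, Real.norm_of_nonneg (by positivity),
    Real.norm_of_nonneg (by positivity)]
  gcongr
  · exact rpow_norm_le h0 h2 ξ
  · exact (norm_vecFourier_le τ u v w i ξ).trans h

/-- `Λ^ℓ V` exists in `L²`, as the Sobolev size contains two derivatives of `V`. -/
lemma exists_lambda_vecV {ℓ : ℝ} (h0 : 0 ≤ ℓ) (h2 : ℓ ≤ 2) (hE : sobSize τ u v w < ∞) :
    ∃ W : Unit ⊕ Fin 3 ⊕ Fin 3 → TD, (∀ i, IsLambda ℓ (vecV τ u v w i) (W i)) ∧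
      ∀ i, HasFourier (W i) (fun ξ => ((‖ξ‖ ^ ℓ : ℝ) : ℂ) * vecFourier τ u v w i ξ) := by
  choose g hg using fun i => exists_hasFourier (memLp_lambda τ u v w h0 h2 hE i)
  have hV : ∀ i, MemLp (vecFourier τ u v w i) 2 volume := fun i => by
    simpa using memLp_lambda τ u v w le_rfl (by norm_num) hE i
  choose f hf using fun i => (hasFourier_vecV τ u v w i).exists_td (hV i)
  refine ⟨fun i => td (g i), fun i => ⟨f i, g i, (hf i).2, rfl, ?_⟩, fun i => (hg i).2⟩
  filter_upwards [(hf i).1, (hg i).1] with ξ e1 e2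
  rw [e1, e2]

/-- Plancherel's identity for a multiplier applied to `(v + τ w, ∇(u + τ v), ∇v)`. -/
lemma l2NormV_multiplier {W : Unit ⊕ Fin 3 ⊕ Fin 3 → TD} {g : E3 → ℝ}
    (hW : ∀ i, HasFourier (W i) (fun ξ => (g ξ : ℂ) * vecFourier τ u v w i ξ)) :
    l2NormV W = eLpNorm (fun ξ => g ξ * vlen τ u v w ξ) 2 volume :=
  l2NormV_eq hW (.of_forall fun ξ => by
    simp only [norm_mul, mul_pow]
    rw [← Finset.mul_sum, sum_norm_vecFourier_sq]
    simp)

lemma blockNorm_multiplier (P : LittlewoodPaley) (q : ℤ) {W : Unit ⊕ Fin 3 ⊕ Fin 3 → TD}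
    {g : E3 → ℝ} (hW : ∀ i, HasFourier (W i) (fun ξ => (g ξ : ℂ) * vecFourier τ u v w i ξ)) :
    blockNorm P q W = eLpNorm (fun ξ => blockSym P q ξ * (g ξ * vlen τ u v w ξ)) 2 volume := by
  have := l2NormV_multiplier τ u v w (W := fun i => block P q (W i))
    (g := fun ξ => blockSym P q ξ * g ξ) fun i => by
      refine ((hW i).block P q).congr (.of_forall fun ξ => ?_)
      push_cast; ring
  unfold blockNorm
  simpa only [mul_assoc] using this

lemma blockNorm_vecV (P : LittlewoodPaley) (q : ℤ) : blockNorm P q (vecV τ u v w) =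
    eLpNorm (fun ξ => blockSym P q ξ * vlen τ u v w ξ) 2 volume := by
  have := blockNorm_multiplier τ u v w P q (W := vecV τ u v w) (g := fun _ => 1) fun i => by
    simpa using hasFourier_vecV τ u v w i
  simpa using this

end

/-- The weighted `L²` norms as extended norms. -/
lemma IsWeight.eLpNorm_vlen {m g : E3 → ℝ} {l : ℝ} (hm : IsWeight m l)
    (hg : ∀ ξ, g ξ ^ 2 = m ξ) (τ : ℝ) (u v w : L2) :
    eLpNorm (fun ξ => g ξ * vlen τ u v w ξ) 2 volume = ENNReal.ofReal √(wnormSq m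
      (𝓕 (v + (τ : ℂ) • w)) (𝓕 (u + (τ : ℂ) • v)) (𝓕 v)) := by
  rw [eLpNorm_eq_sqrt] <;> simp only [mul_pow, hg, vlen_sq]
  · rfl
  · exact hm.integrable_quad _ _ _

lemma IsWeight.eLpNorm_norm {m g : E3 → ℝ} {l : ℝ} (hm : IsWeight m l)
    (hg : ∀ ξ, g ξ ^ 2 = m ξ) (f : L2) :
    eLpNorm (fun ξ => g ξ * ‖f ξ‖) 2 volume = ENNReal.ofReal √(wnormSq₁ m f) := by
  rw [eLpNorm_eq_sqrt] <;> simp only [mul_pow, hg]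
  · rfl
  · exact hm.integrable₁ _

/-! ### Scalar inequalities for the decay profile -/

lemma exp_neg_mul_le {c x : ℝ} (hc : 0 < c) (hx : 0 ≤ x) :
    Real.exp (-(c * x)) ≤ (8 + 4 / c ^ 2) * ((2 + x)⁻¹) ^ 2 := by
  have h1 := Real.quadratic_le_exp_of_nonneg (x := c * x) (by positivity)
  have hcx : 0 ≤ c * x := by positivity
  rw [Real.exp_neg, inv_pow, ← div_eq_mul_inv, inv_eq_one_div,
    div_le_div_iff₀ (Real.exp_pos _) (by positivity), one_mul]
  calc (2 + x) ^ 2 ≤ 8 + 2 * x ^ 2 := by nlinarith [sq_nonneg (x - 2)]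
    _ = 8 + 4 / c ^ 2 * ((c * x) ^ 2 / 2) := by field_simp; ring
    _ ≤ 8 * Real.exp (c * x) + 4 / c ^ 2 * Real.exp (c * x) := by
        gcongr
        · nlinarith [sq_nonneg (c * x)]
        · linarith
    _ = _ := by ring

lemma rpow_neg_three_halves {T : ℝ} (hT : 0 < T) :
    T ^ (-3 / 2 : ℝ) = T ^ (-1 / 2 : ℝ) * T⁻¹ := by
  rw [← Real.rpow_neg_one, ← Real.rpow_add hT]; norm_num

lemma exp_neg_mul_le_rpow {c t : ℝ} (hc : 0 < c) (ht : 0 ≤ t) :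
    Real.exp (-(c * t)) ≤ (8 + 4 / c ^ 2) * (1 + t) ^ (-3 / 2 : ℝ) := by
  refine (exp_neg_mul_le hc ht).trans ?_
  gcongr
  calc ((2 + t)⁻¹) ^ 2 ≤ ((1 + t)⁻¹) ^ 2 := by gcongr; norm_num
    _ = (1 + t) ^ (-2 : ℝ) := by
        rw [Real.rpow_neg (by positivity), Real.rpow_two, inv_pow]
    _ ≤ _ := Real.rpow_le_rpow_of_exponent_le (by linarith) (by norm_num)

/-- The bound for a block in the linear estimate, compared with the profile. -/
lemma block_bound_le {c h t x K : ℝ} (hc : 0 < c) (h0 : 0 < h) (h1 : h ≤ 1) (ht : 0 ≤ t)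
    (hx : 0 ≤ x) (hK : 0 ≤ K) :
    Real.exp (-c * (h ^ 2 / 4) * t) * (x + K) +
      K * (1 + t) ^ (-3 / 2 : ℝ) * min (1 / (h ^ 2 / 4)) (1 + t) ≤
      (13 + 64 / c ^ 2) * (x + K) * profile h (1 + t) := by
  have hT : 0 < 1 + t := by linarith
  have hh : 0 < h ^ 2 := by positivity
  have e1 : Real.exp (-c * (h ^ 2 / 4) * t) ≤ (13 + 64 / c ^ 2) * ((1 + h ^ 2 * (1 + t))⁻¹) ^ 2 := by
    have := exp_neg_mul_le (c := c / 4) (x := h ^ 2 * t) (by positivity) (by positivity)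
    rw [show -c * (h ^ 2 / 4) * t = -(c / 4 * (h ^ 2 * t)) by ring]
    refine this.trans ?_
    have h2 : h ^ 2 ≤ 1 := pow_le_one₀ h0.le h1
    have e : 4 / (c / 4) ^ 2 = 64 / c ^ 2 := by field_simp; norm_num
    rw [e]
    have hle : (2 + h ^ 2 * t)⁻¹ ≤ (1 + h ^ 2 * (1 + t))⁻¹ :=
      inv_anti₀ (by positivity) (by linarith)
    gcongr
    norm_num
  have e2 : (1 + t) ^ (-3 / 2 : ℝ) * min (1 / (h ^ 2 / 4)) (1 + t) ≤
      (13 + 64 / c ^ 2) * ((1 + t) ^ (-1 / 2 : ℝ) * (1 + h ^ 2 * (1 + t))⁻¹) := by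
    have hm0 : 0 ≤ min (1 / (h ^ 2 / 4)) (1 + t) := le_min (by positivity) hT.le
    have hm1 := min_le_left (1 / (h ^ 2 / 4)) (1 + t)
    have hm2 := min_le_right (1 / (h ^ 2 / 4)) (1 + t)
    generalize min (1 / (h ^ 2 / 4)) (1 + t) = m at *
    have e3 : (1 + t)⁻¹ * m ≤ 5 * (1 + h ^ 2 * (1 + t))⁻¹ := by
      rw [inv_mul_eq_div, ← div_eq_mul_inv, div_le_div_iff₀ hT (by positivity)]
      have : m * h ^ 2 ≤ 4 := by
        calc m * h ^ 2 ≤ 1 / (h ^ 2 / 4) * h ^ 2 := by gcongr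
          _ = 4 := by field_simp
      nlinarith [mul_le_mul_of_nonneg_right this hT.le]
    rw [rpow_neg_three_halves hT, mul_assoc]
    calc (1 + t) ^ (-1 / 2 : ℝ) * ((1 + t)⁻¹ * m)
        ≤ (1 + t) ^ (-1 / 2 : ℝ) * (5 * (1 + h ^ 2 * (1 + t))⁻¹) := by gcongr
      _ = 5 * ((1 + t) ^ (-1 / 2 : ℝ) * (1 + h ^ 2 * (1 + t))⁻¹) := by ring
      _ ≤ _ := by
        gcongr
        have : 0 ≤ 64 / c ^ 2 := by positivity
        linarith
  calc _ ≤ (13 + 64 / c ^ 2) * ((1 + h ^ 2 * (1 + t))⁻¹) ^ 2 * (x + K) +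
        (x + K) * ((13 + 64 / c ^ 2) * ((1 + t) ^ (-1 / 2 : ℝ) * (1 + h ^ 2 * (1 + t))⁻¹)) := by
        rw [mul_assoc K]
        gcongr
        linarith
    _ = _ := by unfold profile; ring

lemma profile_le_two {h T : ℝ} (hT : 1 ≤ T) : profile h T ≤ 2 := by
  have h1 : (1 + h ^ 2 * T)⁻¹ ≤ 1 := inv_le_one_of_one_le₀ (by nlinarith [sq_nonneg h])
  have h0 : 0 ≤ (1 + h ^ 2 * T)⁻¹ := by positivity
  have h2 : T ^ (-1 / 2 : ℝ) ≤ 1 := Real.rpow_le_one_of_one_le_of_nonpos hT (by norm_num)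
  have h3 : 0 ≤ T ^ (-1 / 2 : ℝ) := by positivity
  unfold profile
  nlinarith [mul_le_mul h2 h1 h0 zero_le_one]

lemma rpow_le_profile {h T : ℝ} (h0 : 0 < h) (h1 : h ≤ 1) (hT : 1 ≤ T) :
    T ^ (-3 / 2 : ℝ) ≤ 2 * profile h T := by
  have hT0 : 0 < T := by linarith
  have h2 : h ^ 2 ≤ 1 := pow_le_one₀ h0.le h1
  have e : T⁻¹ ≤ 2 * (1 + h ^ 2 * T)⁻¹ := by
    rw [← div_eq_mul_inv, inv_eq_one_div, div_le_div_iff₀ hT0 (by positivity)]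
    nlinarith
  rw [rpow_neg_three_halves hT0]
  calc T ^ (-1 / 2 : ℝ) * T⁻¹ ≤ T ^ (-1 / 2 : ℝ) * (2 * (1 + h ^ 2 * T)⁻¹) := by gcongr
    _ = 2 * (T ^ (-1 / 2 : ℝ) * (1 + h ^ 2 * T)⁻¹) := by ring
    _ ≤ _ := by
      unfold profile
      have : 0 ≤ (1 + h ^ 2 * T)⁻¹ ^ 2 := by positivity
      linarith

lemma profile_half_le {h S T : ℝ} (hS : 0 < S) (hT : 0 < T) (hST : T ≤ 2 * S) :
    profile h S ≤ 4 * profile h T := by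
  have e1 : (1 + h ^ 2 * S)⁻¹ ≤ 2 * (1 + h ^ 2 * T)⁻¹ := by
    rw [← div_eq_mul_inv, inv_eq_one_div, div_le_div_iff₀ (by positivity) (by positivity)]
    nlinarith [mul_le_mul_of_nonneg_left hST (sq_nonneg h)]
  have e2 : S ^ (-1 / 2 : ℝ) ≤ 2 * T ^ (-1 / 2 : ℝ) := by
    have h1 : (2 * S) ^ (-1 / 2 : ℝ) ≤ T ^ (-1 / 2 : ℝ) :=
      Real.rpow_le_rpow_of_nonpos hT hST (by norm_num)
    rw [Real.mul_rpow (by norm_num) hS.le] at h1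
    have h2 : (1 / 2 : ℝ) ≤ 2 ^ (-1 / 2 : ℝ) := by
      calc (1 / 2 : ℝ) = 2 ^ (-1 : ℝ) := by rw [Real.rpow_neg_one]; norm_num
        _ ≤ _ := Real.rpow_le_rpow_of_exponent_le (by norm_num) (by norm_num)
    have h3 : 0 ≤ S ^ (-1 / 2 : ℝ) := by positivity
    nlinarith [mul_le_mul_of_nonneg_right h2 h3]
  have p1 : 0 ≤ (1 + h ^ 2 * S)⁻¹ := by positivity
  have p2 : 0 ≤ S ^ (-1 / 2 : ℝ) := by positivity
  have p3 : 0 ≤ (1 + h ^ 2 * T)⁻¹ := by positivity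
  have p4 : 0 ≤ T ^ (-1 / 2 : ℝ) := by positivity
  unfold profile
  have q1 := pow_le_pow_left₀ p1 e1 2
  have q2 := mul_le_mul e2 e1 p1 (by positivity)
  nlinarith

lemma weight_eq (q : ℤ) (s : ℝ) : weight q s = ENNReal.ofReal (((2 : ℝ) ^ q) ^ s) := by
  rw [weight, Real.rpow_mul (by norm_num), Real.rpow_intCast]

/-! ### Sources -/

/-- A bounded function is small on dyadic blocks of low frequency. -/
lemma exists_block_bound : ∃ c : ℝ, 0 < c ∧ ∀ (P : LittlewoodPaley) (q : ℤ) (f : L2) (B : ℝ),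
    (∀ᵐ ξ, ‖f ξ‖ₑ ≤ ENNReal.ofReal B) → eLpNorm (fun ξ => blockSym P q ξ * ‖f ξ‖) 2 volume ≤
      ENNReal.ofReal (c * ((2 : ℝ) ^ q) ^ (3 / 2 : ℝ) * B) := by
  set V := volume (Metric.ball (0 : E3) 1) with hV
  have hVt : V < ∞ := measure_ball_lt_top
  set c : ℝ := √(1 + V.toReal) with hc
  refine ⟨c, by positivity, fun P q f B hB => ?_⟩
  have hh : (0 : ℝ) < 2 ^ q := by positivity
  set S := Metric.closedBall (0 : E3) (2 ^ q) with hS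
  have hv : volume S = ENNReal.ofReal (((2 : ℝ) ^ q) ^ 3) * V := by
    rw [hS, Measure.addHaar_closedBall _ _ hh.le, finrank_euclideanSpace_fin]
  have h1 : eLpNorm (fun ξ => blockSym P q ξ * ‖f ξ‖) 2 volume ^ 2 ≤
      ENNReal.ofReal (c * ((2 : ℝ) ^ q) ^ (3 / 2 : ℝ) * B) ^ 2 := by
    rw [eLpNorm_two_sq]
    calc ∫⁻ ξ, ‖blockSym P q ξ * ‖f ξ‖‖ₑ ^ 2
        ≤ ∫⁻ ξ, S.indicator (fun _ => ENNReal.ofReal B ^ 2) ξ := by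
          refine lintegral_mono_ae ?_
          filter_upwards [hB] with ξ hξ
          by_cases h0 : blockSym P q ξ = 0
          · simp [h0]
          have hmem : ξ ∈ S := by
            have := (blockSym_supp P h0).2
            have h2 := norm_le_freq ξ
            simp only [hS, Metric.mem_closedBall, dist_zero_right]
            linarith
          rw [indicator_of_mem hmem, enorm_mul, enorm_norm]
          gcongr
          refine (mul_le_mul' ?_ hξ).trans (one_mul _).le
          rw [Real.enorm_of_nonneg (blockSym_nonneg P q ξ), ENNReal.ofReal_le_one]
          exact blockSym_le_one P q ξ
      _ = ENNReal.ofReal B ^ 2 * volume S := by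
          rw [lintegral_indicator measurableSet_closedBall, lintegral_const,
            Measure.restrict_apply_univ]
      _ ≤ ENNReal.ofReal B ^ 2 * (ENNReal.ofReal (((2 : ℝ) ^ q) ^ 3) * ENNReal.ofReal (c ^ 2)) := by
          rw [hv]
          gcongr
          rw [hc, Real.sq_sqrt (by positivity)]
          refine ENNReal.le_ofReal_iff_toReal_le hVt.ne (by positivity) |>.2 (by linarith)
      _ = _ := by
          have e : ((2 : ℝ) ^ q) ^ 3 = (((2 : ℝ) ^ q) ^ (3 / 2 : ℝ)) ^ 2 := by
            rw [← Real.rpow_natCast, ← Real.rpow_natCast, ← Real.rpow_mul hh.le]; norm_num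
          rw [ENNReal.ofReal_mul (by positivity), ENNReal.ofReal_mul (by positivity), e,
            ENNReal.ofReal_pow (by positivity), ENNReal.ofReal_pow (by positivity)]
          ring
  exact (ENNReal.pow_le_pow_left_iff two_ne_zero).1 h1

/-! ### Decay of the dyadic blocks -/

/-- Decay of the low-frequency blocks of solutions of the linearised equation with a source that
decays like `(1 + t) ^ (-3 / 2)`. -/
lemma exists_block_decay {τ γ : ℝ} (hτ : 0 < τ) (hγ : 0 < γ) :
    ∃ Q : ℝ, 0 < Q ∧ ∀ (P : LittlewoodPaley) {q : ℤ} {h : ℝ}, (2 : ℝ) ^ q = h → h ≤ 1 →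
      ∀ {a p d n r s : ℝ → L2}, IsLinearSolution τ γ a p d n r s → ∀ {t E K : ℝ}, 0 ≤ t → 0 ≤ E →
        0 ≤ K → √(wnormSq (blockWeight P q) (a 0) (p 0) (d 0)) ≤ h ^ (3 / 2 : ℝ) * E →
        (∀ σ ∈ Icc 0 t, √(wnormSq₁ (blockWeight P q) (n σ)) ≤
          h ^ (3 / 2 : ℝ) * K * (1 + σ) ^ (-3 / 2 : ℝ)) →
        √(wnormSq (blockWeight P q) (a t) (p t) (d t)) ≤
          Q * (E + K) * (h ^ (3 / 2 : ℝ) * profile h (1 + t)) := by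
  obtain ⟨c, C, hc, hC, H⟩ := exists_linear_decay hτ hγ
  refine ⟨C * (13 + 64 / c ^ 2), by positivity, ?_⟩
  intro P q h hq h1 a p d n r s hsol t E K ht hE hK h0 hn
  have hh : 0 < h := by rw [← hq]; positivity
  have hm := isWeight_block P (q := q) (by rw [hq]; exact h1)
  rw [hq] at hm
  refine (H (by positivity) hm hsol ht (by positivity) hn).trans ?_
  have hb := block_bound_le (x := h ^ (3 / 2 : ℝ) * E) (K := h ^ (3 / 2 : ℝ) * K) hc hh h1 ht
    (by positivity) (by positivity)
  calc _ ≤ C * (Real.exp (-c * (h ^ 2 / 4) * t) * (h ^ (3 / 2 : ℝ) * E + h ^ (3 / 2 : ℝ) * K) +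
            h ^ (3 / 2 : ℝ) * K * (1 + t) ^ (-3 / 2 : ℝ) * min (1 / (h ^ 2 / 4)) (1 + t)) := by
        gcongr
    _ ≤ C * ((13 + 64 / c ^ 2) * (h ^ (3 / 2 : ℝ) * E + h ^ (3 / 2 : ℝ) * K) *
        profile h (1 + t)) := by gcongr
    _ = _ := by ring

/-- Decay of the low-frequency blocks of `w`. -/
lemma exists_block_decay_w {τ γ : ℝ} (hτ : 0 < τ) (hγ : 0 < γ) :
    ∃ Q : ℝ, 0 < Q ∧ ∀ (P : LittlewoodPaley) {q : ℤ} {h : ℝ}, (2 : ℝ) ^ q = h → h ≤ 1 →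
      ∀ {a p d n r s s' : ℝ → L2}, IsLinearSolution τ γ a p d n r s →
        (∀ t, 0 ≤ t → HasDerivWithinAt s (s' t) (Ici 0) t) →
        (∀ t, 0 ≤ t → ∀ᵐ ξ, s' t ξ = (1 / τ : ℝ) * (r t ξ - s t ξ)) →
        ∀ {t E K : ℝ}, 0 ≤ t → 0 ≤ E →
        0 ≤ K → √(wnormSq (blockWeight P q) (a 0) (p 0) (d 0)) ≤ h ^ (3 / 2 : ℝ) * E →
        √(wnormSq₁ (blockWeight P q) (s 0)) ≤ h ^ (1 / 2 : ℝ) * E →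
        (∀ σ ∈ Icc 0 t, √(wnormSq₁ (blockWeight P q) (n σ)) ≤
          h ^ (3 / 2 : ℝ) * K * (1 + σ) ^ (-3 / 2 : ℝ)) →
        √(wnormSq₁ (blockWeight P q) (s t)) ≤
          Q * (E + K) * (Real.exp (-(1 / τ) * t / 2) * h ^ (1 / 2 : ℝ) +
            h ^ (3 / 2 : ℝ) * profile h (1 + t)) := by
  obtain ⟨Q, hQ, H⟩ := exists_block_decay hτ hγ
  set Q' := 6 * (1 + γ) * Q + 4 with hQ'
  refine ⟨1 + 4 * Q', by positivity, ?_⟩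
  intro P q h hq h1 a p d n r s s' hsol hs he t E K ht hE hK h0 hs0 hn
  have hh : 0 < h := by rw [← hq]; positivity
  have hm := isWeight_block P (q := q) (by rw [hq]; exact h1)
  have hr : ∀ σ ∈ Icc 0 t, √(wnormSq₁ (blockWeight P q) (r σ)) ≤
      Q' * (E + K) * (h ^ (3 / 2 : ℝ) * profile h (1 + σ)) := by
    intro σ hσ
    have e1 := H P hq h1 hsol hσ.1 hE hK h0 fun σ' hσ' => hn σ' ⟨hσ'.1, hσ'.2.trans hσ.2⟩
    have e2 := sqrt_wnormSq₁_le hγ hm (a := a σ) (R := 8 / 3 * h)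
      (fun ξ hξ => by have := (blockWeight_supp P hξ).2; rwa [hq] at this) (by positivity)
      (hsol.eq_r σ hσ.1)
    have e3 := rpow_le_profile (T := 1 + σ) hh h1 (by linarith [hσ.1])
    have e4 : 0 ≤ profile h (1 + σ) := profile_nonneg (by linarith [hσ.1])
    refine e2.trans ?_
    calc 2 * (1 + γ) * (8 / 3 * h) * √(wnormSq (blockWeight P q) (a σ) (p σ) (d σ)) +
          2 * √(wnormSq₁ (blockWeight P q) (n σ))
        ≤ 2 * (1 + γ) * (8 / 3 * 1) * (Q * (E + K) * (h ^ (3 / 2 : ℝ) * profile h (1 + σ))) +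
          2 * (h ^ (3 / 2 : ℝ) * K * (2 * profile h (1 + σ))) := by
          gcongr
          exact (hn σ hσ).trans (by gcongr)
      _ ≤ 6 * (1 + γ) * (Q * (E + K) * (h ^ (3 / 2 : ℝ) * profile h (1 + σ))) +
          4 * ((E + K) * (h ^ (3 / 2 : ℝ) * profile h (1 + σ))) := by
          refine add_le_add (mul_le_mul_of_nonneg_right (by linarith) (by positivity)) ?_
          have : 0 ≤ E * (h ^ (3 / 2 : ℝ) * profile h (1 + σ)) := by positivity
          nlinarith
      _ = _ := by rw [hQ']; ring
  have hD : 0 ≤ E + K := by positivity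
  have hp : 0 ≤ profile h (1 + t) := profile_nonneg (by linarith)
  have hh2 : h ^ (3 / 2 : ℝ) ≤ h ^ (1 / 2 : ℝ) :=
    Real.rpow_le_rpow_of_exponent_ge hh h1 (by norm_num)
  -- On the first half of `[0, t]` the source is only bounded, but its effect is damped exponentially;
  -- on the second half the profile at time `σ` is comparable with the profile at time `t`.
  have key := damped_decay hτ hs he hm ht (K₁ := Q' * (E + K) * (h ^ (1 / 2 : ℝ) * 2))
    (K₂ := Q' * (E + K) * (h ^ (3 / 2 : ℝ) * (4 * profile h (1 + t)))) (by positivity)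
    (by positivity) (fun σ hσ => ?_) fun σ hσ => ?_
  · refine key.trans ?_
    have p1 : 0 ≤ (E + K) * (h ^ (3 / 2 : ℝ) * profile h (1 + t)) := by positivity
    have p2 : 0 ≤ Real.exp (-(1 / τ) * t / 2) := (Real.exp_pos _).le
    calc _ ≤ Real.exp (-(1 / τ) * t / 2) * (h ^ (1 / 2 : ℝ) * (E + K) +
          2 * (Q' * (E + K) * (h ^ (1 / 2 : ℝ) * 2))) +
          (1 + 4 * Q') * ((E + K) * (h ^ (3 / 2 : ℝ) * profile h (1 + t))) := by
          refine add_le_add (mul_le_mul_of_nonneg_left (add_le_add (hs0.trans ?_) ?_) p2) ?_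
          · gcongr; linarith
          · have : 0 ≤ Q' * (E + K) * (h ^ (1 / 2 : ℝ) * 2) := by positivity
            linarith
          · nlinarith
      _ = _ := by ring
  · refine (hr σ ⟨hσ.1, by linarith [hσ.2]⟩).trans ?_
    have := profile_le_two (h := h) (T := 1 + σ) (by linarith [hσ.1])
    have : 0 ≤ profile h (1 + σ) := profile_nonneg (by linarith [hσ.1])
    gcongr
  · have hσ0 : 0 ≤ σ := by linarith [hσ.1]
    refine (hr σ ⟨hσ0, hσ.2.le⟩).trans ?_
    have := profile_half_le (h := h) (S := 1 + σ) (T := 1 + t) (by linarith) (by linarith)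
      (by linarith [hσ.1])
    have : 0 ≤ profile h (1 + σ) := profile_nonneg (by linarith)
    gcongr

/-- Decay of the second derivatives away from the low frequencies. -/
lemma exists_high_decay {τ γ : ℝ} (hτ : 0 < τ) (hγ : 0 < γ) :
    ∃ Q : ℝ, 0 < Q ∧ ∀ {R : ℝ} {a p d n r s : ℝ → L2}, IsLinearSolution τ γ a p d n r s →
      ∀ {t E K : ℝ}, 0 ≤ t → 0 ≤ E → 0 ≤ K → √(wnormSq (highWeight R) (a 0) (p 0) (d 0)) ≤ E →
        (∀ σ ∈ Icc 0 t, √(wnormSq₁ (highWeight R) (n σ)) ≤ K * (1 + σ) ^ (-3 / 2 : ℝ)) →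
        √(wnormSq (highWeight R) (a t) (p t) (d t)) ≤ Q * (E + K) * (1 + t) ^ (-3 / 2 : ℝ) := by
  obtain ⟨c, C, hc, hC, H⟩ := exists_linear_decay hτ hγ
  refine ⟨C * (8 + 4 / (c / 8) ^ 2 + 8), by positivity, ?_⟩
  intro R a p d n r s hsol t E K ht hE hK h0 hn
  refine (H (by norm_num) (isWeight_high R) hsol ht hK hn).trans ?_
  have e := exp_neg_mul_le_rpow (c := c / 8) (t := t) (by positivity) ht
  have hm : min (1 / (1 / 8)) (1 + t) ≤ 8 := by norm_num
  have hT : 0 ≤ (1 + t) ^ (-3 / 2 : ℝ) := by positivity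
  rw [show -c * (1 / 8) * t = -(c / 8 * t) by ring]
  calc _ ≤ C * ((8 + 4 / (c / 8) ^ 2) * (1 + t) ^ (-3 / 2 : ℝ) * (E + K) +
        (E + K) * (1 + t) ^ (-3 / 2 : ℝ) * 8) := by
        gcongr
        linarith
    _ = _ := by ring

/-- Frequency-localised decay at time `t`: bounds for the low-frequency blocks of
`V = (v + τ w, ∇(u + τ v), ∇v)` and of `w`, and for two derivatives of `V` at high frequencies. -/
structure FreqDecay (P : LittlewoodPaley) (τ D t : ℝ) (u v w : L2) : Prop where
  block : ∀ n : ℕ, eLpNorm (fun ξ => blockSym P (-((n : ℤ) + 1)) ξ * vlen τ u v w ξ) 2 volume ≤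
    ENNReal.ofReal (D * (((1 / 2) ^ (n + 1)) ^ (3 / 2 : ℝ) * profile ((1 / 2) ^ (n + 1)) (1 + t)))
  block_w : ∀ n : ℕ,
    eLpNorm (fun ξ => blockSym P (-((n : ℤ) + 1)) ξ * ‖(𝓕 w : L2) ξ‖) 2 volume ≤
      ENNReal.ofReal (D * (Real.exp (-(1 / τ) * t / 2) * ((1 / 2) ^ (n + 1)) ^ (1 / 2 : ℝ) +
        ((1 / 2) ^ (n + 1)) ^ (3 / 2 : ℝ) * profile ((1 / 2) ^ (n + 1)) (1 + t)))
  high : eLpNorm ({ξ | 1 / 2 ≤ freq ξ}.indicator fun ξ => freq ξ ^ 2 * vlen τ u v w ξ) 2 volume ≤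
    ENNReal.ofReal (D * (1 + t) ^ (-3 / 2 : ℝ))

/-- The square root of the weight of `H²` on bounded regions away from the low frequencies. -/
noncomputable def highSym (R : ℝ) : E3 → ℝ :=
  {ξ | 1 / 2 ≤ freq ξ ∧ freq ξ ≤ R}.indicator fun ξ => freq ξ ^ 2

lemma highSym_sq (R : ℝ) (ξ : E3) : highSym R ξ ^ 2 = highWeight R ξ := by
  unfold highSym highWeight
  by_cases h : ξ ∈ {ξ : E3 | 1 / 2 ≤ freq ξ ∧ freq ξ ≤ R}
  · rw [indicator_of_mem h, indicator_of_mem h]; ring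
  · rw [indicator_of_notMem h, indicator_of_notMem h]; norm_num

lemma highSym_nonneg (R : ℝ) (ξ : E3) : 0 ≤ highSym R ξ :=
  indicator_nonneg (fun ξ _ => by positivity) ξ

lemma highSym_le (R : ℝ) (ξ : E3) : highSym R ξ ≤ 1 + freq ξ ^ 2 := by
  unfold highSym
  by_cases h : ξ ∈ {ξ : E3 | 1 / 2 ≤ freq ξ ∧ freq ξ ≤ R}
  · rw [indicator_of_mem h]; linarith
  · rw [indicator_of_notMem h]; positivity

/-- Exhaustion of the high frequencies by bounded regions. -/
lemma eLpNorm_high_le_of_forall {f : E3 → ℝ} (hf : AEStronglyMeasurable f volume) {B : ℝ≥0∞}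
    (h : ∀ R : ℕ, eLpNorm (fun ξ => highSym R ξ * f ξ) 2 volume ≤ B) :
    eLpNorm ({ξ | 1 / 2 ≤ freq ξ}.indicator fun ξ => freq ξ ^ 2 * f ξ) 2 volume ≤ B := by
  have hm : ∀ R : ℝ, AEStronglyMeasurable (highSym R) volume := fun R =>
    (continuous_freq.pow 2).aestronglyMeasurable.indicator (measurableSet_highRegion R)
  refine (Lp.eLpNorm_lim_le_liminf_eLpNorm (f := fun (R : ℕ) ξ => highSym R ξ * f ξ)
    (fun R => (hm R).mul hf) _ ?_).trans ?_
  · refine .of_forall fun ξ => ?_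
    obtain ⟨R₀, hR₀⟩ := exists_nat_ge (freq ξ)
    refine tendsto_const_nhds.congr' ?_
    filter_upwards [eventually_ge_atTop R₀] with R hR
    have hle : freq ξ ≤ R := hR₀.trans (by exact_mod_cast hR)
    by_cases hξ : 1 / 2 ≤ freq ξ
    · rw [indicator_of_mem (by exact hξ), highSym, indicator_of_mem (by exact ⟨hξ, hle⟩)]
    · rw [indicator_of_notMem (by exact hξ), highSym,
        indicator_of_notMem (by exact fun h => hξ h.1), zero_mul]
  · exact (liminf_le_liminf (.of_forall h)).trans (by simp)

/-! ### Propagation of the decay of the Sobolev size -/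

lemma sqrt_le_of_eLpNorm {x y : ℝ} (hy : 0 ≤ y) (h : ENNReal.ofReal x ≤ ENNReal.ofReal y) : x ≤ y :=
  (ENNReal.ofReal_le_ofReal_iff hy).1 h

/-- The initial size controls the low-frequency blocks. -/
lemma block_initial_le {P : LittlewoodPaley} {τ E : ℝ} {u v w : L2}
    (hE : initialSize P τ u v w ≤ ENNReal.ofReal E) (q : ℤ) :
    eLpNorm (fun ξ => blockSym P q ξ * vlen τ u v w ξ) 2 volume ≤
      ENNReal.ofReal (((2 : ℝ) ^ q) ^ (3 / 2 : ℝ) * E) := by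
  have h1 : weight q (-3 / 2) * blockNorm P q (vecV τ u v w) ≤ ENNReal.ofReal E :=
    (le_iSup (fun q : ℤ => weight q (-3 / 2) * blockNorm P q (vecV τ u v w)) q).trans
      (le_add_self.trans hE)
  rw [blockNorm_vecV, weight_eq] at h1
  set x := ((2 : ℝ) ^ q) ^ (3 / 2 : ℝ) with hx
  have hx0 : 0 < x := by positivity
  have e : ((2 : ℝ) ^ q) ^ (-3 / 2 : ℝ) = x⁻¹ := by
    rw [hx, ← Real.rpow_neg (by positivity)]; norm_num
  rw [e] at h1
  calc _ = ENNReal.ofReal x * (ENNReal.ofReal x⁻¹ *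
        eLpNorm (fun ξ => blockSym P q ξ * vlen τ u v w ξ) 2 volume) := by
        rw [← mul_assoc, ← ENNReal.ofReal_mul hx0.le, mul_inv_cancel₀ hx0.ne']; simp
    _ ≤ ENNReal.ofReal x * ENNReal.ofReal E := by gcongr
    _ = _ := (ENNReal.ofReal_mul hx0.le).symm

/-- Since `τ w = (v + τ w) - v`, the blocks of `w` are controlled with the loss of one derivative. -/
lemma block_w_le (P : LittlewoodPaley) {τ : ℝ} (hτ : 0 < τ) (u v w : L2) {q : ℤ}
    (hq : (2 : ℝ) ^ q ≤ 1) :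
    eLpNorm (fun ξ => blockSym P q ξ * ‖(𝓕 w : L2) ξ‖) 2 volume ≤
      ENNReal.ofReal (3 / τ * ((2 : ℝ) ^ q)⁻¹) *
        eLpNorm (fun ξ => blockSym P q ξ * vlen τ u v w ξ) 2 volume := by
  have hh : (0 : ℝ) < 2 ^ q := by positivity
  rw [← eLpNorm_const_mul_real (by positivity)]
  refine eLpNorm_mono_ae ?_
  filter_upwards [fourier_w_ae τ v w hτ.ne'] with ξ h
  obtain ⟨h1, -, h3, -⟩ := vlen_bounds τ u v w ξ
  have hV := vlen_nonneg τ u v w ξ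
  have hb := blockSym_nonneg P q ξ
  have hτ' : 0 < 1 / τ := by positivity
  rw [Real.norm_of_nonneg (by positivity), Real.norm_of_nonneg (by positivity), mul_left_comm]
  by_cases h0 : blockSym P q ξ = 0
  · simp [h0]
  have hs := (blockSym_supp P h0).1
  gcongr
  rw [h, norm_mul, Complex.norm_real, Real.norm_of_nonneg hτ'.le,
    show 3 / τ * ((2 : ℝ) ^ q)⁻¹ * vlen τ u v w ξ = 1 / τ * (3 * (((2 : ℝ) ^ q)⁻¹ * vlen τ u v w ξ))
      by ring]
  gcongr
  refine (norm_sub_le _ _).trans ?_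
  have h4 : ‖(𝓕 v : L2) ξ‖ ≤ 4 / 3 * (((2 : ℝ) ^ q)⁻¹ * vlen τ u v w ξ) := by
    rw [inv_mul_eq_div, ← mul_div_assoc, le_div_iff₀ hh]
    nlinarith [norm_nonneg ((𝓕 v : L2) ξ)]
  have h5 : vlen τ u v w ξ ≤ ((2 : ℝ) ^ q)⁻¹ * vlen τ u v w ξ :=
    le_mul_of_one_le_left hV ((one_le_inv₀ hh).2 hq)
  linarith

lemma FreqDecay.mono {P : LittlewoodPaley} {τ D D' t : ℝ} {u v w : L2}
    (h : FreqDecay P τ D t u v w) (ht : 0 ≤ t) (hD : D ≤ D') : FreqDecay P τ D' t u v w := by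
  have hp : ∀ x, 0 ≤ profile x (1 + t) := fun x => profile_nonneg (by linarith)
  refine ⟨fun n => (h.block n).trans ?_, fun n => (h.block_w n).trans ?_, h.high.trans ?_⟩
  · refine ENNReal.ofReal_le_ofReal (mul_le_mul_of_nonneg_right hD ?_)
    exact mul_nonneg (by positivity) (hp _)
  · refine ENNReal.ofReal_le_ofReal (mul_le_mul_of_nonneg_right hD ?_)
    exact add_nonneg (by positivity) (mul_nonneg (by positivity) (hp _))
  · exact ENNReal.ofReal_le_ofReal (mul_le_mul_of_nonneg_right hD (by positivity))

/-- If the Sobolev size decays like `M (1 + σ)^{-3/4}` on `[0, t]`, then the solution has the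
frequency-localised decay at time `t` with a constant quadratic in `M`, since the nonlinear term is
of size `M² (1 + σ)^{-3/2}`. -/
lemma exists_freqDecay {τ β : ℝ} (κ : ℝ) (hτ : 0 < τ) (hβ : τ < β) :
    ∃ Q : ℝ, 0 < Q ∧ ∀ {P : LittlewoodPaley} {u₀ u₁ u₂ : L2} {u v w : ℝ → L2},
      IsGlobalSolution P τ β κ u₀ u₁ u₂ u v w → ∀ {t E M : ℝ}, 0 ≤ t → 0 ≤ E → 0 ≤ M →
        initialSize P τ u₀ u₁ u₂ ≤ ENNReal.ofReal E →
        (∀ σ ∈ Icc 0 t, sobSize τ (u σ) (v σ) (w σ) ≤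
          ENNReal.ofReal (M * (1 + σ) ^ (-3 / 4 : ℝ))) →
        FreqDecay P τ (Q * (E + M ^ 2)) t (u t) (v t) (w t) := by
  have hγ : 0 < β - τ := by linarith
  obtain ⟨Q₁, hQ₁, H₁⟩ := exists_block_decay hτ hγ
  obtain ⟨Q₂, hQ₂, H₂⟩ := exists_block_decay_w hτ hγ
  obtain ⟨Q₃, hQ₃, H₃⟩ := exists_high_decay hτ hγ
  obtain ⟨c, hc, Hc⟩ := exists_block_bound
  set ν := (nlConst τ κ).toReal with hν
  have hν0 : 0 ≤ ν := ENNReal.toReal_nonneg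
  have hνe : nlConst τ κ = ENNReal.ofReal ν := (ENNReal.ofReal_toReal (nlConst_lt_top τ κ).ne).symm
  set b := 1 + 3 / τ + energyConst τ + (c + 1) * ν with hb
  have hec : 0 < energyConst τ := by unfold energyConst; positivity
  have hb0 : 0 < b := by positivity
  refine ⟨(Q₁ + Q₂ + Q₃) * b, by positivity, ?_⟩
  intro P u₀ u₁ u₂ u v w hs t E M ht hE hM hinit hM'
  obtain ⟨N, w', hN, hsol, hw', hwe⟩ := hs.exists_fourier hτ
  obtain ⟨hu0, hv0, hw0, -, -⟩ := hs
  rw [← hu0, ← hv0, ← hw0] at hinit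
  have hsq : ∀ σ ∈ Icc 0 t, nlConst τ κ * sobSize τ (u σ) (v σ) (w σ) ^ 2 ≤
      ENNReal.ofReal (ν * M ^ 2 * (1 + σ) ^ (-3 / 2 : ℝ)) := by
    intro σ hσ
    have hσ0 : 0 ≤ 1 + σ := by linarith [hσ.1]
    rw [hνe, mul_assoc, ENNReal.ofReal_mul hν0]
    gcongr
    refine (pow_le_pow_left' (hM' σ hσ) 2).trans (le_of_eq ?_)
    rw [← ENNReal.ofReal_pow (by positivity), mul_pow, ← Real.rpow_natCast ((1 + σ) ^ _),
      ← Real.rpow_mul hσ0]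
    norm_num
  have hlt : ∀ σ ∈ Icc 0 t, sobSize τ (u σ) (v σ) (w σ) < ∞ := fun σ hσ =>
    (hM' σ hσ).trans_lt (by simp)
  set K := b * M ^ 2 with hK
  have hK0 : 0 ≤ K := by positivity
  set F := b * E with hF
  have hF0 : 0 ≤ F := by positivity
  have bE1 : E ≤ F := le_mul_of_one_le_left hE (by
    have : 0 ≤ 3 / τ + energyConst τ + (c + 1) * ν := by positivity
    linarith)
  have bE2 : 3 / τ * E ≤ F := mul_le_mul_of_nonneg_right (by
    have : 0 ≤ energyConst τ + (c + 1) * ν := by positivity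
    linarith) hE
  have bE3 : energyConst τ * E ≤ F := mul_le_mul_of_nonneg_right (by
    have : 0 ≤ 3 / τ + (c + 1) * ν := by positivity
    linarith) hE
  have bM1 : c * ν * M ^ 2 ≤ K := mul_le_mul_of_nonneg_right (by
    have : 0 ≤ 3 / τ := by positivity
    linarith) (sq_nonneg M)
  have bM2 : ν * M ^ 2 ≤ K := mul_le_mul_of_nonneg_right (by
    have : 0 ≤ 3 / τ := by positivity
    have : 0 ≤ c * ν := by positivity
    linarith) (sq_nonneg M)
  have hFK : F + K = b * (E + M ^ 2) := by rw [hF, hK]; ring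
  have hEM : 0 ≤ E + M ^ 2 := by positivity
  have hle : ∀ Q : ℝ, Q ≤ Q₁ + Q₂ + Q₃ → Q * (F + K) ≤ (Q₁ + Q₂ + Q₃) * b * (E + M ^ 2) := by
    intro Q hQ
    rw [hFK, ← mul_assoc]
    gcongr
  have hz : ∀ n : ℕ, (2 : ℝ) ^ (-((n : ℤ) + 1)) = (1 / 2) ^ (n + 1) := zpow_neg_succ
  have hh1 : ∀ n : ℕ, ((1 : ℝ) / 2) ^ (n + 1) ≤ 1 := fun n =>
    pow_le_one₀ (by norm_num) (by norm_num)
  have hwt : ∀ n : ℕ, IsWeight (blockWeight P (-((n : ℤ) + 1))) _ := fun n =>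
    isWeight_block P (by rw [hz]; exact hh1 n)
  have hi : ∀ n : ℕ, √(wnormSq (blockWeight P (-((n : ℤ) + 1))) (𝓕 (v 0 + (τ : ℂ) • w 0))
      (𝓕 (u 0 + (τ : ℂ) • v 0)) (𝓕 (v 0))) ≤ ((1 / 2) ^ (n + 1)) ^ (3 / 2 : ℝ) * F := by
    intro n
    have h := block_initial_le hinit (-((n : ℤ) + 1))
    rw [(hwt n).eLpNorm_vlen (fun ξ => rfl), hz] at h
    exact (sqrt_le_of_eLpNorm (by positivity) h).trans (by gcongr)
  have hiw : ∀ n : ℕ, √(wnormSq₁ (blockWeight P (-((n : ℤ) + 1))) (𝓕 (w 0))) ≤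
      ((1 / 2) ^ (n + 1)) ^ (1 / 2 : ℝ) * F := by
    intro n
    have h := (block_w_le P hτ (u 0) (v 0) (w 0) (by rw [hz]; exact hh1 n)).trans
      (mul_le_mul_right (block_initial_le hinit (-((n : ℤ) + 1))) _)
    rw [(hwt n).eLpNorm_norm (fun ξ => rfl), hz, ← ENNReal.ofReal_mul (by positivity)] at h
    refine (sqrt_le_of_eLpNorm (by positivity) h).trans ?_
    have hx : (0 : ℝ) < (1 / 2) ^ (n + 1) := by positivity
    generalize ((1 : ℝ) / 2) ^ (n + 1) = x at *
    have e : x ^ (3 / 2 : ℝ) = x * x ^ (1 / 2 : ℝ) := by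
      rw [← Real.rpow_one_add' hx.le (by norm_num)]; norm_num
    calc 3 / τ * x⁻¹ * (x ^ (3 / 2 : ℝ) * E) = x ^ (1 / 2 : ℝ) * (3 / τ * E) := by
          rw [e]; field_simp
      _ ≤ _ := by gcongr
  have hn : ∀ n : ℕ, ∀ σ ∈ Icc 0 t, √(wnormSq₁ (blockWeight P (-((n : ℤ) + 1))) (𝓕 (N σ))) ≤
      ((1 / 2) ^ (n + 1)) ^ (3 / 2 : ℝ) * K * (1 + σ) ^ (-3 / 2 : ℝ) := by
    intro n σ hσ
    have hσ0 : 0 ≤ 1 + σ := by linarith [hσ.1]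
    have h := Hc P (-((n : ℤ) + 1)) (𝓕 (N σ)) (ν * M ^ 2 * (1 + σ) ^ (-3 / 2 : ℝ)) (by
      filter_upwards [enorm_fourier_nonlinearity_le_sq (hlt σ hσ) (hN σ hσ.1)] with ξ hξ
      exact hξ.trans (hsq σ hσ))
    rw [(hwt n).eLpNorm_norm (fun ξ => rfl), hz] at h
    refine (sqrt_le_of_eLpNorm (by positivity) h).trans ?_
    calc _ = ((1 / 2) ^ (n + 1)) ^ (3 / 2 : ℝ) * (c * ν * M ^ 2) * (1 + σ) ^ (-3 / 2 : ℝ) := by ring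
      _ ≤ _ := by gcongr
  refine ⟨fun n => ?_, fun n => ?_, eLpNorm_high_le_of_forall (aesm_vlen τ _ _ _) fun R => ?_⟩
  · rw [(hwt n).eLpNorm_vlen (fun ξ => rfl)]
    refine ENNReal.ofReal_le_ofReal ((H₁ P (hz n) (hh1 n) hsol ht hF0 hK0 (hi n) (hn n)).trans ?_)
    exact mul_le_mul_of_nonneg_right (hle Q₁ (by linarith))
      (mul_nonneg (by positivity) (profile_nonneg (by linarith)))
  · rw [(hwt n).eLpNorm_norm (fun ξ => rfl)]
    refine ENNReal.ofReal_le_ofReal ((H₂ P (hz n) (hh1 n) hsol hw' hwe ht hF0 hK0 (hi n) (hiw n)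
      (hn n)).trans ?_)
    exact mul_le_mul_of_nonneg_right (hle Q₂ (by linarith))
      (add_nonneg (by positivity) (mul_nonneg (by positivity) (profile_nonneg (by linarith))))
  · rw [(isWeight_high R).eLpNorm_vlen (highSym_sq R)]
    refine ENNReal.ofReal_le_ofReal ((H₃ hsol ht hF0 hK0 ?_ fun σ hσ => ?_).trans ?_)
    · have h : eLpNorm (fun ξ => highSym R ξ * vlen τ (u 0) (v 0) (w 0) ξ) 2 volume ≤
          ENNReal.ofReal (energyConst τ * E) := by
        rw [ENNReal.ofReal_mul hec.le]
        refine le_trans ?_ ((sobSize_le_energyNorm P τ (u 0) (v 0) (w 0) hτ).trans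
          (mul_le_mul_right (le_self_add.trans hinit) _))
        refine eLpNorm_mono_ae ?_
        filter_upwards [vlen_le_ampl τ (u 0) (v 0) (w 0)] with ξ hξ
        have h1 := vlen_nonneg τ (u 0) (v 0) (w 0) ξ
        have h2 := highSym_nonneg R ξ
        rw [Real.norm_of_nonneg (by positivity),
          Real.norm_of_nonneg (mul_nonneg (by positivity) (h1.trans hξ))]
        exact mul_le_mul (highSym_le R ξ) hξ h1 (by positivity)
      rw [(isWeight_high R).eLpNorm_vlen (highSym_sq R)] at h
      exact (sqrt_le_of_eLpNorm (by positivity) h).trans bE3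
    · have hσ0 : 0 ≤ 1 + σ := by linarith [hσ.1]
      have h : eLpNorm (fun ξ => highSym R ξ * ‖(𝓕 (N σ) : L2) ξ‖) 2 volume ≤
          ENNReal.ofReal (ν * M ^ 2 * (1 + σ) ^ (-3 / 2 : ℝ)) := by
        refine le_trans ?_ ((eLpNorm_nonlinearity_le (hlt σ hσ) (hN σ hσ.1)).trans (hsq σ hσ))
        refine eLpNorm_mono fun ξ => ?_
        have h2 := highSym_nonneg R ξ
        rw [Real.norm_of_nonneg (by positivity), Real.norm_of_nonneg (by positivity)]
        gcongr
        exact highSym_le R ξ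
      rw [(isWeight_high R).eLpNorm_norm (highSym_sq R)] at h
      exact (sqrt_le_of_eLpNorm (by positivity) h).trans (by gcongr)
    · exact mul_le_mul_of_nonneg_right (hle Q₃ (by linarith)) (by positivity)

/-! ### Summation over the dyadic blocks -/

lemma sum_sqrt_half_pow_le (N : ℕ) :
    ∑ n ∈ Finset.range N, (((1 : ℝ) / 2) ^ (n + 1)) ^ (1 / 2 : ℝ) ≤ 3 := by
  have h : ∀ N : ℕ, ∑ n ∈ Finset.range N, ((3 : ℝ) / 4) ^ (n + 1) = 3 - 3 * (3 / 4) ^ N := by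
    intro N
    induction N with
    | zero => simp
    | succ k ih => rw [Finset.sum_range_succ, ih]; ring
  calc _ ≤ ∑ n ∈ Finset.range N, ((3 : ℝ) / 4) ^ (n + 1) := by
        refine Finset.sum_le_sum fun n _ => ?_
        rw [← Real.sqrt_eq_rpow]
        refine Real.sqrt_le_iff.2 ⟨by positivity, ?_⟩
        rw [← pow_mul, mul_comm, pow_mul]
        gcongr
        norm_num
    _ ≤ 3 := by
        rw [h]
        have : (0 : ℝ) < (3 / 4) ^ N := by positivity
        linarith

lemma half_pow_rpow_mul (n : ℕ) (s r : ℝ) : (((1 : ℝ) / 2) ^ (n + 1)) ^ s *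
    (((1 : ℝ) / 2) ^ (n + 1)) ^ r = (((1 : ℝ) / 2) ^ (n + 1)) ^ (s + r) :=
  (Real.rpow_add (by positivity) _ _).symm

/-- The sum over the low-frequency blocks with the weight `h^s`: the rate is `(1 + t)^{-3/4 - s/2}`. -/
lemma tsum_profile_le {s D T : ℝ} (h0 : 0 ≤ s) (h1 : s ≤ 3 / 2) (hD : 0 ≤ D) (hT : 1 ≤ T) :
    ∑' n : ℕ, ENNReal.ofReal ((((1 : ℝ) / 2) ^ (n + 1)) ^ s *
      (D * (((1 / 2) ^ (n + 1)) ^ (3 / 2 : ℝ) * profile ((1 / 2) ^ (n + 1)) T))) ≤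
      ENNReal.ofReal (D * (7 * T ^ (-3 / 4 - s / 2))) := by
  refine ENNReal.tsum_le_of_sum_range_le fun N => ?_
  have hp : ∀ n : ℕ, 0 ≤ profile ((1 / 2) ^ (n + 1)) T := fun n => profile_nonneg (by linarith)
  rw [← ENNReal.ofReal_sum_of_nonneg fun n _ =>
    mul_nonneg (by positivity) (mul_nonneg hD (mul_nonneg (by positivity) (hp n)))]
  refine ENNReal.ofReal_le_ofReal ?_
  have h := sum_profile_le (σ := s + 3 / 2) (by linarith) (by linarith) hT N
  rw [show -(s + 3 / 2) / 2 = -3 / 4 - s / 2 by ring] at h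
  refine le_trans (le_of_eq ?_) (mul_le_mul_of_nonneg_left h hD)
  rw [Finset.mul_sum]
  refine Finset.sum_congr rfl fun n _ => ?_
  rw [← half_pow_rpow_mul]
  ring

lemma tsum_profile_w_le {s D T e : ℝ} (h0 : 0 ≤ s) (h1 : s ≤ 3 / 2) (hD : 0 ≤ D) (hT : 1 ≤ T)
    (he : 0 ≤ e) :
    ∑' n : ℕ, ENNReal.ofReal ((((1 : ℝ) / 2) ^ (n + 1)) ^ s * (D *
      (e * ((1 / 2) ^ (n + 1)) ^ (1 / 2 : ℝ) +
        ((1 / 2) ^ (n + 1)) ^ (3 / 2 : ℝ) * profile ((1 / 2) ^ (n + 1)) T))) ≤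
      ENNReal.ofReal (D * (3 * e + 7 * T ^ (-3 / 4 - s / 2))) := by
  have hp : ∀ n : ℕ, 0 ≤ profile ((1 / 2) ^ (n + 1)) T := fun n => profile_nonneg (by linarith)
  have hT0 : 0 < T := by linarith
  rw [mul_add, ENNReal.ofReal_add (by positivity) (by positivity)]
  have hA : ∑' n : ℕ, ENNReal.ofReal (D * e * ((((1 : ℝ) / 2) ^ (n + 1)) ^ s *
      ((1 / 2) ^ (n + 1)) ^ (1 / 2 : ℝ))) ≤ ENNReal.ofReal (D * (3 * e)) := by
    refine ENNReal.tsum_le_of_sum_range_le fun N => ?_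
    rw [← ENNReal.ofReal_sum_of_nonneg fun n _ => by positivity]
    refine ENNReal.ofReal_le_ofReal ?_
    rw [← Finset.mul_sum, mul_comm 3, ← mul_assoc]
    gcongr
    refine le_trans (Finset.sum_le_sum fun n _ => ?_) (sum_sqrt_half_pow_le N)
    have h3 : (((1 : ℝ) / 2) ^ (n + 1)) ^ s ≤ 1 :=
      Real.rpow_le_one (by positivity) (pow_le_one₀ (by norm_num) (by norm_num)) h0
    exact mul_le_of_le_one_left (by positivity) h3
  refine le_trans ?_ (add_le_add hA (tsum_profile_le h0 h1 hD hT))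
  · rw [← ENNReal.tsum_add]
    refine ENNReal.tsum_le_tsum fun n => ?_
    have e1 : (((1 : ℝ) / 2) ^ (n + 1)) ^ s * (D *
      (e * ((1 / 2) ^ (n + 1)) ^ (1 / 2 : ℝ) +
        ((1 / 2) ^ (n + 1)) ^ (3 / 2 : ℝ) * profile ((1 / 2) ^ (n + 1)) T)) =
      D * e * ((((1 : ℝ) / 2) ^ (n + 1)) ^ s * ((1 / 2) ^ (n + 1)) ^ (1 / 2 : ℝ)) +
      (((1 : ℝ) / 2) ^ (n + 1)) ^ s * (D * (((1 / 2) ^ (n + 1)) ^ (3 / 2 : ℝ) *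
        profile ((1 / 2) ^ (n + 1)) T)) := by ring
    rw [e1, ENNReal.ofReal_add (by positivity)
      (mul_nonneg (by positivity) (mul_nonneg hD (mul_nonneg (by positivity) (hp n))))]

/-- At low frequencies a function is recovered from its blocks of negative index. -/
lemma eLpNorm_low_le (P : LittlewoodPaley) {G : E3 → ℝ} (hG : AEStronglyMeasurable G volume) :
    eLpNorm ({ξ | freq ξ < 1 / 2}.indicator G) 2 volume ≤
      ∑' n : ℕ, eLpNorm (fun ξ => blockSym P (-((n : ℤ) + 1)) ξ * G ξ) 2 volume := by
  refine eLpNorm_le_tsum (fun n => (continuous_blockSym P _).aestronglyMeasurable.mul hG) ?_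
  filter_upwards [ae_ne_zero] with ξ hξ
  by_cases h : freq ξ < 1 / 2
  · rw [indicator_of_mem (by exact h)]
    simp only [enorm_mul]
    rw [ENNReal.tsum_mul_right]
    exact le_mul_of_one_le_left zero_le (one_le_tsum_blockSym P hξ h)
  · rw [indicator_of_notMem (by exact h)]
    simp

lemma exp_damping_le {τ t : ℝ} (hτ : 0 < τ) (ht : 0 ≤ t) :
    Real.exp (-(1 / τ) * t / 2) ≤ (8 + 16 * τ ^ 2) * (1 + t) ^ (-3 / 2 : ℝ) := by
  have := exp_neg_mul_le_rpow (c := 1 / (2 * τ)) (t := t) (by positivity) ht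
  have e : 4 / (1 / (2 * τ)) ^ 2 = 16 * τ ^ 2 := by field_simp; norm_num
  rw [e] at this
  rwa [show -(1 / τ) * t / 2 = -(1 / (2 * τ) * t) by field_simp]

section

variable {P : LittlewoodPaley} {τ D t : ℝ} {u v w : L2}

lemma FreqDecay.low_le (h : FreqDecay P τ D t u v w) (hD : 0 ≤ D) (ht : 0 ≤ t) :
    eLpNorm ({ξ | freq ξ < 1 / 2}.indicator (vlen τ u v w)) 2 volume ≤
      ENNReal.ofReal (D * (7 * (1 + t) ^ (-3 / 4 : ℝ))) := by
  refine (eLpNorm_low_le P (aesm_vlen τ u v w)).trans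
    ((ENNReal.tsum_le_tsum h.block).trans ?_)
  have := tsum_profile_le (s := 0) le_rfl (by norm_num) hD (T := 1 + t) (by linarith)
  simpa using this

lemma FreqDecay.low_w_le (h : FreqDecay P τ D t u v w) (hD : 0 ≤ D) (ht : 0 ≤ t) :
    eLpNorm ({ξ | freq ξ < 1 / 2}.indicator fun ξ => ‖(𝓕 w : L2) ξ‖) 2 volume ≤
      ENNReal.ofReal (D * (3 * Real.exp (-(1 / τ) * t / 2) + 7 * (1 + t) ^ (-3 / 4 : ℝ))) := by
  refine (eLpNorm_low_le P (aesm_norm_fourier w)).trans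
    ((ENNReal.tsum_le_tsum h.block_w).trans ?_)
  have := tsum_profile_w_le (s := 0) le_rfl (by norm_num) hD (T := 1 + t) (by linarith)
    (Real.exp_pos (-(1 / τ) * t / 2)).le
  simpa using this

/-- The constant in the decay of the Sobolev size. -/
noncomputable def sobConst (τ : ℝ) : ℝ := 6 * 7 + 2 * (3 * (8 + 16 * τ ^ 2) + 7) + (15 + 15 / τ)

/-- The frequency-localised decay implies the decay of the Sobolev size. -/
lemma FreqDecay.sobSize_le (h : FreqDecay P τ D t u v w) (hτ : 0 < τ) (hD : 0 ≤ D) (ht : 0 ≤ t) :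
    sobSize τ u v w ≤ ENNReal.ofReal (sobConst τ * D * (1 + t) ^ (-3 / 4 : ℝ)) := by
  set lo := {ξ : E3 | freq ξ < 1 / 2} with hlo
  set hi := {ξ : E3 | 1 / 2 ≤ freq ξ} with hhi
  have hlom : MeasurableSet lo := measurableSet_lt continuous_freq.measurable measurable_const
  have hhim : MeasurableSet hi := measurableSet_freq_ge _
  set g : Fin 3 → E3 → ℝ := ![fun ξ => 6 * lo.indicator (vlen τ u v w) ξ,
    fun ξ => 2 * lo.indicator (fun ξ => ‖(𝓕 w : L2) ξ‖) ξ,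
    fun ξ => (15 + 15 / τ) * hi.indicator (fun ξ => freq ξ ^ 2 * vlen τ u v w ξ) ξ] with hg
  have hgm : ∀ i, AEStronglyMeasurable (g i) volume := by
    intro i
    fin_cases i
    · exact ((aesm_vlen τ u v w).indicator hlom).const_mul _
    · exact ((aesm_norm_fourier w).indicator hlom).const_mul _
    · exact (((continuous_freq.pow 2).aestronglyMeasurable.mul
        (aesm_vlen τ u v w)).indicator hhim).const_mul _
  have hT0 : 0 < 1 + t := by linarith
  have key : sobSize τ u v w ≤ ∑' i, eLpNorm (g i) 2 volume := by
    refine eLpNorm_le_tsum hgm ?_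
    filter_upwards [ampl_le_vlen τ u v w, norm_fourier_w_le τ u v w hτ] with ξ e1 e2
    have hk0 := freq_nonneg ξ
    have hV := vlen_nonneg τ u v w ξ
    have hA := ampl_nonneg τ u v w ξ
    rw [tsum_fintype, Fin.sum_univ_three]
    change _ ≤ ‖6 * lo.indicator (vlen τ u v w) ξ‖ₑ +
      ‖2 * lo.indicator (fun ξ => ‖(𝓕 w : L2) ξ‖) ξ‖ₑ +
      ‖(15 + 15 / τ) * hi.indicator (fun ξ => freq ξ ^ 2 * vlen τ u v w ξ) ξ‖ₑ
    by_cases hξ : freq ξ < 1 / 2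
    · rw [indicator_of_mem (by exact hξ), indicator_of_mem (by exact hξ),
        indicator_of_notMem (by simpa [hhi] using hξ), mul_zero, enorm_zero, add_zero,
        Real.enorm_of_nonneg (by positivity), Real.enorm_of_nonneg (by positivity),
        Real.enorm_of_nonneg (by positivity), ← ENNReal.ofReal_add (by positivity) (by positivity)]
      refine ENNReal.ofReal_le_ofReal ?_
      have : freq ξ ^ 2 ≤ 1 := pow_le_one₀ hk0 (by linarith)
      nlinarith [norm_nonneg ((𝓕 w : L2) ξ)]
    · have hξ' : 1 / 2 ≤ freq ξ := not_lt.1 hξ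
      rw [indicator_of_notMem (by exact hξ), indicator_of_notMem (by exact hξ),
        indicator_of_mem (by exact hξ'), mul_zero, mul_zero, enorm_zero, zero_add, zero_add]
      refine enorm_mono_real (by positivity) ?_
      have e3 := e2 hξ'
      have e4 : 1 + freq ξ ^ 2 ≤ 5 * freq ξ ^ 2 := by nlinarith
      calc (1 + freq ξ ^ 2) * ampl τ u v w ξ
          ≤ 5 * freq ξ ^ 2 * (3 * vlen τ u v w ξ + 3 / τ * vlen τ u v w ξ) := by
            gcongr
            linarith
        _ = _ := by ring
  refine key.trans ?_
  rw [tsum_fintype, Fin.sum_univ_three]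
  change eLpNorm (fun ξ => 6 * lo.indicator (vlen τ u v w) ξ) 2 volume +
      eLpNorm (fun ξ => 2 * lo.indicator (fun ξ => ‖(𝓕 w : L2) ξ‖) ξ) 2 volume +
      eLpNorm (fun ξ => (15 + 15 / τ) * hi.indicator (fun ξ => freq ξ ^ 2 * vlen τ u v w ξ) ξ) 2
        volume ≤ _
  rw [eLpNorm_const_mul_real (by norm_num), eLpNorm_const_mul_real (by norm_num),
    eLpNorm_const_mul_real (by positivity)]
  have hexp := exp_damping_le hτ ht
  have hmono : (1 + t) ^ (-3 / 2 : ℝ) ≤ (1 + t) ^ (-3 / 4 : ℝ) :=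
    Real.rpow_le_rpow_of_exponent_le (by linarith) (by norm_num)
  have hTp : 0 ≤ (1 + t) ^ (-3 / 4 : ℝ) := by positivity
  have hexp' : Real.exp (-(1 / τ) * t / 2) ≤ (8 + 16 * τ ^ 2) * (1 + t) ^ (-3 / 4 : ℝ) :=
    hexp.trans (by gcongr)
  calc _ ≤ ENNReal.ofReal 6 * ENNReal.ofReal (D * (7 * (1 + t) ^ (-3 / 4 : ℝ))) +
        ENNReal.ofReal 2 * ENNReal.ofReal (D * (3 * Real.exp (-(1 / τ) * t / 2) +
          7 * (1 + t) ^ (-3 / 4 : ℝ))) +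
        ENNReal.ofReal (15 + 15 / τ) * ENNReal.ofReal (D * (1 + t) ^ (-3 / 2 : ℝ)) := by
        gcongr
        · exact h.low_le hD ht
        · exact h.low_w_le hD ht
        · exact h.high
    _ = ENNReal.ofReal (6 * (D * (7 * (1 + t) ^ (-3 / 4 : ℝ))) +
        2 * (D * (3 * Real.exp (-(1 / τ) * t / 2) + 7 * (1 + t) ^ (-3 / 4 : ℝ))) +
        (15 + 15 / τ) * (D * (1 + t) ^ (-3 / 2 : ℝ))) := by
        have := (Real.exp_pos (-(1 / τ) * t / 2)).le
        rw [← ENNReal.ofReal_mul (by positivity), ← ENNReal.ofReal_mul (by positivity),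
          ← ENNReal.ofReal_mul (by positivity), ← ENNReal.ofReal_add (by positivity)
          (by positivity), ← ENNReal.ofReal_add (by positivity) (by positivity)]
    _ ≤ _ := by
        refine ENNReal.ofReal_le_ofReal ?_
        calc _ ≤ 6 * (D * (7 * (1 + t) ^ (-3 / 4 : ℝ))) +
            2 * (D * (3 * ((8 + 16 * τ ^ 2) * (1 + t) ^ (-3 / 4 : ℝ)) +
              7 * (1 + t) ^ (-3 / 4 : ℝ))) + (15 + 15 / τ) * (D * (1 + t) ^ (-3 / 4 : ℝ)) := by
              gcongr
          _ = _ := by unfold sobConst; ring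

end

/-! ### The bootstrap argument -/

/-- A continuous function with `y t ≤ C (E + M²)` whenever `y ≤ M` on `[0, t]` stays small if `E` is
small. -/
lemma bootstrap_le {y : ℝ → ℝ} (hy : ContinuousOn y (Ici 0)) {C E : ℝ} (hC : 0 < C) (hE : 0 ≤ E)
    (hE' : E ≤ 1 / (8 * C ^ 2)) (h0 : y 0 ≤ C * E)
    (h : ∀ t M, 0 ≤ t → 0 ≤ M → (∀ σ ∈ Icc 0 t, y σ ≤ M) → y t ≤ C * (E + M ^ 2)) {t : ℝ}
    (ht : 0 ≤ t) : y t ≤ 2 * C * E := by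
  have hCE : C * (C * E) ≤ 1 / 8 := by
    rw [le_div_iff₀ (by positivity)] at hE'
    nlinarith
  -- At the first time with `y = K`, the hypothesis gives `K ≤ C E + (C K) K ≤ C E + K / 2 < K`.
  have key : ∀ K, 2 * C * E < K → C * K ≤ 1 / 2 → y t < K := by
    intro K hK1 hK2
    have hCE0 : 0 ≤ C * E := by positivity
    have hK0 : 0 < K := by linarith
    by_contra! hlt
    have hcpt : IsCompact {s ∈ Icc 0 t | K ≤ y s} := by
      have : {s ∈ Icc 0 t | K ≤ y s} = Icc 0 t ∩ y ⁻¹' Ici K := rfl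
      rw [this]
      exact isCompact_Icc.of_isClosed_subset ((hy.mono
        Icc_subset_Ici_self).preimage_isClosed_of_isClosed isClosed_Icc isClosed_Ici)
        inter_subset_left
    obtain ⟨s, ⟨hs, hsK⟩, hmin⟩ := hcpt.exists_isLeast ⟨t, ⟨ht, le_rfl⟩, hlt⟩
    obtain ⟨c, hc, hcK⟩ := intermediate_value_Icc hs.1 (hy.mono Icc_subset_Ici_self)
      (show K ∈ Icc (y 0) (y s) from ⟨by linarith, hsK⟩)
    have hcs : s ≤ c := hmin ⟨⟨hc.1, hc.2.trans hs.2⟩, hcK.ge⟩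
    have hcs' : c = s := le_antisymm hc.2 hcs
    rw [hcs'] at hcK
    have := h s K hs.1 hK0.le fun σ hσ => by
      by_contra! hσK
      have : σ = s := le_antisymm hσ.2 (hmin ⟨⟨hσ.1, hσ.2.trans hs.2⟩, hσK.le⟩)
      rw [this, hcK] at hσK
      exact lt_irrefl _ hσK
    nlinarith
  refine le_of_forall_pos_le_add fun ε hε => ?_
  refine (key (2 * C * E + min ε (1 / (8 * C))) (by have : 0 < min ε (1 / (8 * C)) := by positivity
                                                    linarith) ?_).le.trans ?_
  · have : C * min ε (1 / (8 * C)) ≤ 1 / 8 := by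
      calc C * min ε (1 / (8 * C)) ≤ C * (1 / (8 * C)) := by gcongr; exact min_le_right _ _
        _ = 1 / 8 := by field_simp
    nlinarith
  · gcongr
    exact min_le_left _ _

/-- Small global solutions have the frequency-localised decay. -/
theorem exists_freqDecay_of_small {τ β : ℝ} (κ : ℝ) (hτ : 0 < τ) (hβ : τ < β) :
    ∃ δ Q : ℝ, 0 < δ ∧ 0 < Q ∧ ∀ {P : LittlewoodPaley} {u₀ u₁ u₂ : L2} {u v w : ℝ → L2},
      IsGlobalSolution P τ β κ u₀ u₁ u₂ u v w → ∀ {E : ℝ}, 0 ≤ E → E ≤ δ →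
        initialSize P τ u₀ u₁ u₂ ≤ ENNReal.ofReal E → ∀ {t : ℝ}, 0 ≤ t →
          FreqDecay P τ (Q * E) t (u t) (v t) (w t) := by
  obtain ⟨Q, hQ, H⟩ := exists_freqDecay κ hτ hβ
  have hs0 : 0 < sobConst τ := by unfold sobConst; positivity
  have he0 : 0 < energyConst τ := by unfold energyConst; positivity
  set C := sobConst τ * Q + energyConst τ with hC
  have hC0 : 0 < C := by positivity
  -- The smallness needed for the bootstrap argument, applied to `(1 + t)^{3/4}` times the size.
  refine ⟨1 / (8 * C ^ 2), Q * 2, by positivity, by positivity, ?_⟩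
  intro P u₀ u₁ u₂ u v w hs E hE hEδ hinit t ht
  obtain ⟨hfin, hcont⟩ := continuousOn_sobSize hτ hs.2.2.2.1.1
  set y : ℝ → ℝ := fun t => (1 + t) ^ (3 / 4 : ℝ) * (sobSize τ (u t) (v t) (w t)).toReal with hy
  have hyc : ContinuousOn y (Ici 0) := by
    refine ContinuousOn.mul (fun t ht => ?_) hcont
    exact (ContinuousAt.rpow_const (by fun_prop)
      (Or.inl (by have : (0 : ℝ) ≤ t := ht
                  positivity))).continuousWithinAt
  have hyM : ∀ {σ M : ℝ}, 0 ≤ σ → y σ ≤ M →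
      sobSize τ (u σ) (v σ) (w σ) ≤ ENNReal.ofReal (M * (1 + σ) ^ (-3 / 4 : ℝ)) := by
    intro σ M hσ h
    rw [← ENNReal.ofReal_toReal (hfin σ hσ).ne]
    refine ENNReal.ofReal_le_ofReal ?_
    have hx : 0 < (1 + σ) ^ (3 / 4 : ℝ) := by positivity
    rw [show (-3 / 4 : ℝ) = -(3 / 4) by norm_num, Real.rpow_neg (by linarith),
      ← div_eq_mul_inv, le_div_iff₀ hx, mul_comm]
    exact h
  have hyD : ∀ {σ D : ℝ}, 0 ≤ σ → 0 ≤ D → sobSize τ (u σ) (v σ) (w σ) ≤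
      ENNReal.ofReal (D * (1 + σ) ^ (-3 / 4 : ℝ)) → y σ ≤ D := by
    intro σ D hσ hD h
    have h2 := ENNReal.toReal_le_of_le_ofReal (by positivity) h
    have hx : 0 < (1 + σ) ^ (3 / 4 : ℝ) := by positivity
    rw [show (-3 / 4 : ℝ) = -(3 / 4) by norm_num, Real.rpow_neg (by linarith),
      ← div_eq_mul_inv, le_div_iff₀ hx, mul_comm] at h2
    exact h2
  have hy0 : y 0 ≤ C * E := by
    refine hyD le_rfl (by positivity) ?_
    obtain ⟨hu0, hv0, hw0, -, -⟩ := hs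
    rw [hu0, hv0, hw0]
    refine (sobSize_le_energyNorm P τ u₀ u₁ u₂ hτ).trans
      ((mul_le_mul_right (le_self_add.trans hinit) _).trans ?_)
    rw [← ENNReal.ofReal_mul he0.le]
    refine ENNReal.ofReal_le_ofReal ?_
    have : 0 ≤ sobConst τ * Q * E := by positivity
    simp only [add_zero, Real.one_rpow, hC]
    linarith
  have hstep : ∀ t M, 0 ≤ t → 0 ≤ M → (∀ σ ∈ Icc 0 t, y σ ≤ M) → y t ≤ C * (E + M ^ 2) := by
    intro t M ht hM h
    have h1 := H hs ht hE hM hinit fun σ hσ => hyM hσ.1 (h σ hσ)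
    refine hyD ht (by positivity) ((h1.sobSize_le hτ (by positivity) ht).trans ?_)
    refine ENNReal.ofReal_le_ofReal (mul_le_mul_of_nonneg_right ?_ (by positivity))
    have : 0 ≤ energyConst τ * (E + M ^ 2) := by positivity
    rw [hC]; linarith
  have hb : ∀ σ, 0 ≤ σ → y σ ≤ 2 * C * E := fun σ hσ =>
    bootstrap_le hyc hC0 hE hEδ hy0 hstep hσ
  -- With `M = 2 C E`, the bound `M² ≤ E` holds as `E ≤ 1 / (8 C²)`.
  refine (H hs ht hE (by positivity) hinit fun σ hσ => hyM hσ.1 (hb σ hσ.1)).mono ht ?_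
  rw [mul_assoc Q 2 E]
  refine mul_le_mul_of_nonneg_left ?_ hQ.le
  rw [le_div_iff₀ (by positivity)] at hEδ
  nlinarith [mul_le_mul_of_nonneg_left hEδ hE]

/-! ### Besov norms of frequency-localised quantities -/

lemma weight_mono {q : ℕ} {s r : ℝ} (h : s ≤ r) : weight (q : ℤ) s ≤ weight (q : ℤ) r := by
  rw [weight_eq, weight_eq]
  refine ENNReal.ofReal_le_ofReal (Real.rpow_le_rpow_of_exponent_le ?_ h)
  rw [zpow_natCast]
  exact one_le_pow₀ (by norm_num)

lemma weight_neg_succ (n : ℕ) (s : ℝ) :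
    weight (-((n : ℤ) + 1)) s = ENNReal.ofReal (((1 / 2) ^ (n + 1)) ^ s) := by
  rw [weight_eq, zpow_neg_succ]

/-- At high frequencies, half a derivative makes the sum over the blocks converge. -/
lemma tsum_high_le (P : LittlewoodPaley) {f : E3 → ℝ} :
    ∑' q : ℕ, weight (q : ℤ) (3 / 2) * eLpNorm (fun ξ => blockSym P (q : ℤ) ξ * f ξ) 2 volume ≤
      8 * eLpNorm ({ξ | 1 / 2 ≤ freq ξ}.indicator fun ξ => freq ξ ^ 2 * f ξ) 2 volume := by
  set Y := eLpNorm ({ξ | 1 / 2 ≤ freq ξ}.indicator fun ξ => freq ξ ^ 2 * f ξ) 2 volume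
  have h1 : ∀ q : ℕ, weight (q : ℤ) (3 / 2) *
      eLpNorm (fun ξ => blockSym P (q : ℤ) ξ * f ξ) 2 volume ≤
      ENNReal.ofReal (8 / 3 * (((1 : ℝ) / 2) ^ (q + 1)) ^ (1 / 2 : ℝ)) * Y := by
    intro q
    have hx1 : (1 : ℝ) ≤ 2 ^ q := one_le_pow₀ (by norm_num)
    have hx0 : (0 : ℝ) < 2 ^ q := by positivity
    have h2 : eLpNorm (fun ξ => blockSym P (q : ℤ) ξ * f ξ) 2 volume ≤
        ENNReal.ofReal (16 / 9 * (((2 : ℝ) ^ q) ^ 2)⁻¹) * Y := by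
      rw [← eLpNorm_const_mul_real (by positivity)]
      refine eLpNorm_mono fun ξ => ?_
      by_cases h0 : blockSym P (q : ℤ) ξ = 0
      · rw [h0, zero_mul, norm_zero]; exact norm_nonneg _
      have hs := (blockSym_supp P h0).1
      rw [zpow_natCast] at hs
      have hmem : 1 / 2 ≤ freq ξ := by linarith
      rw [indicator_of_mem (by exact hmem), norm_mul (blockSym P _ ξ),
        norm_mul (16 / 9 * (((2 : ℝ) ^ q) ^ 2)⁻¹), norm_mul (freq ξ ^ 2),
        Real.norm_of_nonneg (blockSym_nonneg P _ ξ),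
        Real.norm_of_nonneg (show 0 ≤ 16 / 9 * (((2 : ℝ) ^ q) ^ 2)⁻¹ by positivity),
        Real.norm_of_nonneg (sq_nonneg (freq ξ)), ← mul_assoc]
      refine mul_le_mul_of_nonneg_right ?_ (norm_nonneg (f ξ))
      refine (blockSym_le_one P _ ξ).trans ?_
      rw [mul_assoc, inv_mul_eq_div, ← mul_div_assoc, le_div_iff₀ (by positivity)]
      nlinarith
    calc _ ≤ weight (q : ℤ) (3 / 2) * (ENNReal.ofReal (16 / 9 * (((2 : ℝ) ^ q) ^ 2)⁻¹) * Y) := by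
          gcongr
      _ = ENNReal.ofReal (((2 : ℝ) ^ q) ^ (3 / 2 : ℝ) * (16 / 9 * (((2 : ℝ) ^ q) ^ 2)⁻¹)) * Y := by
          rw [← mul_assoc, weight_eq, zpow_natCast,
            ENNReal.ofReal_mul (p := ((2 : ℝ) ^ q) ^ (3 / 2 : ℝ)) (by positivity)]
      _ ≤ _ := by
          refine mul_le_mul_left (ENNReal.ofReal_le_ofReal ?_) Y
          set x : ℝ := 2 ^ q
          have e1 : ((1 : ℝ) / 2) ^ (q + 1) = x⁻¹ * (1 / 2) := by rw [pow_succ, one_div, inv_pow]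
          rw [e1, Real.mul_rpow (by positivity) (by norm_num)]
          have e2 : x ^ (3 / 2 : ℝ) * (x ^ 2)⁻¹ = x⁻¹ ^ (1 / 2 : ℝ) := by
            rw [Real.inv_rpow hx0.le, ← Real.rpow_neg hx0.le, ← Real.rpow_two,
              ← Real.rpow_neg hx0.le, ← Real.rpow_add hx0]
            norm_num
          have e3 : 2 / 3 ≤ (1 / 2 : ℝ) ^ (1 / 2 : ℝ) := by
            rw [← Real.sqrt_eq_rpow]
            exact Real.le_sqrt_of_sq_le (by norm_num)
          calc x ^ (3 / 2 : ℝ) * (16 / 9 * (x ^ 2)⁻¹) =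
                8 / 3 * (x ^ (3 / 2 : ℝ) * (x ^ 2)⁻¹ * (2 / 3)) := by ring
            _ ≤ _ := by rw [e2]; gcongr
  refine (ENNReal.tsum_le_tsum h1).trans ?_
  rw [ENNReal.tsum_mul_right]
  gcongr
  refine ENNReal.tsum_le_of_sum_range_le fun N => ?_
  rw [← ENNReal.ofReal_sum_of_nonneg fun n _ => by positivity, ← Finset.mul_sum]
  have := sum_sqrt_half_pow_le N
  rw [show (8 : ℝ≥0∞) = ENNReal.ofReal 8 by simp]
  exact ENNReal.ofReal_le_ofReal (by linarith)

section

variable {P : LittlewoodPaley} {τ D t ℓ : ℝ} {u v w : L2}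

/-- On a dyadic block, `Λ^ℓ` costs at most the factor `2^{qℓ}`: the symbol is `|ξ|^ℓ` in the variable in
which the block is localised at `2π|ξ| ≤ (8/3) 2^q`. -/
lemma eLpNorm_block_lambda_le (P : LittlewoodPaley) (q : ℤ) (h0 : 0 ≤ ℓ) (f : E3 → ℝ) :
    eLpNorm (fun ξ => blockSym P q ξ * (‖ξ‖ ^ ℓ * f ξ)) 2 volume ≤
      ENNReal.ofReal (((2 : ℝ) ^ q) ^ ℓ) *
        eLpNorm (fun ξ => blockSym P q ξ * f ξ) 2 volume := by
  rw [← eLpNorm_const_mul_real (by positivity)]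
  refine eLpNorm_mono fun ξ => ?_
  by_cases hb : blockSym P q ξ = 0
  · simp [hb]
  have hs := (blockSym_supp P hb).2
  have hh : (0 : ℝ) < 2 ^ q := by positivity
  have h1 : ‖ξ‖ ≤ 2 ^ q := (norm_le_freq ξ).trans (by linarith)
  rw [mul_left_comm, norm_mul (‖ξ‖ ^ ℓ), norm_mul (((2 : ℝ) ^ q) ^ ℓ),
    Real.norm_of_nonneg (show 0 ≤ ‖ξ‖ ^ ℓ by positivity),
    Real.norm_of_nonneg (show 0 ≤ ((2 : ℝ) ^ q) ^ ℓ by positivity)]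
  gcongr

lemma FreqDecay.tsum_lambda_le (h : FreqDecay P τ D t u v w) (hD : 0 ≤ D) (ht : 0 ≤ t)
    (h0 : 0 ≤ ℓ) (h1 : ℓ ≤ 3 / 2) :
    ∑' n : ℕ, eLpNorm (fun ξ => blockSym P (-((n : ℤ) + 1)) ξ * (‖ξ‖ ^ ℓ * vlen τ u v w ξ)) 2
      volume ≤ ENNReal.ofReal (D * (7 * (1 + t) ^ (-3 / 4 - ℓ / 2))) := by
  refine le_trans (ENNReal.tsum_le_tsum fun n => ?_)
    (tsum_profile_le h0 h1 hD (T := 1 + t) (by linarith))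
  refine (eLpNorm_block_lambda_le P _ h0 _).trans ?_
  rw [zpow_neg_succ, ENNReal.ofReal_mul (by positivity)]
  gcongr
  exact h.block n

lemma FreqDecay.tsum_high_lambda_le (h : FreqDecay P τ D t u v w) (h0 : 0 ≤ ℓ) :
    ∑' q : ℕ, weight (q : ℤ) (3 / 2 - ℓ) *
      eLpNorm (fun ξ => blockSym P (q : ℤ) ξ * (‖ξ‖ ^ ℓ * vlen τ u v w ξ)) 2 volume ≤
      ENNReal.ofReal (D * (8 * (1 + t) ^ (-3 / 2 : ℝ))) := by
  have e : D * (8 * (1 + t) ^ (-3 / 2 : ℝ)) = 8 * (D * (1 + t) ^ (-3 / 2 : ℝ)) := by ring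
  rw [e, ENNReal.ofReal_mul (by norm_num), ENNReal.ofReal_ofNat]
  refine le_trans (ENNReal.tsum_le_tsum fun q => ?_)
    ((tsum_high_le P).trans (mul_le_mul_right h.high 8))
  refine (mul_le_mul_right (eLpNorm_block_lambda_le P _ h0 _) _).trans (le_of_eq ?_)
  rw [weight_eq, weight_eq, ← mul_assoc, ← ENNReal.ofReal_mul (by positivity),
    ← Real.rpow_add (by positivity), sub_add_cancel]

lemma rpow_le_rpow_lambda (ht : 0 ≤ t) (h1 : ℓ ≤ 3 / 2) :
    (1 + t) ^ (-3 / 2 : ℝ) ≤ (1 + t) ^ (-3 / 4 - ℓ / 2) :=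
  Real.rpow_le_rpow_of_exponent_le (by linarith) (by linarith)

lemma FreqDecay.low_lambda_le (h : FreqDecay P τ D t u v w) (hD : 0 ≤ D) (ht : 0 ≤ t)
    (h0 : 0 ≤ ℓ) (h1 : ℓ ≤ 3 / 2) :
    eLpNorm (fun ξ => lowSym P ξ * ‖ξ‖ ^ ℓ * vlen τ u v w ξ) 2 volume ≤
      ENNReal.ofReal (D * (11 * (1 + t) ^ (-3 / 4 - ℓ / 2))) := by
  set lo := {ξ : E3 | freq ξ < 1 / 2} with hlo
  set hi := {ξ : E3 | 1 / 2 ≤ freq ξ} with hhi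
  have hlom : MeasurableSet lo := measurableSet_lt continuous_freq.measurable measurable_const
  have hℓm : AEStronglyMeasurable (fun ξ : E3 => ‖ξ‖ ^ ℓ * vlen τ u v w ξ) volume :=
    (continuous_norm.rpow_const fun _ => Or.inr h0).aestronglyMeasurable.mul (aesm_vlen τ u v w)
  have hhm : AEStronglyMeasurable
      (fun ξ => 4 * hi.indicator (fun ξ => freq ξ ^ 2 * vlen τ u v w ξ) ξ) volume :=
    (((continuous_freq.pow 2).aestronglyMeasurable.mul
      (aesm_vlen τ u v w)).indicator (measurableSet_freq_ge _)).const_mul _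
  have key : eLpNorm (fun ξ => lowSym P ξ * ‖ξ‖ ^ ℓ * vlen τ u v w ξ) 2 volume ≤
      eLpNorm (lo.indicator fun ξ : E3 => ‖ξ‖ ^ ℓ * vlen τ u v w ξ) 2 volume +
      eLpNorm (fun ξ => 4 * hi.indicator (fun ξ => freq ξ ^ 2 * vlen τ u v w ξ) ξ) 2 volume := by
    refine le_trans (eLpNorm_mono_real fun ξ => ?_)
      (eLpNorm_add_le (hℓm.indicator hlom) hhm (by norm_num))
    have hV := vlen_nonneg τ u v w ξ
    have hχ0 := lowSym_nonneg P ξ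
    have hχ1 := lowSym_le_one P ξ
    have hk := freq_nonneg ξ
    rw [Real.norm_of_nonneg (by positivity), Pi.add_apply]
    by_cases hξ : freq ξ < 1 / 2
    · rw [indicator_of_mem (by exact hξ), indicator_of_notMem (by simpa [hhi] using hξ), mul_zero,
        add_zero]
      gcongr
      exact mul_le_of_le_one_left (by positivity) hχ1
    · have hξ' : 1 / 2 ≤ freq ξ := not_lt.1 hξ
      rw [indicator_of_notMem (by exact hξ), indicator_of_mem (by exact hξ'), zero_add, ← mul_assoc]
      by_cases hz : lowSym P ξ = 0
      · rw [hz, zero_mul, zero_mul]; positivity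
      have hs := lowSym_supp P hz
      have hn : ‖ξ‖ ^ ℓ ≤ 1 :=
        Real.rpow_le_one (norm_nonneg ξ) ((norm_le_freq ξ).trans (by linarith)) h0
      refine mul_le_mul_of_nonneg_right ?_ hV
      calc lowSym P ξ * ‖ξ‖ ^ ℓ ≤ 1 * 1 := by gcongr
        _ ≤ 4 * freq ξ ^ 2 := by nlinarith
  refine key.trans ?_
  rw [eLpNorm_const_mul_real (by norm_num)]
  calc _ ≤ ENNReal.ofReal (D * (7 * (1 + t) ^ (-3 / 4 - ℓ / 2))) +
        ENNReal.ofReal 4 * ENNReal.ofReal (D * (1 + t) ^ (-3 / 2 : ℝ)) := by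
        gcongr
        · exact (eLpNorm_low_le P hℓm).trans (h.tsum_lambda_le hD ht h0 h1)
        · exact h.high
    _ = ENNReal.ofReal (D * (7 * (1 + t) ^ (-3 / 4 - ℓ / 2)) +
        4 * (D * (1 + t) ^ (-3 / 2 : ℝ))) := by
        rw [← ENNReal.ofReal_mul (by norm_num), ← ENNReal.ofReal_add (by positivity) (by positivity)]
    _ ≤ _ := by
        refine ENNReal.ofReal_le_ofReal ?_
        have := mul_le_mul_of_nonneg_left (rpow_le_rpow_lambda ht h1) hD
        linarith

lemma FreqDecay.inhomBesov_le (h : FreqDecay P τ D t u v w) (hD : 0 ≤ D) (ht : 0 ≤ t)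
    (h0 : 0 ≤ ℓ) (h1 : ℓ ≤ 3 / 2) {W : Unit ⊕ Fin 3 ⊕ Fin 3 → TD}
    (hW : ∀ i, HasFourier (W i) (fun ξ => ((‖ξ‖ ^ ℓ : ℝ) : ℂ) * vecFourier τ u v w i ξ)) :
    inhomBesov P (3 / 2 - ℓ) W ≤ ENNReal.ofReal (D * (19 * (1 + t) ^ (-3 / 4 - ℓ / 2))) := by
  unfold inhomBesov
  have hlow : l2NormV (fun i => lowBlock P (W i)) =
      eLpNorm (fun ξ => lowSym P ξ * ‖ξ‖ ^ ℓ * vlen τ u v w ξ) 2 volume :=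
    l2NormV_multiplier τ u v w (g := fun ξ => lowSym P ξ * ‖ξ‖ ^ ℓ) fun i =>
      ((hW i).lowBlock P).congr (.of_forall fun ξ => by push_cast; ring)
  have hw1 : weight (-1) (3 / 2 - ℓ) ≤ 1 := by
    rw [weight_eq, ENNReal.ofReal_le_one]
    exact Real.rpow_le_one (by positivity) (by norm_num) (by linarith)
  rw [hlow]
  simp only [blockNorm_multiplier τ u v w P _ hW]
  calc _ ≤ 1 * ENNReal.ofReal (D * (11 * (1 + t) ^ (-3 / 4 - ℓ / 2))) +
        ENNReal.ofReal (D * (8 * (1 + t) ^ (-3 / 2 : ℝ))) :=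
        add_le_add (mul_le_mul' hw1 (h.low_lambda_le hD ht h0 h1)) (h.tsum_high_lambda_le h0)
    _ = ENNReal.ofReal (D * (11 * (1 + t) ^ (-3 / 4 - ℓ / 2)) +
        D * (8 * (1 + t) ^ (-3 / 2 : ℝ))) := by
        rw [one_mul, ENNReal.ofReal_add (by positivity) (by positivity)]
    _ ≤ _ := by
        refine ENNReal.ofReal_le_ofReal ?_
        have := mul_le_mul_of_nonneg_left (rpow_le_rpow_lambda ht h1) hD
        linarith

lemma FreqDecay.homBesov_le (h : FreqDecay P τ D t u v w) (hD : 0 ≤ D) (ht : 0 ≤ t)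
    {W : Unit ⊕ Fin 3 ⊕ Fin 3 → TD} (hW : ∀ i, HasFourier (W i)
      (fun ξ => ((‖ξ‖ ^ (3 / 2 : ℝ) : ℝ) : ℂ) * vecFourier τ u v w i ξ)) :
    homBesov P 0 W ≤ ENNReal.ofReal (D * (15 * (1 + t) ^ (-3 / 2 : ℝ))) := by
  unfold homBesov
  rw [tsum_int_eq]
  simp only [blockNorm_multiplier τ u v w P _ hW]
  have hhi := h.tsum_high_lambda_le (ℓ := 3 / 2) (by norm_num)
  have hlo := h.tsum_lambda_le hD ht (ℓ := 3 / 2) (by norm_num) le_rfl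
  have e0 : ∀ q : ℤ, weight q 0 = 1 := fun q => by simp [weight]
  rw [sub_self] at hhi
  rw [show (-3 / 4 - 3 / 2 / 2 : ℝ) = -3 / 2 by norm_num] at hlo
  refine (add_le_add hhi (le_of_eq_of_le ?_ hlo)).trans (le_of_eq ?_)
  · simp only [e0, one_mul]
  · rw [← ENNReal.ofReal_add (by positivity) (by positivity)]
    ring_nf

/-- The constant in the decay of `w`. -/
noncomputable def wConst (τ : ℝ) : ℝ := 3 * (8 + 16 * τ ^ 2) + 7 + 24 / τ

/-- At low frequencies the bound of `w` comes from its damped equation, and at high frequencies from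
`τ w = (v + τ w) - v`. -/
lemma FreqDecay.homBesov_w_le (h : FreqDecay P τ D t u v w) (hτ : 0 < τ) (hD : 0 ≤ D) (ht : 0 ≤ t)
    {s : ℝ} (h0 : 0 ≤ s) (h1 : s ≤ 3 / 2) :
    homBesov P s (sc (td w)) ≤
      ENNReal.ofReal (D * (wConst τ * (1 + t) ^ (-3 / 4 - s / 2))) := by
  unfold homBesov
  rw [tsum_int_eq]
  simp only [blockNorm_sc (hasFourier_td w)]
  have hlo : ∑' n : ℕ, weight (-((n : ℤ) + 1)) s *
      eLpNorm (fun ξ => blockSym P (-((n : ℤ) + 1)) ξ * ‖(𝓕 w : L2) ξ‖) 2 volume ≤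
      ENNReal.ofReal (D * (3 * Real.exp (-(1 / τ) * t / 2) + 7 * (1 + t) ^ (-3 / 4 - s / 2))) := by
    refine le_trans (ENNReal.tsum_le_tsum fun n => ?_) (tsum_profile_w_le h0 h1 hD (T := 1 + t)
      (by linarith) (Real.exp_pos (-(1 / τ) * t / 2)).le)
    rw [weight_neg_succ, ENNReal.ofReal_mul (by positivity)]
    gcongr
    exact h.block_w n
  have hhi : ∑' q : ℕ, weight (q : ℤ) s *
      eLpNorm (fun ξ => blockSym P (q : ℤ) ξ * ‖(𝓕 w : L2) ξ‖) 2 volume ≤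
      ENNReal.ofReal (3 / τ) * (8 * ENNReal.ofReal (D * (1 + t) ^ (-3 / 2 : ℝ))) := by
    refine le_trans ?_ (mul_le_mul_right ((tsum_high_le P).trans (mul_le_mul_right h.high 8)) _)
    rw [← ENNReal.tsum_mul_left]
    refine ENNReal.tsum_le_tsum fun q => ?_
    rw [mul_left_comm, ← eLpNorm_const_mul_real (by positivity)]
    refine mul_le_mul' (weight_mono h1) (eLpNorm_mono_ae ?_)
    filter_upwards [norm_fourier_w_le τ u v w hτ] with ξ hξ
    have hV := vlen_nonneg τ u v w ξ
    have hb0 := blockSym_nonneg P q ξ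
    rw [Real.norm_of_nonneg (by positivity), Real.norm_of_nonneg (by positivity), mul_left_comm]
    by_cases hb : blockSym P (q : ℤ) ξ = 0
    · simp [hb]
    have hs := (blockSym_supp P hb).1
    have hx1 : (1 : ℝ) ≤ 2 ^ (q : ℤ) := by rw [zpow_natCast]; exact one_le_pow₀ (by norm_num)
    gcongr
    exact hξ (by linarith)
  refine (add_le_add hhi hlo).trans ?_
  have e8 : (8 : ℝ≥0∞) = ENNReal.ofReal 8 := by simp
  rw [e8, ← ENNReal.ofReal_mul (by norm_num), ← ENNReal.ofReal_mul (by positivity),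
    ← ENNReal.ofReal_add (by positivity) (by positivity)]
  refine ENNReal.ofReal_le_ofReal ?_
  have r := rpow_le_rpow_lambda ht h1
  have hT : 0 < 1 + t := by linarith
  have hexp : Real.exp (-(1 / τ) * t / 2) ≤ (8 + 16 * τ ^ 2) * (1 + t) ^ (-3 / 4 - s / 2) :=
    (exp_damping_le hτ ht).trans (by gcongr)
  calc _ ≤ 3 / τ * (8 * (D * (1 + t) ^ (-3 / 4 - s / 2))) +
        D * (3 * ((8 + 16 * τ ^ 2) * (1 + t) ^ (-3 / 4 - s / 2)) +
          7 * (1 + t) ^ (-3 / 4 - s / 2)) := by gcongr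
    _ = _ := by unfold wConst; ring

end

end JMGT

open JMGT in
theorem theorem3p2 (P : LittlewoodPaley) (τ β A B : ℝ) (hτ : 0 < τ) (hβ : τ < β) (hA : A ≠ 0) :
    ∃ δ : ℝ, 0 < δ ∧ ∃ C : ℝ, 0 < C ∧
      ∀ u₀ u₁ u₂ : L2,
        inhomBesov P (7 / 2) (sc (td u₀)) < ∞ →
        inhomBesov P (7 / 2) (sc (td u₁)) < ∞ →
        inhomBesov P (5 / 2) (sc (td u₂)) < ∞ →
        initialSize P τ u₀ u₁ u₂ ≤ ENNReal.ofReal δ →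
          ∀ u v w : ℝ → L2, IsGlobalSolution P τ β (B / A) u₀ u₁ u₂ u v w →
            ∀ t : ℝ, 0 ≤ t →
              (∀ ℓ : ℝ, 0 ≤ ℓ → ℓ < 3 / 2 →
                ∃ W : Unit ⊕ Fin 3 ⊕ Fin 3 → TD,
                  (∀ i, IsLambda ℓ (vecV τ (u t) (v t) (w t) i) (W i)) ∧
                  inhomBesov P (3 / 2 - ℓ) W ≤
                    ENNReal.ofReal C * initialSize P τ u₀ u₁ u₂ *
                      ENNReal.ofReal ((1 + t) ^ (-3 / 4 - ℓ / 2))) ∧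
              (∃ W : Unit ⊕ Fin 3 ⊕ Fin 3 → TD,
                  (∀ i, IsLambda (3 / 2) (vecV τ (u t) (v t) (w t) i) (W i)) ∧
                  homBesov P 0 W ≤
                    ENNReal.ofReal C * initialSize P τ u₀ u₁ u₂ *
                      ENNReal.ofReal ((1 + t) ^ (-3 / 2 : ℝ))) ∧
              homBesov P (3 / 2) (sc (td (w t))) ≤
                ENNReal.ofReal C * initialSize P τ u₀ u₁ u₂ *
                      ENNReal.ofReal ((1 + t) ^ (-3 / 2 : ℝ)) ∧
              homBesov P 0 (sc (td (w t))) ≤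
                ENNReal.ofReal C * initialSize P τ u₀ u₁ u₂ *
                      ENNReal.ofReal ((1 + t) ^ (-3 / 4 : ℝ)) := by
  obtain ⟨δ, Q, hδ, hQ, H⟩ := exists_freqDecay_of_small (B / A) hτ hβ
  have hw0 : 0 < wConst τ := by unfold wConst; positivity
  refine ⟨δ, hδ, Q * (19 + wConst τ), by positivity, ?_⟩
  intro u₀ u₁ u₂ _ _ _ hinit u v w hs t ht
  set E := (initialSize P τ u₀ u₁ u₂).toReal with hE
  have hE0 : 0 ≤ E := ENNReal.toReal_nonneg
  have hEe : initialSize P τ u₀ u₁ u₂ = ENNReal.ofReal E :=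
    (ENNReal.ofReal_toReal (hinit.trans_lt (by simp)).ne).symm
  have hEδ : E ≤ δ := ENNReal.toReal_le_of_le_ofReal hδ.le hinit
  have hdec := H hs hE0 hEδ hEe.le ht
  have hfin := (continuousOn_sobSize hτ hs.2.2.2.1.1).1 t ht
  have hD : 0 ≤ Q * E := by positivity
  have hle : ∀ (c r : ℝ), c ≤ 19 + wConst τ → 0 ≤ r → ENNReal.ofReal (Q * E * (c * r)) ≤
      ENNReal.ofReal (Q * (19 + wConst τ)) * initialSize P τ u₀ u₁ u₂ * ENNReal.ofReal r := by
    intro c r hc hr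
    rw [hEe, ← ENNReal.ofReal_mul (by positivity), ← ENNReal.ofReal_mul (by positivity)]
    refine ENNReal.ofReal_le_ofReal ?_
    calc Q * E * (c * r) ≤ Q * E * ((19 + wConst τ) * r) := by gcongr
      _ = _ := by ring
  refine ⟨fun ℓ h0 h1 => ?_, ?_, ?_, ?_⟩
  · obtain ⟨W, hW, hWF⟩ := exists_lambda_vecV τ (u t) (v t) (w t) h0 (by linarith) hfin
    exact ⟨W, hW, (hdec.inhomBesov_le hD ht h0 h1.le hWF).trans
      (hle _ _ (by linarith) (by positivity))⟩
  · obtain ⟨W, hW, hWF⟩ := exists_lambda_vecV τ (u t) (v t) (w t) (ℓ := 3 / 2) (by norm_num)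
      (by norm_num) hfin
    exact ⟨W, hW, (hdec.homBesov_le hD ht hWF).trans (hle _ _ (by linarith) (by positivity))⟩
  · have h := hdec.homBesov_w_le hτ hD ht (s := 3 / 2) (by norm_num) le_rfl
    rw [show (-3 / 4 - 3 / 2 / 2 : ℝ) = -3 / 2 by norm_num] at h
    exact h.trans (hle _ _ (by linarith) (by positivity))
  · have h := hdec.homBesov_w_le hτ hD ht (s := 0) le_rfl (by norm_num)
    rw [show (-3 / 4 - 0 / 2 : ℝ) = -3 / 4 by norm_num] at h
    exact h.trans (hle _ _ (by linarith) (by positivity))
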